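/- Let $\mathfrak g=sl_2(\mathbb C)$ with standard basis $E,F,H$ and form $\langle a,b\rangle=\operatorname{tr}(ab)$, let $\hat{\mathfrak g}=\mathfrak g\otimes\mathbb C[t,t^{-1}]\oplus\mathbb Cc$ be the affine Lie algebra with $c$ central and $[a\otimes t^m,b\otimes t^n]=[a,b]\otimes t^{m+n}+m\langle a,b\rangle\delta_{m+n,0}\,c$, and write $a(m)$ for the action of $a\otimes t^m$. Let $\lambda$ be the fundamental weight of $\mathfrak g$ (so $\lambda(H)=1$), and for integers $k,n\ge 0$ let $L(k,n)$ be the irreducible highest weight $\hat{\mathfrak g}$-module with highest weight $(k,n\lambda)$: it is the quotient of the Verma module, generated by a vector killed by $\hat{\mathfrak n}_+=\mathfrak g\otimes t\mathbb C[t]\oplus\mathbb CE\otimes 1$, on which $c$ acts by $k$ and $H(0)$ by $n$, by the sum of all its proper submodules. Let $\mathbf 1$ be the canonical highest weight vector of $L(k,0)$. Theorem 3.1 (the $sl_2(\mathbb C)$ case). Let $k$ be a positive integer. (a) There is a vertex algebra structure on $L(k,0)$ with vacuum $\mathbf 1$ and $Y(a(-1)\mathbf 1,x)=\sum_{m\in\mathbb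 Z}a(m)x^{-m-1}$ for all $a\in\mathfrak g$. For every such structure and every $0\le n\le k$ there is an $L(k,0)$-module structure $Y_{L(k,n)}$ on $L(k,n)$ with $Y_{L(k,n)}(a(-1)\mathbf 1,x)=\sum_{m\in\mathbb Z}a(m)x^{-m-1}$ for all $a\in\mathfrak g$. (b) Let $L(k,0)$ and the $L(k,m)$, $0\le m\le k$, carry any structures as in (a), let $H^{(1)}=\tfrac12H$ and $$\Delta(H^{(1)},x)=x^{H^{(1)}(0)}\exp\Big(\sum_{m\ge 1}\frac{H^{(1)}(m)}{-m}(-x)^{-m}\Big)$$ on $L(k,0)$. For $0\le n\le k$, the formula $Y^{(1)}(u,x)=Y_{L(k,n)}(\Delta(H^{(1)},x)u,x)$, $u\in L(k,0)$, defines an $L(k,0)$-module structure on the vector space $L(k,n)$. This module, denoted $(L(k,n))^{(1)}$, satisfies $$(L(k,n))^{(1)}\cong L(k,k-n)$$ as $L(k,0)$-modules. Moreover, if $v$ is a highest weight vector for $L(k,n)$, then $F(0)^nv$ is a highest weight vector for $(L(k,n))^{(1)}$, with weight $(k,(k-n)\lambda)$. Here a highest weight vector of an $L(k,0)$-module is a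 nonzero vector killed by $\hat{\mathfrak n}_+$ and an eigenvector of $c$ and $H\otimes 1$, where $\hat{\mathfrak g}$ acts through $a\otimes t^m\mapsto$ the coefficient of $x^{-m-1}$ in the vertex operator of $a(-1)\mathbf 1$, and $F(0)$ is the original action on $L(k,n)$. -/

import Mathlib

open scoped TensorProduct

attribute [local instance 100] LieRing.ofAssociativeRing

noncomputable section

namespace AffineSl2

/-! ### The Lie algebra `sl₂(ℂ)` -/

/-- The Lie algebra `sl₂(ℂ)` of traceless complex `2 × 2` matrices. -/
abbrev sl2 : Type := LieAlgebra.SpecialLinear.sl (Fin 2) ℂ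

/-- The matrix `E = (0 1; 0 0)`. -/
def E : sl2 := ⟨!![0, 1; 0, 0], by
  simp [LieAlgebra.SpecialLinear.sl, Matrix.trace_fin_two]⟩

/-- The matrix `F = (0 0; 1 0)`. -/
def F : sl2 := ⟨!![0, 0; 1, 0], by
  simp [LieAlgebra.SpecialLinear.sl, Matrix.trace_fin_two]⟩

/-- The matrix `H = (1 0; 0 -1)`, the coroot of the positive root `α`. -/
def H : sl2 := ⟨!![1, 0; 0, -1], by
  simp [LieAlgebra.SpecialLinear.sl, Matrix.trace_fin_two]⟩

/-- The fundamental coweight `H⁽¹⁾ = H / 2`. -/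
def coweight : sl2 := (1 / 2 : ℂ) • H

/-- The standard invariant form `⟨a, b⟩ = tr (a b)`, for which `‖α‖² = 2`. -/
def form : LinearMap.BilinForm ℂ sl2 :=
  LinearMap.mk₂ ℂ (fun a b => Matrix.trace (a.1 * b.1))
    (by intro a a' b; simp [add_mul])
    (by intro c a b; simp)
    (by intro a b b'; simp [mul_add])
    (by intro c a b; simp)

theorem form_apply (a b : sl2) : form a b = Matrix.trace (a.1 * b.1) := rfl

/-- Mathlib's cocycle attached to a form `Φ` sends `(a ⊗ t^m, b ⊗ t^n)` to `n Φ(a, b) δ_{m+n,0}`,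
so the cocycle `m ⟨a, b⟩ δ_{m+n,0}` is the one attached to `Φ = -⟨ , ⟩`. -/
theorem neg_form_lieInvariant : (-form).lieInvariant sl2 := by
  intro x y z
  have h := Matrix.trace_mul_cycle x.1 y.1 z.1
  have h' := Matrix.trace_mul_cycle z.1 x.1 y.1
  simp only [LinearMap.neg_apply, form_apply, LieAlgebra.SpecialLinear.sl_bracket, sub_mul,
    mul_sub, Matrix.trace_sub, ← Matrix.mul_assoc] at h h' ⊢
  rw [h, h']
  ring

theorem neg_form_isSymm : (-form).IsSymm := by
  constructor
  intro x y
  simp [form_apply, Matrix.trace_mul_comm x.1 y.1]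

/-! ### The affine Lie algebra -/

/-- The cocycle `(a ⊗ t^m, b ⊗ t^n) ↦ m ⟨a, b⟩ δ_{m+n,0}` on `sl₂ ⊗ ℂ[t, t⁻¹]`. -/
abbrev cocycle := LieAlgebra.LoopAlgebra.twoCocycleOfBilinear ℂ ℤ sl2 (-form)
  neg_form_lieInvariant neg_form_isSymm

/-- The affine Lie algebra `sl₂ ⊗ ℂ[t, t⁻¹] ⊕ ℂ c`. -/
abbrev Affine : Type := LieAlgebra.ofTwoCocycle cocycle

/-- The element `a ⊗ t^m`. -/
def loop (a : sl2) (m : ℤ) : Affine :=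
  LieAlgebra.ofProd cocycle (AddMonoidAlgebra.single m 1 ⊗ₜ[ℂ] a, 0)

/-- The central element `c`. -/
def central : Affine :=
  LieAlgebra.ofProd cocycle (0, (TrivialLieModule.equiv ℂ _ ℂ).symm 1)

theorem loop_bracket (a b : sl2) (m n : ℤ) :
    ⁅loop a m, loop b n⁆ =
      loop ⁅a, b⁆ (m + n) + (if m + n = 0 then (m : ℂ) * form a b else 0) • central := by
  have key : LieAlgebra.LoopAlgebra.residuePairing ℂ ℤ sl2 (-form)
      (AddMonoidAlgebra.single m 1 ⊗ₜ[ℂ] a) (AddMonoidAlgebra.single n 1 ⊗ₜ[ℂ] b)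
      = if m + n = 0 then (m : ℂ) * form a b else 0 := by
    rw [LieAlgebra.LoopAlgebra.residuePairing_apply_apply]
    simp only [LieAlgebra.LoopAlgebra.toFinsupp_single_tmul]
    rw [Finsupp.sum_single_index (by simp)]
    split_ifs with h
    · obtain rfl : m = -n := by omega
      simp
    · rw [Finsupp.single_eq_of_ne (by omega)]
      simp
  rw [loop, loop, LieAlgebra.bracket_ofTwoCocycle]
  simp only [Equiv.symm_apply_apply, loop, central, ← LieAlgebra.of_smul, ← LieAlgebra.of_add]
  refine congrArg _ (Prod.ext ?_ ?_)
  · rw [LieAlgebra.ExtendScalars.bracket_tmul, AddMonoidAlgebra.single_mul_single, mul_one]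
    simp only [Prod.fst_add, Prod.smul_fst, smul_zero, add_zero]
  · change (TrivialLieModule.equiv ℂ (LieAlgebra.loopAlgebra ℂ ℤ sl2) ℂ).symm
      (LieAlgebra.LoopAlgebra.residuePairing ℂ ℤ sl2 (-form)
      (AddMonoidAlgebra.single m 1 ⊗ₜ[ℂ] a) (AddMonoidAlgebra.single n 1 ⊗ₜ[ℂ] b)) +
      ⁅_, (0 : TrivialLieModule ℂ (LieAlgebra.loopAlgebra ℂ ℤ sl2) ℂ)⁆ -
      ⁅_, (0 : TrivialLieModule ℂ (LieAlgebra.loopAlgebra ℂ ℤ sl2) ℂ)⁆ = _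
    rw [key, lie_zero, lie_zero, add_zero, sub_zero]
    simp only [Prod.snd_add, Prod.smul_snd, zero_add, ← map_smul, smul_eq_mul, mul_one]

theorem central_bracket (x : Affine) : ⁅central, x⁆ = 0 := by
  rw [central, LieAlgebra.bracket_ofTwoCocycle, ← LieAlgebra.of_zero]
  refine congrArg _ (Prod.ext ?_ ?_) <;> simp [trivial_lie_zero]

/-- The universal enveloping algebra of the affine Lie algebra. -/
abbrev U : Type := UniversalEnvelopingAlgebra ℂ Affine

/-- The inclusion of the affine Lie algebra in its enveloping algebra. -/
abbrev inU (x : Affine) : U := UniversalEnvelopingAlgebra.ι ℂ x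

/-- The action of the affine Lie algebra on a module over its enveloping algebra. -/
def act (W : Type*) [AddCommGroup W] [Module ℂ W] [Module U W] [IsScalarTower ℂ U W] :
    Affine →ₗ⁅ℂ⁆ Module.End ℂ W :=
  (Algebra.lsmul ℂ ℂ W : U →ₐ[ℂ] Module.End ℂ W).toLieHom.comp (UniversalEnvelopingAlgebra.ι ℂ)

theorem act_apply {W : Type*} [AddCommGroup W] [Module ℂ W] [Module U W] [IsScalarTower ℂ U W]
    (x : Affine) (w : W) : act W x w = inU x • w := rfl

/-! ### Highest weight modules

Weights are pairs `(κ, μ)`: the central element acts by the level `κ`, and `H ⊗ 1` acts by `μ`,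
that is, the finite part of the weight is `μ λ`, where `λ` is the fundamental weight. -/

/-- A spanning set of `n₊ = sl₂ ⊗ t ℂ[t] ⊕ ℂ E ⊗ 1`, which is the subalgebra generated by the
Chevalley generators `e₀ = F ⊗ t` and `e₁ = E ⊗ 1`. -/
def nPlus : Set Affine :=
  {x | x = loop E 0 ∨ ∃ (a : sl2) (m : ℤ), 0 < m ∧ x = loop a m}

/-- `w` is a highest weight vector of weight `(κ, μ λ)` for the representation `ρ`. -/
structure IsHighestWeightVector {W : Type*} [AddCommGroup W] [Module ℂ W]
    (ρ : Affine →ₗ⁅ℂ⁆ Module.End ℂ W) (κ μ : ℂ) (w : W) : Prop where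
  ne_zero : w ≠ 0
  annihilated : ∀ x ∈ nPlus, ρ x w = 0
  level : ρ central w = κ • w
  weight : ρ (loop H 0) w = μ • w

/-- The left ideal of the enveloping algebra generated by `n₊`, `c - κ` and `H ⊗ 1 - μ`. -/
def vermaIdeal (κ μ : ℂ) : Submodule U U :=
  Submodule.span U (inU '' nPlus ∪
    {inU central - algebraMap ℂ U κ, inU (loop H 0) - algebraMap ℂ U μ})

/-- The Verma module of highest weight `(κ, μ λ)`. -/
abbrev Verma (κ μ : ℂ) : Type := U ⧸ vermaIdeal κ μ

/-- The sum of all proper submodules of the Verma module (its maximal proper submodule, as soon as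
the level is not critical). -/
def maxSubmodule (κ μ : ℂ) : Submodule U (Verma κ μ) :=
  sSup {N | N ≠ ⊤}

/-- `L(k, n)`: the irreducible highest weight module of level `k` and highest weight
`(k, n λ)`. -/
abbrev L (k n : ℕ) : Type := Verma k n ⧸ maxSubmodule k n

/-- The image in `L(k, n)` of `1`, the canonical highest weight vector. -/
def hwVec (k n : ℕ) : L k n :=
  (maxSubmodule k n).mkQ ((vermaIdeal k n).mkQ 1)

/-! ### Vertex algebras and their modules -/

/-- The `n`-th mode `Aₙ` of `A(x) = ∑ Aₙ x^(-n-1)`. -/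
abbrev nthMode {W : Type*} [AddCommGroup W] [Module ℂ W] (A : VertexOperator ℂ W) (n : ℤ) :
    Module.End ℂ W :=
  VertexOperator.ncoeff A n

/-- The Jacobi identity
`x₀⁻¹ δ((x₁ - x₂)/x₀) Y(u,x₁) Y(v,x₂) - x₀⁻¹ δ((x₂ - x₁)/(-x₀)) Y(v,x₂) Y(u,x₁)
  = x₂⁻¹ δ((x₁ - x₀)/x₂) Y(Y(u,x₀)v, x₂)`,
read off at the coefficients of `x₀^(-l-1) x₁^(-m-1) x₂^(-n-1)`, for all integers `l`, `m`, `n`.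
Here `nthMode (Y u) n` is the mode `uₙ`, the coefficient of `x^(-n-1)`. All sums are finite, since
vertex operators applied to a vector are Laurent series. -/
def JacobiIdentity {V W : Type*} [AddCommGroup V] [Module ℂ V] [AddCommGroup W] [Module ℂ W]
    (Y : V →ₗ[ℂ] VertexOperator ℂ V) (YW : V →ₗ[ℂ] VertexOperator ℂ W) : Prop :=
  ∀ (u v : V) (w : W) (l m n : ℤ),
    (∑ᶠ i : ℕ, ((-1 : ℂ) ^ i * (Ring.choose l i : ℤ)) •
        ((nthMode (YW u) (m + l - i)) ((nthMode (YW v) (n + i)) w))) -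
      (∑ᶠ i : ℕ, ((-1 : ℂ) ^ l * (-1 : ℂ) ^ i * (Ring.choose l i : ℤ)) •
        ((nthMode (YW v) (n + l - i)) ((nthMode (YW u) (m + i)) w))) =
    ∑ᶠ i : ℕ, ((Ring.choose m i : ℤ) : ℂ) • ((nthMode (YW ((nthMode (Y u) (l + i)) v)) (m + n - i)) w)

/-- A vertex algebra structure on the complex vector space `V`. -/
structure VertexAlgebra (V : Type*) [AddCommGroup V] [Module ℂ V] where
  /-- The vacuum vector. -/
  vac : V
  /-- The vertex operator map `v ↦ Y(v, x)`. -/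
  Y : V →ₗ[ℂ] VertexOperator ℂ V
  vac_mode : ∀ n : ℤ, (nthMode (Y vac) n) = if n = -1 then 1 else 0
  creation : ∀ (v : V) (n : ℤ), 0 ≤ n → (nthMode (Y v) n) vac = 0
  creation_limit : ∀ v : V, (nthMode (Y v) (-1)) vac = v
  jacobi : JacobiIdentity Y Y

/-- A structure on `W` of a module over the vertex algebra `𝒱`. -/
structure VertexModule {V : Type*} [AddCommGroup V] [Module ℂ V] (𝒱 : VertexAlgebra V)
    (W : Type*) [AddCommGroup W] [Module ℂ W] where
  /-- The vertex operator map `v ↦ Y_W(v, x)`. -/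
  Y : V →ₗ[ℂ] VertexOperator ℂ W
  vac_mode : ∀ n : ℤ, (nthMode (Y 𝒱.vac) n) = if n = -1 then 1 else 0
  jacobi : JacobiIdentity 𝒱.Y Y

/-- Isomorphism of modules over a vertex algebra. -/
def VertexModule.Isomorphic {V W W' : Type*} [AddCommGroup V] [Module ℂ V]
    [AddCommGroup W] [Module ℂ W] [AddCommGroup W'] [Module ℂ W'] {𝒱 : VertexAlgebra V}
    (M : VertexModule 𝒱 W) (M' : VertexModule 𝒱 W') : Prop :=
  ∃ f : W ≃ₗ[ℂ] W', ∀ (v : V) (n : ℤ) (w : W), f ((nthMode (M.Y v) n) w) = (nthMode (M'.Y v) n) (f w)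

/-! ### Li's operators -/

/-- The coefficient of `z^p` in `exp(A(z))`, for an operator valued power series `A` without
constant term; the powers `A^j` with `j > p` do not contribute to it. -/
def expCoeff {V : Type*} [AddCommGroup V] [Module ℂ V] (A : PowerSeries (Module.End ℂ V)) (p : ℕ) :
    Module.End ℂ V :=
  ∑ j ∈ Finset.range (p + 1), ((j.factorial : ℂ)⁻¹) • PowerSeries.coeff p (A ^ j)

/-- The series `∑_{n ≥ 1} h(n)/(-n) (-x)^(-n)` as a power series in `z = x⁻¹`. -/
def deltaSeries {V : Type*} [AddCommGroup V] [Module ℂ V]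
    (ρ : Affine →ₗ⁅ℂ⁆ Module.End ℂ V) (h : sl2) : PowerSeries (Module.End ℂ V) :=
  PowerSeries.mk fun n => if n = 0 then 0 else ((-1 : ℂ) ^ n / (-(n : ℂ))) • ρ (loop h n)

/-- The component of a vector in the eigenspace of `T` for the eigenvalue `r`, along the other
eigenspaces, when `T` is diagonalizable: the inclusion of `⨁ r, eigenspace T r` in `V` is always
injective, and it is then bijective. -/
def eigenComponent {V : Type*} [AddCommGroup V] [Module ℂ V] (T : Module.End ℂ V) (r : ℂ) :
    Module.End ℂ V :=
  (Module.End.eigenspace T r).subtype ∘ₗ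
    DirectSum.component ℂ ℂ (fun s => Module.End.eigenspace T s) r ∘ₗ
      (DirectSum.coeLinearMap (fun s => Module.End.eigenspace T s)).leftInverse

/-- On an eigenvector the component is what it should be. -/
theorem eigenComponent_of_mem {V : Type*} [AddCommGroup V] [Module ℂ V] (T : Module.End ℂ V)
    (r s : ℂ) (v : V) (hv : T v = s • v) :
    eigenComponent T r v = if s = r then v else 0 := by
  classical
  have hinj : LinearMap.ker (DirectSum.coeLinearMap (fun s => Module.End.eigenspace T s)) = ⊥ :=
    LinearMap.ker_eq_bot.2 (Module.End.eigenspaces_iSupIndep T).dfinsupp_lsum_injective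
  have hmem : v ∈ Module.End.eigenspace T s := Module.End.mem_eigenspace_iff.2 hv
  have h := LinearMap.leftInverse_apply_of_inj hinj
    (DirectSum.lof ℂ ℂ (fun s => Module.End.eigenspace T s) s ⟨v, hmem⟩)
  rw [DirectSum.coeLinearMap_lof] at h
  simp only [eigenComponent, LinearMap.comp_apply]
  rw [h]
  split_ifs with hsr
  · subst hsr
    simp [DirectSum.component.lof_self]
  · simp [DirectSum.component.of, hsr]

/-- The coefficient of `x^q` (`q` an integer) in
`Δ(h,x) v = x^{h(0)} exp(∑_{n ≥ 1} h(n)/(-n) (-x)^(-n)) v`.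
Here `x^{h(0)} u = x^r u` for an eigenvector `u` of `h(0)` with eigenvalue `r`; so the coefficient
of `x^q` collects, over all `p`, the component of eigenvalue `q + p` of the coefficient of
`x^(-p)` of the exponential. Only integral eigenvalues occur for a coweight `h` on `L(k, 0)`. -/
def deltaCoeff {V : Type*} [AddCommGroup V] [Module ℂ V]
    (ρ : Affine →ₗ⁅ℂ⁆ Module.End ℂ V) (h : sl2) (q : ℤ) (v : V) : V :=
  ∑ᶠ p : ℕ, eigenComponent (ρ (loop h 0)) ((q + p : ℤ) : ℂ) (expCoeff (deltaSeries ρ h) p v)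

/-! ### The vertex algebra `L(k, 0)` -/

/-- The vector `a = a(-1) 𝟏` of `L(k, 0)`. -/
def gen (k : ℕ) (a : sl2) : L k 0 := act (L k 0) (loop a (-1)) (hwVec k 0)

/-- The vertex algebra structure on `L(k, 0)` is the one attached to its affine Lie algebra
structure: the vacuum is the highest weight vector, and
`Y(a(-1) 𝟏, x) = ∑ a(n) x^(-n-1)`. -/
def IsAffineVertexAlgebra (k : ℕ) (𝒱 : VertexAlgebra (L k 0)) : Prop :=
  𝒱.vac = hwVec k 0 ∧ ∀ (a : sl2) (n : ℤ), (nthMode (𝒱.Y (gen k a)) n) = act (L k 0) (loop a n)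

/-- The `L(k, 0)`-module structure on `L(k, n)` is the one attached to its affine Lie algebra
structure: `Y(a(-1) 𝟏, x) = ∑ a(n) x^(-n-1)`. -/
def IsAffineVertexModule {k n : ℕ} {𝒱 : VertexAlgebra (L k 0)}
    (M : VertexModule 𝒱 (L k n)) : Prop :=
  ∀ (a : sl2) (m : ℤ), (nthMode (M.Y (gen k a)) m) = act (L k n) (loop a m)

/-- `N` is the twist `M^{(h)}` of `M`: it has the same underlying space, and
`Y_N(v,x) = Y_M(Δ(h,x) v, x)`. -/
def IsTwist {k : ℕ} {𝒱 : VertexAlgebra (L k 0)} {W : Type*} [AddCommGroup W] [Module ℂ W]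
    (h : sl2) (M N : VertexModule 𝒱 W) : Prop :=
  ∀ (v : L k 0) (m : ℤ),
    (nthMode (N.Y v) m) = ∑ᶠ q : ℤ, (nthMode (M.Y (deltaCoeff (act (L k 0)) h q v)) (m + q))

/-- `w` is a highest weight vector of weight `(κ, μ λ)` of the `L(k, 0)`-module `M`, for the
representation of the affine Lie algebra on `M` in which `a ⊗ t^m` acts as the `m`-th mode of
`a = a(-1) 𝟏` (there is at most one such representation, since `c` is a combination of brackets). -/
def VertexModule.IsHighestWeightVector {k : ℕ} {𝒱 : VertexAlgebra (L k 0)} {W : Type*}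
    [AddCommGroup W] [Module ℂ W] (M : VertexModule 𝒱 W) (κ μ : ℂ) (w : W) : Prop :=
  ∃ ρ : Affine →ₗ⁅ℂ⁆ Module.End ℂ W,
    (∀ (a : sl2) (m : ℤ), ρ (loop a m) = (nthMode (M.Y (gen k a)) m)) ∧
      AffineSl2.IsHighestWeightVector ρ κ μ w

end AffineSl2

end

/-! The vertex algebra is realized by fields. On a restricted representation `W` of level `k`, the
currents `a(x) = ∑ a(m) x^(-m-1)` satisfy a commutator formula (locality), and `a ⊗ t^m` acts on the
space of all fields on `W` by the `m`-th residue product with `a(x)` (`fprod`). By `fprod_comm_sub`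
this is again a representation of level `k`, in which the identity field is a vacuum vector. Dong's
lemma (`HasComm.loc_fprod`) makes the fields generated from the identity (`vfld`) mutually local and
closed under products, and local fields satisfy the Jacobi identity (`HasComm.bor_eq`). Thus it is
enough to identify `vfld` with a copy of `L(k, 0)`: the identification is then the state-field map
(`exists_fieldMap`).

The identification uses two facts. First, a cyclic highest weight representation of weight `0` in
which `F(0)` and `E(-1)` are nilpotent on the generator is irreducible (`HW.irr`). In a nonzero
invariant subspace, a weight vector of least principal degree is singular; nilpotency for the two
simple roots forces its weight `i` to satisfy `0 ≤ i ≤ k`, and the Sugawara operator evaluates its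
degree as `-i(k - i)/(k + 2) ≤ 0`. Degrees being nonnegative, the vector spans the vacuum line.
Secondly, the field `E(x)^(k+1)` vanishes on `L(k, n)` for `n ≤ k`. It is a singular vector among
the fields, so the modes of the `sl₂`-module it generates span a subrepresentation of `L(k, n)`;
modulo the images of the `a(m)` with `m < 0` it acts on the top component through `E(0)^(k+1) = 0`,
so that subrepresentation is proper, hence zero (`HW.field_eq_zero`).

Field maps send products of states to products of fields. This is seen on the direct sum of `L(k,
0)` and `W`, whose field map projects to both (`IsStateField.map_mode_of_prod`). Conversely every
module structure with the prescribed currents comes from a field map (`isFieldMap_of_module`), so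
arbitrary structures can be treated.

For the twist, let `E(m)` act as `E(m + 1)`, `F(m)` as `F(m - 1)`, and shift `H(0)` by the level.
Invariant subspaces do not change, and on `L(k, n)` the vector `F(0)^n v` becomes a highest weight
vector of weight `k - n`. Hence the twisted representation is `L(k, k - n)` and has a field map of
its own. That this map is `Y(Δ(H/2, x) v, x)` is checked on the vacuum and propagated by `E(-1)` and
`F(0)`: conjugation by the exponential factor multiplies `E ⊗ t^m` by `1 + zt` and `F ⊗ t^m` by `(1
+ zt)⁻¹`, where `z = x⁻¹`. The formula therefore inherits the module axioms from the field map.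

The argument never needs to know beforehand that `L(k, n)` is nonzero: the zero case is treated
separately where it matters. -/

noncomputable section

namespace AffineSl2

/-! ### Binomial coefficients with integral upper entry -/

/-- The binomial coefficient `l` choose `i`, as a complex number. -/
def ch (l : ℤ) (i : ℕ) : ℂ := ((Ring.choose l i : ℤ) : ℂ)

@[simp] theorem ch_zero (l : ℤ) : ch l 0 = 1 := by simp [ch]

@[simp] theorem ch_zero_succ (i : ℕ) : ch 0 (i + 1) = 0 := by
  simp [ch, Ring.choose_zero_succ]

theorem ch_succ_succ (l : ℤ) (i : ℕ) : ch (l + 1) (i + 1) = ch l i + ch l (i + 1) := by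
  simp [ch, Ring.choose_succ_succ]

theorem ch_natCast (n i : ℕ) : ch n i = (n.choose i : ℂ) := by
  simp [ch, Ring.choose_natCast]

theorem ch_natCast_of_lt {n i : ℕ} (h : n < i) : ch n i = 0 := by
  simp [ch_natCast, Nat.choose_eq_zero_of_lt h]

theorem ch_mul_ch (l : ℤ) (i j : ℕ) :
    ch l i * ch (l - i) j = ((i + j).choose i : ℂ) * ch l (i + j) := by
  have h := Ring.choose_smul_choose l (Nat.le_add_right i j)
  rw [Nat.add_sub_cancel_left, nsmul_eq_mul] at h
  simp only [ch]
  exact_mod_cast h.symm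

theorem ch_mul_ch_comm (l : ℤ) (i j : ℕ) : ch l i * ch (l - i) j = ch l j * ch (l - j) i := by
  rw [ch_mul_ch, ch_mul_ch, add_comm j i, Nat.choose_symm_add]

theorem ch_mul_ch_natCast (l : ℤ) (i j : ℕ) :
    ch l (j + i) * ch ((j + i : ℕ) : ℤ) j = ch l j * ch (l - j) i := by
  rw [ch_mul_ch, ch_natCast, mul_comm]

theorem sum_ch_mul_ch (a b : ℤ) (t : ℕ) :
    ∑ x ∈ Finset.HasAntidiagonal.antidiagonal t, ch a x.1 * ch b x.2 = ch (a + b) t := by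
  have h := Ring.add_choose_eq t (Commute.all a b)
  simp only [ch]
  exact_mod_cast h.symm

/-- Upper negation; it absorbs the signs of alternating sums so that Vandermonde's identity applies.
-/
theorem neg_one_pow_mul_ch (l : ℤ) (s : ℕ) : (-1) ^ s * ch l s = ch (s - 1 - l) s := by
  have h := Ring.choose_neg (-l) s
  rw [neg_neg] at h
  simp only [ch]
  rw [h, show -l + (s : ℤ) - 1 = s - 1 - l by ring, Units.smul_def, smul_eq_mul,
    Int.negOnePow_def]
  push_cast
  rw [← mul_assoc]
  simp [← mul_pow]

theorem succ_mul_ch (l : ℤ) (i : ℕ) : ((i : ℂ) + 1) * ch l (i + 1) = l * ch (l - 1) i := by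
  have h := ch_mul_ch l 1 i
  simp only [add_comm 1 i, Nat.choose_one_right] at h
  push_cast at h
  rw [← h]
  simp [ch]

/-- The alternating sums which invert a binomial expansion. -/
theorem ch_eq_sum_skew (p q : ℤ) (i : ℕ) :
    ch p i = ∑ j ∈ Finset.range (i + 1), (-1) ^ j * ch q j * ch (p + q - j) (i - j) := by
  -- Upper negation of the last factor makes its upper entry independent of `j`, which leaves a
  -- Vandermonde convolution.
  have h1 : ∀ j ∈ Finset.range (i + 1), (-1) ^ j * ch q j * ch (p + q - j) (i - j) =
      (-1) ^ i * (ch q j * ch (i - 1 - p - q) (i - j)) := by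
    intro j hj
    have hj' : j ≤ i := Nat.lt_succ_iff.1 (Finset.mem_range.1 hj)
    have h2 := neg_one_pow_mul_ch (p + q - j) (i - j)
    rw [Nat.cast_sub hj', show (i : ℤ) - j - 1 - (p + q - j) = i - 1 - p - q by ring] at h2
    rw [← h2]
    obtain ⟨s, rfl⟩ := Nat.exists_eq_add_of_le hj'
    rw [Nat.add_sub_cancel_left, pow_add]
    have : ((-1 : ℂ) ^ s) * (-1) ^ s = 1 := by rw [← mul_pow]; simp
    linear_combination (-((-1) ^ j * ch q j * ch (p + q - j) s)) * this
  rw [Finset.sum_congr rfl h1, ← Finset.mul_sum,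
    ← Finset.Nat.sum_antidiagonal_eq_sum_range_succ (fun x y => ch q x * ch (i - 1 - p - q) y),
    sum_ch_mul_ch, show q + (i - 1 - p - q) = (i : ℤ) - 1 - p by ring, ← neg_one_pow_mul_ch,
    ← mul_assoc, ← mul_pow]
  simp

/-! ### Finite sums -/

section sums

variable {M : Type*} [AddCommGroup M]

theorem finsum_eq_sum_range {f : ℕ → M} (K : ℕ) (h : ∀ i, K ≤ i → f i = 0) :
    ∑ᶠ i, f i = ∑ i ∈ Finset.range K, f i := by
  refine finsum_eq_sum_of_support_subset f fun i hi => ?_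
  by_contra hK
  exact hi (h i (by simpa using hK))

theorem sum_range_eq_sum_range {f : ℕ → M} {J K : ℕ} (hJK : J ≤ K) (h : ∀ i, J ≤ i → f i = 0) :
    ∑ i ∈ Finset.range J, f i = ∑ i ∈ Finset.range K, f i :=
  Finset.sum_subset (Finset.range_mono hJK) fun i _ hi => h i (by simpa using hi)

theorem sum_range_shift {f : ℕ → M} {K : ℕ} (j : ℕ) (h : ∀ i, K ≤ i → f i = 0)
    (h' : ∀ i, i < j → f i = 0) :
    ∑ i ∈ Finset.range K, f i = ∑ i ∈ Finset.range K, f (j + i) := by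
  rw [sum_range_eq_sum_range (Nat.le_add_left K j) h, Finset.sum_range_add,
    Finset.sum_eq_zero fun i hi => h' i (Finset.mem_range.1 hi), zero_add]

variable [Module ℂ M]

/-- Since `y` vanishes from `K` on, the square of indices may be replaced by the triangle `i + s <
K` and regrouped along diagonals. It multiplies two binomial series that act through the same total
index. -/
theorem sum_box (K : ℕ) (c d : ℕ → ℂ) (y : ℕ → M) (hy : ∀ t, K ≤ t → y t = 0) :
    ∑ i ∈ Finset.range K, ∑ s ∈ Finset.range K, (c i * d s) • y (i + s) =
      ∑ t ∈ Finset.range K, (∑ x ∈ Finset.HasAntidiagonal.antidiagonal t, c x.1 * d x.2) • y t := by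
  have h1 : ∀ i ∈ Finset.range K, ∑ s ∈ Finset.range K, (c i * d s) • y (i + s) =
      ∑ t ∈ Finset.range K, if i ≤ t then (c i * d (t - i)) • y t else 0 := by
    intro i _
    have h := sum_range_shift (M := M) (K := K) i
      (f := fun t => if i ≤ t then (c i * d (t - i)) • y t else 0)
      (fun t ht => by simp [hy t ht]) (fun t ht => by simp [Nat.not_le.2 ht])
    simpa using h.symm
  rw [Finset.sum_congr rfl h1, Finset.sum_comm]
  refine Finset.sum_congr rfl fun t ht => ?_
  rw [Finset.Nat.sum_antidiagonal_eq_sum_range_succ (fun x y => c x * d y), Finset.sum_smul,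
    ← sum_range_eq_sum_range (J := t + 1) (K := K) (f := fun i => if i ≤ t then
      (c i * d (t - i)) • y t else 0)]
  · exact Finset.sum_congr rfl fun i hi => by
      rw [if_pos (Nat.lt_succ_iff.1 (Finset.mem_range.1 hi))]
  · exact Finset.mem_range.1 ht
  · intro i hi
    rw [if_neg (by omega)]

end sums

/-- The coefficient form of `(1 - z)^a (1 - z)^b = (1 - z)^(a + b)`. -/
theorem sum_antidiagonal_neg_one_pow_mul_ch (a b : ℤ) (t : ℕ) :
    ∑ x ∈ Finset.HasAntidiagonal.antidiagonal t, ((-1) ^ x.1 * ch a x.1) * ((-1) ^ x.2 * ch b x.2) =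
      (-1) ^ t * ch (a + b) t := by
  rw [← sum_ch_mul_ch, Finset.mul_sum]
  refine Finset.sum_congr rfl fun x hx => ?_
  rw [← Finset.HasAntidiagonal.mem_antidiagonal.1 hx, pow_add]
  ring

/-! ### Fields and their products -/

/-- The fields on `W`, given by their modes. -/
structure Fld (W : Type*) [AddCommGroup W] [Module ℂ W] where
  /-- The `n`-th mode. -/
  val : ℤ → Module.End ℂ W
  trunc : ∀ w, ∃ N : ℤ, ∀ n, N ≤ n → val n w = 0

section fields

variable {W : Type*} [AddCommGroup W] [Module ℂ W]

theorem Fld.val_injective : Function.Injective (Fld.val : Fld W → ℤ → Module.End ℂ W) := by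
  rintro ⟨f, _⟩ ⟨g, _⟩ h
  congr

theorem Fld.ext {f g : Fld W} (h : ∀ n w, f.1 n w = g.1 n w) : f = g :=
  Fld.val_injective (funext fun n => LinearMap.ext (h n))

instance : Zero (Fld W) := ⟨⟨0, fun _ => ⟨0, by simp⟩⟩⟩

instance : Add (Fld W) := ⟨fun f g => ⟨f.1 + g.1, fun w => by
  obtain ⟨N, hN⟩ := f.2 w
  obtain ⟨N', hN'⟩ := g.2 w
  exact ⟨max N N', fun n hn => by
    simp [hN n (le_of_max_le_left hn), hN' n (le_of_max_le_right hn)]⟩⟩⟩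

instance {R : Type*} [Monoid R] [DistribMulAction R W] [SMulCommClass ℂ R W] : SMul R (Fld W) :=
  ⟨fun c f => ⟨c • f.1, fun w => by
    obtain ⟨N, hN⟩ := f.2 w
    exact ⟨N, fun n hn => by simp [hN n hn]⟩⟩⟩

instance : Neg (Fld W) := ⟨fun f => ⟨-f.1, fun w => by
  obtain ⟨N, hN⟩ := f.2 w
  exact ⟨N, fun n hn => by simp [hN n hn]⟩⟩⟩

instance : Sub (Fld W) := ⟨fun f g => ⟨f.1 - g.1, fun w => by
  obtain ⟨N, hN⟩ := f.2 w
  obtain ⟨N', hN'⟩ := g.2 w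
  exact ⟨max N N', fun n hn => by
    simp [hN n (le_of_max_le_left hn), hN' n (le_of_max_le_right hn)]⟩⟩⟩

instance : AddCommGroup (Fld W) :=
  Fld.val_injective.addCommGroup _ rfl (fun _ _ => rfl) (fun _ => rfl) (fun _ _ => rfl)
    (fun _ _ => rfl) (fun _ _ => rfl)

instance : Module ℂ (Fld W) :=
  Fld.val_injective.module ℂ ⟨⟨Fld.val, rfl⟩, fun _ _ => rfl⟩ (fun _ _ => rfl)

theorem Fld.add_apply (f g : Fld W) (n : ℤ) (w : W) : (f + g).1 n w = f.1 n w + g.1 n w := rfl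

theorem Fld.sub_apply (f g : Fld W) (n : ℤ) (w : W) : (f - g).1 n w = f.1 n w - g.1 n w := rfl

theorem Fld.smul_apply (c : ℂ) (f : Fld W) (n : ℤ) (w : W) : (c • f).1 n w = c • f.1 n w := rfl

theorem Fld.zero_apply (n : ℤ) (w : W) : (0 : Fld W).1 n w = 0 := rfl

theorem Fld.sum_apply {ι : Type*} (s : Finset ι) (f : ι → Fld W) (n : ℤ) (w : W) :
    (∑ i ∈ s, f i).1 n w = ∑ i ∈ s, (f i).1 n w := by
  classical
  induction s using Finset.induction_on with
  | empty => simp [Fld.zero_apply]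
  | insert i s hi ih => rw [Finset.sum_insert hi, Finset.sum_insert hi, Fld.add_apply, ih]

theorem Fld.exists_bound (f : Fld W) (w : W) (n : ℤ) :
    ∃ K : ℕ, ∀ i : ℕ, K ≤ i → f.1 (n + i) w = 0 := by
  obtain ⟨N, hN⟩ := f.2 w
  exact ⟨(N - n).toNat, fun i hi => hN _ (by omega)⟩

/-- The bound is uniform in `i` because only finitely many of the vectors `a.1 (p + i) w` are
nonzero. -/
theorem Fld.exists_bound_comp (a b : Fld W) (w : W) (p q : ℤ) :
    ∃ K : ℕ, ∀ s i : ℕ, K ≤ s → b.1 (q + s) (a.1 (p + i) w) = 0 := by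
  obtain ⟨K, hK⟩ := Fld.exists_bound a w p
  have h : ∀ L : ℕ, ∃ K' : ℕ, ∀ s i : ℕ, i < L → K' ≤ s → b.1 (q + s) (a.1 (p + i) w) = 0 := by
    intro L
    induction L with
    | zero => exact ⟨0, fun s i hi => absurd hi (by omega)⟩
    | succ L ih =>
      obtain ⟨K', hK'⟩ := ih
      obtain ⟨K'', hK''⟩ := Fld.exists_bound b (a.1 (p + L) w) q
      refine ⟨max K' K'', fun s i hi hs => ?_⟩
      rcases Nat.lt_succ_iff_lt_or_eq.1 hi with h | rfl
      · exact hK' s i h (by omega)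
      · exact hK'' s (by omega)
  obtain ⟨K', hK'⟩ := h K
  refine ⟨K', fun s i hs => ?_⟩
  rcases lt_or_ge i K with h | h
  · exact hK' s i h hs
  · rw [hK i h, map_zero]

/-- The coefficient of `x₁^(-p-1) x₂^(-n-1)` in `(x₁ - x₂)^l a(x₁) f(x₂)`, with the residue
convention that `p` is shifted by `l`. -/
def nop (a f : Fld W) (l p n : ℤ) : Module.End ℂ W where
  toFun w := ∑ᶠ i : ℕ, ((-1) ^ i * ch l i) • a.1 (p + l - i) (f.1 (n + i) w)
  map_add' w w' := by
    obtain ⟨K, hK⟩ := Fld.exists_bound f w n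
    obtain ⟨K', hK'⟩ := Fld.exists_bound f w' n
    rw [finsum_eq_sum_range (max K K') fun i hi => by
        rw [map_add, hK i (le_of_max_le_left hi), hK' i (le_of_max_le_right hi)]; simp,
      finsum_eq_sum_range (max K K') fun i hi => by
        rw [hK i (le_of_max_le_left hi)]; simp,
      finsum_eq_sum_range (max K K') fun i hi => by
        rw [hK' i (le_of_max_le_right hi)]; simp, ← Finset.sum_add_distrib]
    simp
  map_smul' c w := by
    obtain ⟨K, hK⟩ := Fld.exists_bound f w n
    rw [finsum_eq_sum_range K fun i hi => by rw [map_smul, hK i hi]; simp,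
      finsum_eq_sum_range K fun i hi => by rw [hK i hi]; simp, RingHom.id_apply,
      Finset.smul_sum]
    simp only [map_smul]
    exact Finset.sum_congr rfl fun i _ => smul_comm _ _ _

theorem nop_apply (a f : Fld W) (l p n : ℤ) (w : W) : nop a f l p n w =
    ∑ᶠ i : ℕ, ((-1) ^ i * ch l i) • a.1 (p + l - i) (f.1 (n + i) w) := rfl

theorem nop_eq_sum (a f : Fld W) (l p n : ℤ) (w : W) (K : ℕ)
    (h : ∀ i : ℕ, K ≤ i → f.1 (n + i) w = 0) : nop a f l p n w =
    ∑ i ∈ Finset.range K, ((-1) ^ i * ch l i) • a.1 (p + l - i) (f.1 (n + i) w) :=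
  finsum_eq_sum_range K fun i hi => by rw [h i hi]; simp

theorem nop_eq_zero (a f : Fld W) (l p n : ℤ) (w : W)
    (h : ∀ i : ℕ, f.1 (n + i) w = 0) : nop a f l p n w = 0 := by
  rw [nop_eq_sum a f l p n w 0 fun i _ => h i]
  simp

theorem nop_add_left (a a' f : Fld W) (l p n : ℤ) (w : W) :
    nop (a + a') f l p n w = nop a f l p n w + nop a' f l p n w := by
  obtain ⟨K, hK⟩ := Fld.exists_bound f w n
  simp only [nop_eq_sum _ f l p n w K hK, Fld.add_apply, smul_add, Finset.sum_add_distrib]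

theorem nop_smul_left (c : ℂ) (a f : Fld W) (l p n : ℤ) (w : W) :
    nop (c • a) f l p n w = c • nop a f l p n w := by
  obtain ⟨K, hK⟩ := Fld.exists_bound f w n
  simp only [nop_eq_sum _ f l p n w K hK, Fld.smul_apply, Finset.smul_sum]
  exact Finset.sum_congr rfl fun i _ => smul_comm _ _ _

theorem nop_add_right (a f f' : Fld W) (l p n : ℤ) (w : W) :
    nop a (f + f') l p n w = nop a f l p n w + nop a f' l p n w := by
  obtain ⟨K, hK⟩ := Fld.exists_bound f w n
  obtain ⟨K', hK'⟩ := Fld.exists_bound f' w n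
  rw [nop_eq_sum a f l p n w (max K K') fun i hi => hK i (le_of_max_le_left hi),
    nop_eq_sum a f' l p n w (max K K') fun i hi => hK' i (le_of_max_le_right hi),
    nop_eq_sum a _ l p n w (max K K') fun i hi => by
      rw [Fld.add_apply, hK i (le_of_max_le_left hi), hK' i (le_of_max_le_right hi), add_zero]]
  simp only [Fld.add_apply, map_add, smul_add, Finset.sum_add_distrib]

theorem nop_smul_right (c : ℂ) (a f : Fld W) (l p n : ℤ) (w : W) :
    nop a (c • f) l p n w = c • nop a f l p n w := by
  obtain ⟨K, hK⟩ := Fld.exists_bound f w n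
  rw [nop_eq_sum a f l p n w K hK, nop_eq_sum a _ l p n w K fun i hi => by
      rw [Fld.smul_apply, hK i hi, smul_zero], Finset.smul_sum]
  simp only [Fld.smul_apply, map_smul]
  exact Finset.sum_congr rfl fun i _ => smul_comm _ _ _

/-- `nop a f l p n` as a field in the variable of `f`. -/
def lmul (l p : ℤ) : Fld W →ₗ[ℂ] Fld W →ₗ[ℂ] Fld W :=
  LinearMap.mk₂ ℂ (fun a f => ⟨fun n => nop a f l p n, fun w => by
      obtain ⟨N, hN⟩ := f.2 w
      exact ⟨N, fun n hn => nop_eq_zero _ _ _ _ _ _ fun i => hN _ (by omega)⟩⟩)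
    (fun a a' f => Fld.ext fun n w => nop_add_left a a' f l p n w)
    (fun c a f => Fld.ext fun n w => nop_smul_left c a f l p n w)
    (fun a f f' => Fld.ext fun n w => nop_add_right a f f' l p n w)
    (fun c a f => Fld.ext fun n w => nop_smul_right c a f l p n w)

/-- `nop f a l n p` as a field in the variable of `f`. -/
def rmul (l p : ℤ) : Fld W →ₗ[ℂ] Fld W →ₗ[ℂ] Fld W :=
  LinearMap.mk₂ ℂ (fun a f => ⟨fun n => nop f a l n p, fun w => by
      obtain ⟨K, hK⟩ := Fld.exists_bound a w p
      obtain ⟨K', hK'⟩ := Fld.exists_bound_comp a f w p 0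
      -- Only the terms `i < K` occur, so this bound keeps every mode index `n + l - i` at or above
      -- `K'`.
      refine ⟨K' - l + K, fun n hn => ?_⟩
      rw [nop_eq_sum f a l n p w K hK]
      refine Finset.sum_eq_zero fun i hi => ?_
      have h := hK' (n + l - i).toNat i (by have := Finset.mem_range.1 hi; omega)
      rw [show (0 : ℤ) + ((n + l - i).toNat : ℤ) = n + l - i by
        have := Finset.mem_range.1 hi; omega] at h
      rw [h, smul_zero]⟩)
    (fun a a' f => Fld.ext fun n w => nop_add_right f a a' l n p w)
    (fun c a f => Fld.ext fun n w => nop_smul_right c f a l n p w)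
    (fun a f f' => Fld.ext fun n w => nop_add_left f f' a l n p w)
    (fun c a f => Fld.ext fun n w => nop_smul_left c f a l n p w)

theorem lmul_apply (l p : ℤ) (a f : Fld W) (n : ℤ) : (lmul l p a f).1 n = nop a f l p n := rfl

theorem rmul_apply (l p : ℤ) (a f : Fld W) (n : ℤ) : (rmul l p a f).1 n = nop f a l n p := rfl

/-- The left-hand side of the Jacobi identity for the fields `a` and `f`. -/
def bor (l p : ℤ) : Fld W →ₗ[ℂ] Fld W →ₗ[ℂ] Fld W :=
  lmul l p - ((-1 : ℂ) ^ l) • rmul l p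

theorem bor_apply (l p : ℤ) (a f : Fld W) (n : ℤ) (w : W) :
    (bor l p a f).1 n w = nop a f l p n w - (-1 : ℂ) ^ l • nop f a l n p w := rfl

/-- The `l`-th product of two fields. -/
abbrev fprod (l : ℤ) : Fld W →ₗ[ℂ] Fld W →ₗ[ℂ] Fld W := bor l 0

theorem nop_zero (a f : Fld W) (p n : ℤ) (w : W) : nop a f 0 p n w = a.1 p (f.1 n w) := by
  rw [nop_apply, finsum_eq_sum_range 1]
  · simp
  · intro i hi
    obtain ⟨i, rfl⟩ := Nat.exists_eq_add_of_le' hi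
    simp

/-- Pascal's rule, that is, `(x₁ - x₂)^(l+1) = (x₁ - x₂) (x₁ - x₂)^l`: the factor `x₁` shifts `p`
and the factor `x₂` shifts `n`. -/
theorem nop_succ (a f : Fld W) (l p n : ℤ) (w : W) :
    nop a f (l + 1) p n w = nop a f l (p + 1) n w - nop a f l p (n + 1) w := by
  obtain ⟨K, hK⟩ := Fld.exists_bound f w n
  rw [nop_eq_sum a f (l + 1) p n w (K + 1) fun i hi => hK i (by omega),
    nop_eq_sum a f l (p + 1) n w (K + 1) fun i hi => hK i (by omega),
    nop_eq_sum a f l p (n + 1) w K fun i hi => by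
      rw [show n + 1 + (i : ℤ) = n + (i + 1 : ℕ) by push_cast; ring]; exact hK _ (by omega),
    Finset.sum_range_succ', Finset.sum_range_succ' _ K]
  have key : ∀ A B C D B' : W, A = B - B' → D = C → A + D = B + C - B' := by
    rintro A B C D B' rfl rfl
    abel
  refine key _ _ _ _ _ ?_ ?_
  · rw [← Finset.sum_sub_distrib]
    refine Finset.sum_congr rfl fun i _ => ?_
    rw [ch_succ_succ, show n + 1 + (i : ℤ) = n + (i + 1 : ℕ) by push_cast; ring,
      show p + 1 + l - ((i + 1 : ℕ) : ℤ) = p + (l + 1) - (i + 1 : ℕ) by ring,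
      show p + l - (i : ℤ) = p + (l + 1) - (i + 1 : ℕ) by push_cast; ring, ← sub_smul]
    congr 1
    ring
  · simp [show p + 1 + l = p + (l + 1) by ring]

theorem bor_zero (a f : Fld W) (p n : ℤ) (w : W) :
    (bor 0 p a f).1 n w = a.1 p (f.1 n w) - f.1 n (a.1 p w) := by
  rw [bor_apply, nop_zero, nop_zero, zpow_zero, one_smul]

/-- Multiplication by `x₁ - x₂` again. The Jacobi identity for fields is proved by matching this
recursion with `sum_ch_smul_succ`. -/
theorem bor_succ (a f : Fld W) (l p n : ℤ) (w : W) :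
    (bor (l + 1) p a f).1 n w = (bor l (p + 1) a f).1 n w - (bor l p a f).1 (n + 1) w := by
  simp only [bor_apply, nop_succ, zpow_add_one₀ (show (-1 : ℂ) ≠ 0 by norm_num), smul_sub,
    mul_neg, mul_one, neg_smul]
  abel

/-- The commutator formula `[a_p, b_q] = ∑ⱼ (p choose j) (gⱼ)_{p+q-j}`. -/
def HasComm (a b : Fld W) (J : ℕ) (g : ℕ → Fld W) : Prop :=
  (∀ j, J ≤ j → g j = 0) ∧ ∀ (p q : ℤ) (w : W), a.1 p (b.1 q w) - b.1 q (a.1 p w) =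
    ∑ j ∈ Finset.range J, ch p j • (g j).1 (p + q - j) w

theorem HasComm.mono {a b : Fld W} {J K : ℕ} {g : ℕ → Fld W} (h : HasComm a b J g)
    (hJK : J ≤ K) : HasComm a b K g :=
  ⟨fun j hj => h.1 j (hJK.trans hj), fun p q w => by
    rw [h.2, sum_range_eq_sum_range hJK fun i hi => by rw [h.1 i hi, Fld.zero_apply, smul_zero]]⟩

/-- The right-hand side of the Jacobi identity satisfies the recursion of the left-hand side. -/
theorem sum_ch_smul_succ (P : ℤ → Fld W) (l p n : ℤ) (w : W) (K : ℕ) :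
    ∑ i ∈ Finset.range (K + 1), ch (p + 1) i • (P (l + i)).1 (p + 1 + n - i) w =
      ∑ i ∈ Finset.range K, ch p i • (P (l + 1 + i)).1 (p + n - i) w +
      ∑ i ∈ Finset.range (K + 1), ch p i • (P (l + i)).1 (p + (n + 1) - i) w := by
  rw [Finset.sum_range_succ', Finset.sum_range_succ' _ K, ← add_assoc, ← Finset.sum_add_distrib]
  congr 1
  · refine Finset.sum_congr rfl fun i _ => ?_
    rw [ch_succ_succ, add_smul, show l + 1 + (i : ℤ) = l + (i + 1 : ℕ) by push_cast; ring,
      show p + 1 + n - ((i + 1 : ℕ) : ℤ) = p + n - i by push_cast; ring,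
      show p + (n + 1) - ((i + 1 : ℕ) : ℤ) = p + n - i by push_cast; ring]
  · simp [show p + 1 + n = p + (n + 1) by ring]

end fields

end AffineSl2

end

/-! ### The Jacobi identity for local fields and the commutators of their multiplication operators.
-/

noncomputable section

namespace AffineSl2

section fields

variable {W : Type*} [AddCommGroup W] [Module ℂ W]

/-- For `l = 0` this is the commutator formula, and both sides obey the same recursion in `l`. -/
theorem HasComm.bor_natCast {a b : Fld W} {J : ℕ} {g : ℕ → Fld W} (h : HasComm a b J g)
    (l : ℕ) (p n : ℤ) (w : W) : (bor l p a b).1 n w =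
      ∑ i ∈ Finset.range J, ch p i • (g (l + i)).1 (p + n - i) w := by
  induction l generalizing p n with
  | zero => simpa [bor_zero] using h.2 p n w
  | succ l ih =>
    have h1 := sum_ch_smul_succ (fun j => g j.toNat) l p n w J
    rw [Nat.cast_succ, bor_succ, ih, ih]
    have h2 : ∀ (p n : ℤ), ∑ i ∈ Finset.range (J + 1), ch p i • (g ((l : ℤ) + i).toNat).1 n w =
        ∑ i ∈ Finset.range J, ch p i • (g (l + i)).1 n w := by
      intro p n
      rw [Finset.sum_range_succ]
      have : ((l : ℤ) + J).toNat = l + J := by omega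
      rw [this, h.1 (l + J) (by omega), Fld.zero_apply, smul_zero, add_zero]
      exact Finset.sum_congr rfl fun i _ => by rw [show ((l : ℤ) + i).toNat = l + i by omega]
    have h3 : ∀ (p n : ℤ), ∑ i ∈ Finset.range (J + 1),
        ch p i • (g ((l : ℤ) + i).toNat).1 (n - i) w =
        ∑ i ∈ Finset.range J, ch p i • (g (l + i)).1 (n - i) w := by
      intro p n
      rw [Finset.sum_range_succ]
      have : ((l : ℤ) + J).toNat = l + J := by omega
      rw [this, h.1 (l + J) (by omega), Fld.zero_apply, smul_zero, add_zero]
      exact Finset.sum_congr rfl fun i _ => by rw [show ((l : ℤ) + i).toNat = l + i by omega]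
    rw [h3, h3] at h1
    rw [h1, add_sub_cancel_right]
    exact Finset.sum_congr rfl fun i _ => by
      rw [show ((l : ℤ) + 1 + i).toNat = l + 1 + i by omega]

/-- At `p = 0` only the term `i = 0` survives, so the coefficients of a commutator formula are
forced to be the nonnegative products. -/
theorem HasComm.fprod_natCast {a b : Fld W} {J : ℕ} {g : ℕ → Fld W} (h : HasComm a b J g)
    (l : ℕ) : fprod l a b = g l := by
  refine Fld.ext fun n w => ?_
  rw [h.bor_natCast]
  rcases Nat.eq_zero_or_pos J with rfl | hJ
  · simp [h.1 l (by omega), Fld.zero_apply]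
  · obtain ⟨J, rfl⟩ := Nat.exists_eq_add_of_le' hJ
    rw [Finset.sum_range_succ']
    simp

/-- The fields `a` and `f` satisfy the commutator formula. -/
def Loc (a f : Fld W) : Prop := ∃ J : ℕ, HasComm a f J fun j => fprod j a f

theorem HasComm.loc {a b : Fld W} {J : ℕ} {g : ℕ → Fld W} (h : HasComm a b J g) : Loc a b := by
  refine ⟨J, ?_⟩
  have : (fun j : ℕ => fprod (j : ℤ) a b) = g := funext h.fprod_natCast
  rwa [this]

/-- The Jacobi identity for fields which satisfy the commutator formula. -/
theorem HasComm.bor_eq {a f : Fld W} {J : ℕ} (h : HasComm a f J fun j => fprod j a f)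
    (l p n : ℤ) (w : W) (K : ℕ) (hK : J ≤ l + K) : (bor l p a f).1 n w =
      ∑ i ∈ Finset.range K, ch p i • (fprod (l + i) a f).1 (p + n - i) w := by
  have vanish : ∀ j : ℤ, J ≤ j → fprod j a f = 0 := by
    intro j hj
    have := h.1 j.toNat (by omega)
    simpa only [show ((j.toNat : ℕ) : ℤ) = j by omega] using this
  have indep : ∀ (l p n : ℤ) (K K' : ℕ), J ≤ l + K → J ≤ l + K' →
      ∑ i ∈ Finset.range K, ch p i • (fprod (l + i) a f).1 (n - i) w =
      ∑ i ∈ Finset.range K', ch p i • (fprod (l + i) a f).1 (n - i) w := by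
    have key : ∀ (l p n : ℤ) (K K' : ℕ), J ≤ l + K → K ≤ K' →
        ∑ i ∈ Finset.range K, ch p i • (fprod (l + i) a f).1 (n - i) w =
        ∑ i ∈ Finset.range K', ch p i • (fprod (l + i) a f).1 (n - i) w := by
      intro l p n K K' hK hKK
      exact sum_range_eq_sum_range hKK fun i hi => by
        rw [vanish (l + i) (by omega), Fld.zero_apply, smul_zero]
    intro l p n K K' hK hK'
    rcases le_total K K' with hh | hh
    · exact key l p n K K' hK hh
    · exact (key l p n K' K hK' hh).symm
  suffices H : ∀ l : ℤ, ∀ p n : ℤ, (bor l p a f).1 n w = ∑ i ∈ Finset.range ((J - l).toNat + 1),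
      ch p i • (fprod (l + i) a f).1 (p + n - i) w by
    rw [H, indep l p (p + n) _ K (by omega) hK]
  intro l
  rcases le_or_gt 0 l with hl | hl
  · obtain ⟨l, rfl⟩ := Int.eq_ofNat_of_zero_le hl
    intro p n
    rw [h.bor_natCast, indep l p (p + n) _ J (by omega) (by omega)]
    push_cast
    rfl
  obtain ⟨l, rfl⟩ : ∃ l' : ℕ, l = -(l' : ℤ) := ⟨(-l).toNat, by omega⟩
  clear hl
  induction l with
  | zero =>
    intro p n
    have := h.bor_natCast 0 p n w
    rw [Nat.cast_zero, neg_zero] at *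
    rw [this, indep 0 p (p + n) _ J (by omega) (by omega)]
    simp
  | succ l ih =>
    -- Descent to negative index. At `p = 0` the claim is the definition of `fprod`; since the
    -- identity is known for `m + 1`, the common recursion carries it from `p` to `p + 1` and back.
    set m : ℤ := -((l + 1 : ℕ) : ℤ) with hm
    have hm1 : -(l : ℤ) = m + 1 := by push_cast [hm]; ring
    rw [hm1] at ih
    have hrec : ∀ p n : ℤ, ∑ i ∈ Finset.range ((J - m).toNat + 1),
        ch (p + 1) i • (fprod (m + i) a f).1 (p + 1 + n - i) w =
        (bor (m + 1) p a f).1 n w + ∑ i ∈ Finset.range ((J - m).toNat + 1),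
        ch p i • (fprod (m + i) a f).1 (p + (n + 1) - i) w := by
      intro p n
      rw [ih p n, sum_ch_smul_succ (fun j => fprod j a f) m p n w,
        indep (m + 1) p (p + n) ((J - (m + 1)).toNat + 1) (J - m).toNat (by omega) (by omega)]
    have hrec' : ∀ p n : ℤ, (bor m (p + 1) a f).1 n w =
        (bor (m + 1) p a f).1 n w + (bor m p a f).1 (n + 1) w := by
      intro p n
      rw [bor_succ]
      abel
    intro p
    induction p with
    | zero =>
      intro n
      rw [Finset.sum_range_succ']
      simp
    | succ p ihp =>
      intro n
      rw [hrec, hrec', ihp]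
    | pred p ihp =>
      intro n
      have h1 := hrec (-(p : ℤ) - 1) (n - 1)
      have h2 := hrec' (-(p : ℤ) - 1) (n - 1)
      rw [sub_add_cancel, sub_add_cancel] at h1 h2
      rw [ihp (n - 1), h1] at h2
      exact (add_left_cancel h2).symm

/-- Expand both compositions over one square of indices and commute `a` past `b` termwise. The
identity `ch l i * ch (l - i) j = ch l j * ch (l - j) i` takes the factor `ch l j` out, and the
remaining double sum recombines into a single power of `x₁ - x₂`. -/
theorem lmul_comm_sub {a b : Fld W} {J : ℕ} {g : ℕ → Fld W} (h : HasComm a b J g)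
    (f : Fld W) (l m : ℤ) : lmul l 0 a (lmul m 0 b f) - lmul m 0 b (lmul l 0 a f) =
      ∑ j ∈ Finset.range J, ch l j • lmul (l + m - j) 0 (g j) f := by
  refine Fld.ext fun n w => ?_
  obtain ⟨K, hK⟩ := Fld.exists_bound f w n
  have expand : ∀ (a b : Fld W) (l m : ℤ), (lmul l 0 a (lmul m 0 b f)).1 n w =
      ∑ i ∈ Finset.range K, ∑ s ∈ Finset.range K,
        (((-1) ^ i * ch l i) * ((-1) ^ s * ch m s)) •
          a.1 (l - i) (b.1 (m - s) (f.1 (n + (i + s : ℕ)) w)) := by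
    intro a b l m
    rw [lmul_apply, nop_eq_sum _ _ _ _ _ _ K]
    · refine Finset.sum_congr rfl fun i _ => ?_
      rw [lmul_apply, nop_eq_sum _ _ _ _ _ _ K, map_sum, Finset.smul_sum]
      · refine Finset.sum_congr rfl fun s _ => ?_
        rw [map_smul, smul_smul, zero_add, zero_add, Nat.cast_add, add_assoc]
      · intro s hs
        rw [add_assoc, ← Nat.cast_add]
        exact hK _ (by omega)
    · intro i hi
      rw [lmul_apply]
      refine nop_eq_zero _ _ _ _ _ _ fun s => ?_
      rw [add_assoc, ← Nat.cast_add]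
      exact hK _ (by omega)
  have box : ∀ j : ℕ, ∑ i ∈ Finset.range K, ∑ s ∈ Finset.range K,
      ((((-1) ^ i * ch (l - j) i) * ((-1) ^ s * ch m s))) •
        (g j).1 (l + m - j - (i + s : ℕ)) (f.1 (n + (i + s : ℕ)) w) =
      (lmul (l + m - j) 0 (g j) f).1 n w := by
    intro j
    rw [sum_box K (fun i => (-1) ^ i * ch (l - j) i) (fun s => (-1) ^ s * ch m s)
      (fun t => (g j).1 (l + m - j - (t : ℕ)) (f.1 (n + (t : ℕ)) w))
      (fun t ht => by rw [hK t ht, map_zero]), lmul_apply, nop_eq_sum _ _ _ _ _ _ K hK]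
    refine Finset.sum_congr rfl fun t _ => ?_
    rw [sum_antidiagonal_neg_one_pow_mul_ch, zero_add, show l - (j : ℤ) + m = l + m - j by ring]
  rw [Fld.sub_apply, expand, expand, Finset.sum_comm (s := Finset.range K) (t := Finset.range K)
    (f := fun i s => (((-1) ^ i * ch m i) * ((-1) ^ s * ch l s)) •
          b.1 (m - i) (a.1 (l - s) (f.1 (n + (i + s : ℕ)) w))), ← Finset.sum_sub_distrib,
    Fld.sum_apply]
  simp only [Fld.smul_apply, ← box, Finset.smul_sum]
  rw [Finset.sum_comm (s := Finset.range J)]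
  refine Finset.sum_congr rfl fun i _ => ?_
  rw [← Finset.sum_sub_distrib, Finset.sum_comm (s := Finset.range J)]
  refine Finset.sum_congr rfl fun s _ => ?_
  rw [add_comm s i, mul_comm ((-1) ^ s * ch m s), ← smul_sub, h.2, Finset.smul_sum]
  refine Finset.sum_congr rfl fun j _ => ?_
  rw [smul_smul, smul_smul, show l - (i : ℤ) + (m - s) - j = l + m - j - (i + s : ℕ) by
    push_cast; ring]
  congr 1
  linear_combination ((-1) ^ i * (-1) ^ s * ch m s) * ch_mul_ch_comm l i j

/-- The operators `a` and `b` are placed on opposite sides of `f`, so only the finiteness of the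
double sum is at stake. -/
theorem lmul_rmul_comm (a b f : Fld W) (l m : ℤ) :
    lmul l 0 a (rmul m 0 b f) = rmul m 0 b (lmul l 0 a f) := by
  refine Fld.ext fun n w => ?_
  obtain ⟨S, hS⟩ := Fld.exists_bound b w 0
  obtain ⟨K, hK⟩ := Fld.exists_bound_comp b f w 0 (m + n - S)
  have hK' : ∀ i : ℕ, K ≤ i → ∀ s : ℕ, s < S → f.1 (n + i + m - s) (b.1 (0 + s) w) = 0 := by
    intro i hi s hs
    have := hK (i + S - s) s (by omega)
    rwa [show m + n - S + ((i + S - s : ℕ) : ℤ) = n + i + m - s by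
      rw [Nat.cast_sub (by omega)]; push_cast; ring] at this
  rw [lmul_apply, nop_eq_sum _ _ _ _ _ _ K, rmul_apply, nop_eq_sum _ _ _ _ _ _ S hS]
  · have h1 : ∀ s ∈ Finset.range S, (lmul l 0 a f).1 (n + m - s) (b.1 (0 + s) w) =
        ∑ i ∈ Finset.range K, ((-1) ^ i * ch l i) • a.1 (0 + l - i)
          (f.1 (n + m - s + i) (b.1 (0 + s) w)) := by
      intro s hs
      rw [lmul_apply, nop_eq_sum _ _ _ _ _ _ K]
      intro i hi
      rw [← hK' i hi s (Finset.mem_range.1 hs)]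
      congr 2
      ring
    rw [Finset.sum_congr rfl fun s hs => congrArg _ (h1 s hs)]
    simp only [Finset.smul_sum]
    rw [Finset.sum_comm (s := Finset.range S)]
    refine Finset.sum_congr rfl fun i _ => ?_
    rw [rmul_apply, nop_eq_sum _ _ _ _ _ _ S hS, map_sum, Finset.smul_sum]
    refine Finset.sum_congr rfl fun s _ => ?_
    rw [map_smul, smul_smul, smul_smul, mul_comm, show n + i + m - (s : ℤ) = n + m - s + i by ring]
  · intro i hi
    rw [rmul_apply, nop_eq_sum _ _ _ _ _ _ S hS]
    exact Finset.sum_eq_zero fun s hs => by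
      rw [hK' i hi s (Finset.mem_range.1 hs), smul_zero]

theorem rmul_comm_sub {a b : Fld W} {J : ℕ} {g : ℕ → Fld W} (h : HasComm a b J g)
    (f : Fld W) (l m : ℤ) : rmul m 0 b (rmul l 0 a f) - rmul l 0 a (rmul m 0 b f) =
      ∑ j ∈ Finset.range J, ((-1) ^ j * ch l j) • rmul (l + m - j) 0 (g j) f := by
  refine Fld.ext fun n w => ?_
  obtain ⟨Ka, hKa⟩ := Fld.exists_bound a w 0
  obtain ⟨Kb, hKb⟩ := Fld.exists_bound b w 0
  obtain ⟨Kab, hKab⟩ := Fld.exists_bound_comp a b w 0 0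
  obtain ⟨Kba, hKba⟩ := Fld.exists_bound_comp b a w 0 0
  have hg : ∃ Kg : ℕ, ∀ j < J, ∀ i : ℕ, Kg ≤ i → (g j).1 i w = 0 := by
    clear h
    induction J with
    | zero => exact ⟨0, fun j hj => absurd hj (by omega)⟩
    | succ J ih =>
      obtain ⟨K, hK⟩ := ih
      obtain ⟨K', hK'⟩ := Fld.exists_bound (g J) w 0
      refine ⟨max K K', fun j hj i hi => ?_⟩
      rcases Nat.lt_succ_iff_lt_or_eq.1 hj with h | rfl
      · exact hK j h i (by omega)
      · simpa using hK' i (by omega)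
  obtain ⟨Kg, hKg⟩ := hg
  obtain ⟨K, hK1, hK2, hK3, hK4, hK5⟩ :
      ∃ K : ℕ, Ka ≤ K ∧ Kb ≤ K ∧ Kab ≤ K ∧ Kba ≤ K ∧ Kg + J ≤ K :=
    ⟨Ka + Kb + Kab + Kba + Kg + J, by omega, by omega, by omega, by omega, by omega⟩
  have expand : ∀ (a b : Fld W) (l m : ℤ), (∀ i : ℕ, K ≤ i → a.1 (0 + i) w = 0) →
      (∀ s i : ℕ, K ≤ s → b.1 (0 + s) (a.1 (0 + i) w) = 0) →
      (rmul l 0 a (rmul m 0 b f)).1 n w =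
      ∑ i ∈ Finset.range K, ∑ s ∈ Finset.range K,
        (((-1) ^ i * ch l i) * ((-1) ^ s * ch m s)) •
          f.1 (n + l + m - (i + s : ℕ)) (b.1 s (a.1 i w)) := by
    intro a b l m ha hab
    rw [rmul_apply, nop_eq_sum _ _ _ _ _ _ K ha]
    refine Finset.sum_congr rfl fun i _ => ?_
    rw [rmul_apply, nop_eq_sum _ _ _ _ _ _ K fun s hs => hab s i hs, Finset.smul_sum]
    refine Finset.sum_congr rfl fun s _ => ?_
    rw [smul_smul, zero_add, zero_add,
      show n + l - (i : ℤ) + m - s = n + l + m - (i + s : ℕ) by push_cast; ring]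
  have box : ∀ j < J, (rmul (l + m - j) 0 (g j) f).1 n w =
      ∑ i ∈ Finset.range K, ∑ s ∈ Finset.range K,
      ((((-1) ^ i * ch (l - j) i) * ((-1) ^ s * ch m s))) •
        f.1 (n + l + m - j - (i + s : ℕ)) ((g j).1 (i + s : ℕ) w) := by
    intro j hj
    rw [sum_box K (fun i => (-1) ^ i * ch (l - j) i) (fun s => (-1) ^ s * ch m s)
      (fun t => f.1 (n + l + m - j - (t : ℕ)) ((g j).1 (t : ℕ) w))
      (fun t ht => by rw [hKg j hj t (by omega), map_zero]), rmul_apply,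
      nop_eq_sum _ _ _ _ _ _ K fun i hi => by rw [zero_add]; exact hKg j hj i (by omega)]
    refine Finset.sum_congr rfl fun t _ => ?_
    rw [sum_antidiagonal_neg_one_pow_mul_ch, zero_add, show l - (j : ℤ) + m = l + m - j by ring,
      show n + (l + m - (j : ℤ)) - t = n + l + m - j - t by ring]
  rw [Fld.sub_apply, expand b a m l (fun i hi => hKb i (by omega)) (fun s i hs => hKba s i (by omega)),
    expand a b l m (fun i hi => hKa i (by omega)) (fun s i hs => hKab s i (by omega)),
    Finset.sum_comm, ← Finset.sum_sub_distrib, Fld.sum_apply]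
  -- On the right of `f` the mode of `a` is some `i ≥ 0`, so the commutator produces `ch i j`, which
  -- vanishes for `i < j`. Replacing `i` by `j + i` creates the sign `(-1)^j`.
  have inner : ∀ j ∈ Finset.range J, (((-1) ^ j * ch l j) • rmul (l + m - j) 0 (g j) f).1 n w =
      ∑ i ∈ Finset.range K, ∑ s ∈ Finset.range K,
        (((-1) ^ i * ch l i) * ((-1) ^ s * ch m s)) •
          f.1 (n + l + m - (i + s : ℕ)) (ch i j • (g j).1 (i + s - j) w) := by
    intro j hj
    have hj' := Finset.mem_range.1 hj
    rw [sum_range_shift j]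
    · rw [Fld.smul_apply, box j hj', Finset.smul_sum]
      refine Finset.sum_congr rfl fun i _ => ?_
      rw [Finset.smul_sum]
      refine Finset.sum_congr rfl fun s _ => ?_
      rw [map_smul, smul_smul, smul_smul,
        show n + l + m - (j : ℤ) - (i + s : ℕ) = n + l + m - (j + i + s : ℕ) by push_cast; ring,
        show ((j + i : ℕ) : ℤ) + s - j = (i + s : ℕ) by push_cast; ring]
      congr 1
      rw [pow_add]
      linear_combination (-((-1) ^ i * (-1) ^ j * (-1) ^ s * ch m s)) * ch_mul_ch_natCast l i j
    · intro i hi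
      refine Finset.sum_eq_zero fun s _ => ?_
      have := hKg j hj' (i + s - j) (by omega)
      rw [show ((i + s - j : ℕ) : ℤ) = (i : ℤ) + s - j by
        rw [Nat.cast_sub (by omega)]; push_cast; ring] at this
      rw [this, smul_zero, map_zero, smul_zero]
    · intro i hi
      refine Finset.sum_eq_zero fun s _ => ?_
      rw [ch_natCast_of_lt hi, zero_smul, map_zero, smul_zero]
  rw [Finset.sum_congr rfl inner, Finset.sum_comm]
  refine Finset.sum_congr rfl fun i _ => ?_
  rw [← Finset.sum_sub_distrib, Finset.sum_comm (s := Finset.range J)]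
  refine Finset.sum_congr rfl fun s _ => ?_
  rw [← Finset.smul_sum, ← map_sum, ← h.2, map_sub, smul_sub, add_comm s i,
    mul_comm ((-1) ^ s * ch m s), show n + m + l = n + l + m by ring]

/-- The commutator formula for the operators of left multiplication by fields. -/
theorem fprod_comm_sub {a b : Fld W} {J : ℕ} {g : ℕ → Fld W} (h : HasComm a b J g)
    (f : Fld W) (l m : ℤ) : fprod l a (fprod m b f) - fprod m b (fprod l a f) =
      ∑ j ∈ Finset.range J, ch l j • fprod (l + m - j) (g j) f := by
  -- Each product is a left minus a right multiplication. The mixed terms cancel in the commutator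
  -- by `lmul_rmul_comm`, leaving the left-left and right-right commutators.
  have h1 : ∀ (a b : Fld W) (l m : ℤ), fprod l a (fprod m b f) =
      lmul l 0 a (lmul m 0 b f) - (-1 : ℂ) ^ m • lmul l 0 a (rmul m 0 b f) -
      (-1 : ℂ) ^ l • rmul l 0 a (lmul m 0 b f) +
      ((-1 : ℂ) ^ l * (-1) ^ m) • rmul l 0 a (rmul m 0 b f) := by
    intro a b l m
    simp only [fprod, bor, LinearMap.sub_apply, LinearMap.smul_apply, map_sub, map_smul, smul_sub,
      smul_smul, mul_comm ((-1 : ℂ) ^ m)]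
    abel
  have h2 : ∀ j ∈ Finset.range J, ch l j • fprod (l + m - j) (g j) f =
      ch l j • lmul (l + m - j) 0 (g j) f -
      ((-1 : ℂ) ^ l * (-1) ^ m) • (((-1) ^ j * ch l j) • rmul (l + m - j) 0 (g j) f) := by
    intro j _
    simp only [fprod, bor, LinearMap.sub_apply, LinearMap.smul_apply, smul_sub, smul_smul]
    congr 2
    rw [zpow_sub₀ (by norm_num), zpow_add₀ (by norm_num), zpow_natCast, div_eq_mul_inv, ← inv_pow,
      show (-1 : ℂ)⁻¹ = -1 by norm_num]
    ring
  rw [Finset.sum_congr rfl h2, Finset.sum_sub_distrib, ← Finset.smul_sum, ← lmul_comm_sub h f,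
    ← rmul_comm_sub h f, h1, h1, lmul_rmul_comm a b, lmul_rmul_comm b a,
    mul_comm ((-1 : ℂ) ^ m), smul_sub]
  abel

end fields

end AffineSl2

end

/-! ### Dong's lemma, skew symmetry, derivatives and the identity field. -/

noncomputable section

namespace AffineSl2

section fields

variable {W : Type*} [AddCommGroup W] [Module ℂ W]

theorem Loc.exists_hasComm {a f : Fld W} (h : Loc a f) (K : ℕ) :
    ∃ J : ℕ, K ≤ J ∧ HasComm a f J fun j => fprod j a f := by
  obtain ⟨J, hJ⟩ := h
  exact ⟨max J K, le_max_right _ _, hJ.mono (le_max_left _ _)⟩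

/-- Leibniz rule: `a.1 p` is commuted first past the modes of `b`, then past those of `f`. -/
theorem HasComm.nop_comm {a b f : Fld W} {J J' : ℕ} {g g' : ℕ → Fld W} (h : HasComm a b J g)
    (h' : HasComm a f J' g') (m t p q : ℤ) (w : W) :
    a.1 p (nop b f m t q w) - nop b f m t q (a.1 p w) =
      ∑ j ∈ Finset.range J, ch p j • nop (g j) f m (t + p - j) q w +
      ∑ j ∈ Finset.range J', ch p j • nop b (g' j) m t (p + q - j) w := by
  obtain ⟨K₁, hK₁⟩ := f.exists_bound w q
  obtain ⟨K₂, hK₂⟩ := f.exists_bound (a.1 p w) q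
  have hg : ∃ K : ℕ, ∀ j < J', ∀ i : ℕ, K ≤ i → (g' j).1 (p + q - j + i) w = 0 := by
    clear h'
    induction J' with
    | zero => exact ⟨0, fun j hj => absurd hj (by omega)⟩
    | succ J ih =>
      obtain ⟨K, hK⟩ := ih
      obtain ⟨K', hK'⟩ := (g' J).exists_bound w (p + q - J)
      refine ⟨max K K', fun j hj i hi => ?_⟩
      rcases Nat.lt_succ_iff_lt_or_eq.1 hj with h | rfl
      · exact hK j h i (by omega)
      · simpa using hK' i (by omega)
  obtain ⟨K₃, hK₃⟩ := hg
  obtain ⟨K, h1, h2, h3⟩ : ∃ K : ℕ, K₁ ≤ K ∧ K₂ ≤ K ∧ K₃ ≤ K :=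
    ⟨K₁ + K₂ + K₃, by omega, by omega, by omega⟩
  have e1 : ∀ j ∈ Finset.range J, ch p j • nop (g j) f m (t + p - j) q w =
      ∑ i ∈ Finset.range K, ((-1) ^ i * ch m i) •
        (ch p j • (g j).1 (p + (t + m - i) - j) (f.1 (q + i) w)) := by
    intro j _
    rw [nop_eq_sum _ _ _ _ _ _ K fun i hi => hK₁ i (by omega), Finset.smul_sum]
    refine Finset.sum_congr rfl fun i _ => ?_
    rw [smul_comm, show t + p - j + m - i = p + (t + m - i) - j by ring]
  have e2 : ∀ j ∈ Finset.range J', ch p j • nop b (g' j) m t (p + q - j) w =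
      ∑ i ∈ Finset.range K, ((-1) ^ i * ch m i) •
        b.1 (t + m - i) (ch p j • (g' j).1 (p + (q + i) - j) w) := by
    intro j hj
    rw [nop_eq_sum _ _ _ _ _ _ K fun i hi => hK₃ j (Finset.mem_range.1 hj) i (by omega),
      Finset.smul_sum]
    refine Finset.sum_congr rfl fun i _ => ?_
    rw [smul_comm, map_smul, show p + q - j + i = p + (q + i) - j by ring]
  rw [Finset.sum_congr rfl e1, Finset.sum_congr rfl e2, Finset.sum_comm (s := Finset.range J),
    Finset.sum_comm (s := Finset.range J'), ← Finset.sum_add_distrib,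
    nop_eq_sum _ _ _ _ _ _ K fun i hi => hK₁ i (by omega),
    nop_eq_sum _ _ _ _ _ _ K fun i hi => hK₂ i (by omega), map_sum, ← Finset.sum_sub_distrib]
  refine Finset.sum_congr rfl fun i _ => ?_
  rw [← Finset.smul_sum, ← Finset.smul_sum, ← map_sum, ← h.2, ← h'.2, map_smul, ← smul_sub,
    ← smul_add, map_sub]
  congr 1
  abel

/-- Dong's lemma, in terms of commutator formulas. -/
theorem HasComm.loc_fprod {a b f : Fld W} {J : ℕ} {g : ℕ → Fld W} (h : HasComm a b J g)
    (hf : Loc a f) (hg : ∀ j < J, Loc (g j) f) (m : ℤ) : Loc a (fprod m b f) := by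
  obtain ⟨Jf, hJf⟩ := hf
  have hK : ∃ K : ℕ, ∀ j < J, HasComm (g j) f K fun i => fprod i (g j) f := by
    clear h
    induction J with
    | zero => exact ⟨0, fun j hj => absurd hj (by omega)⟩
    | succ J ih =>
      obtain ⟨K, hK⟩ := ih fun j hj => hg j (by omega)
      obtain ⟨K', hKK', hK'⟩ := (hg J (by omega)).exists_hasComm K
      refine ⟨K', fun j hj => ?_⟩
      rcases Nat.lt_succ_iff_lt_or_eq.1 hj with h | rfl
      · exact (hK j h).mono hKK'
      · exact hK'
  obtain ⟨Kg, hKg⟩ := hK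
  obtain ⟨K, h1, h2⟩ : ∃ K : ℕ, Jf ≤ K ∧ Kg ≤ m + K := ⟨Jf + (Kg - m).toNat, by omega, by omega⟩
  have hv : ∀ j < J, ∀ i : ℤ, Kg ≤ i → fprod i (g j) f = 0 := by
    intro j hj i hi
    simpa only [show ((i.toNat : ℕ) : ℤ) = i by omega] using (hKg j hj).1 i.toNat (by omega)
  have hr : ∀ r : ℕ, fprod (r : ℤ) a (fprod m b f) = fprod m b (fprod (r : ℤ) a f) +
      ∑ j ∈ Finset.range J, ch r j • fprod (r + m - j) (g j) f := by
    intro r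
    rw [← fprod_comm_sub h]
    abel
  -- The proposed coefficients are the products of `a` with `fprod m b f`, as computed by `hr`. From
  -- `r = K + J` on both parts vanish, because `fprod r a f = 0` and the index `r + m - j` exceeds
  -- the locality bound of `g j` and `f`.
  refine HasComm.loc (J := K + J) (g := fun r => fprod m b (fprod (r : ℤ) a f) +
      ∑ j ∈ Finset.range J, ch r j • fprod (r + m - j) (g j) f) ⟨?_, ?_⟩
  · intro r hr'
    dsimp only
    have := hJf.1 r (by omega)
    dsimp only at this
    rw [this, map_zero, zero_add]
    refine Finset.sum_eq_zero fun j hj => ?_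
    have := Finset.mem_range.1 hj
    rw [hv j this _ (by omega), smul_zero]
  · intro p q w
    -- For fixed `j` the sum over `r` is the right-hand side of the Jacobi identity for `g j` and
    -- `f`. What remains is the Leibniz rule on each half of `fprod m b f`.
    have e1 : ∀ j ∈ Finset.range J, ∑ r ∈ Finset.range (K + J),
        ch p r • ((ch r j • fprod (r + m - j) (g j) f : Fld W).1 (p + q - r) w) =
        ch p j • (bor m (p - j) (g j) f).1 q w := by
      intro j hj
      have hj' := Finset.mem_range.1 hj
      rw [(hKg j hj').bor_eq m (p - j) q w (K + J) (by omega), sum_range_shift j, Finset.smul_sum]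
      · refine Finset.sum_congr rfl fun i _ => ?_
        rw [Fld.smul_apply, smul_smul, smul_smul, ch_mul_ch_natCast,
          show ((j + i : ℕ) : ℤ) + m - j = m + i by push_cast; ring,
          show p + q - ((j + i : ℕ) : ℤ) = p - j + q - i by push_cast; ring]
      · intro r hr'
        rw [hv j hj' _ (by omega), smul_zero, Fld.zero_apply, smul_zero]
      · intro r hr'
        rw [ch_natCast_of_lt hr', zero_smul, Fld.zero_apply, smul_zero]
    have hf' := hJf.mono (show Jf ≤ K + J by omega)
    simp only [Fld.add_apply, smul_add, Finset.sum_add_distrib, Fld.sum_apply, Finset.smul_sum]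
    rw [Finset.sum_comm (t := Finset.range J), Finset.sum_congr rfl e1]
    have n1 := h.nop_comm hf' m 0 p q w
    have n2 := hf'.nop_comm h m q p 0 w
    simp only [bor_apply, map_sub, map_smul, smul_sub, Finset.sum_sub_distrib]
    rw [show ∀ A B C D : W, A - B - (C - D) = (A - C) - (B - D) from fun A B C D => by abel,
      ← smul_sub, n1, n2, smul_add, Finset.smul_sum, Finset.smul_sum]
    have c1 : ∀ x ∈ Finset.range J, (-1 : ℂ) ^ m • (ch p x • nop f (g x) m q (p + 0 - x) w) =
        ch p x • (-1 : ℂ) ^ m • nop f (g x) m q (p - x) w := by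
      intro x _
      rw [smul_comm, add_zero]
    have c2 : ∀ x ∈ Finset.range (K + J),
        (-1 : ℂ) ^ m • (ch p x • nop (fprod x a f) b m (q + p - x) 0 w) =
        ch p x • (-1 : ℂ) ^ m • nop (fprod x a f) b m (p + q - x) 0 w := by
      intro x _
      rw [smul_comm, add_comm q p]
    rw [Finset.sum_congr rfl c1, Finset.sum_congr rfl c2]
    simp only [zero_add]
    abel

/-- The derivative of a field. -/
def deriv : Fld W →ₗ[ℂ] Fld W where
  toFun f := ⟨fun n => (-n : ℂ) • f.1 (n - 1), fun w => by
    obtain ⟨N, hN⟩ := f.2 w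
    exact ⟨N + 1, fun n hn => by simp [hN (n - 1) (by omega)]⟩⟩
  map_add' f g := Fld.ext fun n w => by
    simp only [Fld.add_apply, LinearMap.smul_apply, smul_add]
  map_smul' c f := Fld.ext fun n w => by
    simp only [Fld.smul_apply, LinearMap.smul_apply, RingHom.id_apply]
    exact smul_comm _ _ _

theorem deriv_apply (f : Fld W) (n : ℤ) (w : W) :
    (deriv f).1 n w = (-n : ℂ) • f.1 (n - 1) w := rfl

/-- The divided powers of the derivative. -/
def divDeriv (s : ℕ) : Fld W →ₗ[ℂ] Fld W := ((s.factorial : ℂ)⁻¹) • (deriv ^ s)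

theorem divDeriv_succ (s : ℕ) (f : Fld W) :
    ((s : ℂ) + 1) • divDeriv (s + 1) f = deriv (divDeriv s f) := by
  simp only [divDeriv, LinearMap.smul_apply, map_smul, smul_smul, pow_succ', Module.End.mul_apply,
    Nat.factorial_succ, Nat.cast_mul, Nat.cast_add, Nat.cast_one]
  congr 1
  have h1 : (s : ℂ) + 1 ≠ 0 := by exact_mod_cast Nat.succ_ne_zero s
  field_simp

theorem divDeriv_apply (s : ℕ) (f : Fld W) (n : ℤ) (w : W) :
    (divDeriv s f).1 n w = ((-1) ^ s * ch n s) • f.1 (n - s) w := by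
  induction s generalizing n with
  | zero => simp [divDeriv]
  | succ s ih =>
    have h1 : (s : ℂ) + 1 ≠ 0 := by exact_mod_cast Nat.succ_ne_zero s
    have h2 := congrArg (fun g : Fld W => g.1 n w) (divDeriv_succ s f)
    simp only [Fld.smul_apply, deriv_apply, ih] at h2
    rw [← sub_eq_zero] at h2 ⊢
    refine (smul_eq_zero.1 ((smul_sub _ _ _).trans (Eq.trans ?_ h2))).resolve_left h1
    rw [smul_smul, smul_smul, show n - 1 - (s : ℤ) = n - (s + 1 : ℕ) by push_cast; ring]
    congr 2
    rw [pow_succ]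
    linear_combination (-(-1) ^ s) * succ_mul_ch n s

theorem divDeriv_mem {N : Submodule ℂ (Fld W)} (hN : ∀ f ∈ N, deriv f ∈ N) (s : ℕ) {f : Fld W}
    (hf : f ∈ N) : divDeriv s f ∈ N := by
  refine N.smul_mem _ ?_
  induction s with
  | zero => simpa using hf
  | succ s ih => rw [pow_succ', Module.End.mul_apply]; exact hN _ ih

/-- Skew symmetry of the commutator formula. -/
theorem HasComm.skew {a f : Fld W} {J : ℕ} {g : ℕ → Fld W} (h : HasComm a f J g) :
    HasComm f a J fun j => ∑ i ∈ Finset.range J,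
      if j ≤ i then ((-1 : ℂ) ^ (i + 1)) • divDeriv (i - j) (g i) else 0 := by
  refine ⟨fun j hj => Finset.sum_eq_zero fun i hi => ?_, fun q p w => ?_⟩
  · rw [if_neg (by have := Finset.mem_range.1 hi; omega)]
  · simp only [Fld.sum_apply, Finset.smul_sum]
    rw [Finset.sum_comm, ← neg_sub, h.2, ← Finset.sum_neg_distrib]
    -- For fixed `i`, `ch_eq_sum_skew` rewrites the binomial coefficient in `p` through binomial
    -- coefficients in `q`; the other factors are those of the modes of divided derivatives of `g
    -- i`.
    refine Finset.sum_congr rfl fun i hi => ?_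
    have hi' := Finset.mem_range.1 hi
    rw [← sum_range_eq_sum_range (J := i + 1) (K := J) (by omega), ch_eq_sum_skew p q i,
      ← neg_smul, ← Finset.sum_neg_distrib, Finset.sum_smul]
    · refine Finset.sum_congr rfl fun j hj => ?_
      have hj' : j ≤ i := by have := Finset.mem_range.1 hj; omega
      rw [if_pos hj', Fld.smul_apply, divDeriv_apply, smul_smul, smul_smul,
        show q + p - (j : ℤ) - (i - j : ℕ) = p + q - i by rw [Nat.cast_sub hj']; ring]
      congr 1
      obtain ⟨s, rfl⟩ := Nat.exists_eq_add_of_le hj'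
      rw [Nat.add_sub_cancel_left, add_comm q p, pow_add, pow_add]
      have : ((-1 : ℂ) ^ s) * (-1) ^ s = 1 := by rw [← mul_pow]; simp
      linear_combination ((-1) ^ j * ch q j * ch (p + q - j) s) * this
    · intro j hj
      rw [if_neg (by omega), Fld.zero_apply, smul_zero]

/-- Differentiate `(x₁ - x₂)^m a(x₁) f(x₂)` in `x₂`: one term from `f`, and `-m (x₁ - x₂)^(m-1)`
from the kernel. The two orderings of `a` and `f` are treated by `key` and `key'`. -/
theorem deriv_fprod (a f : Fld W) (m : ℤ) :
    deriv (fprod m a f) = fprod m a (deriv f) - (m : ℂ) • fprod (m - 1) a f := by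
  have key : ∀ (a f : Fld W) (m t n : ℤ) (w : W), (-(n + t) : ℂ) • nop a f m t (n - 1) w =
      nop a (deriv f) m t n w - (m : ℂ) • nop a f (m - 1) t n w
        - (t : ℂ) • nop a f m t (n - 1) w := by
    intro a f m t n w
    obtain ⟨K, hK⟩ := f.exists_bound w (n - 1)
    have hK' : ∀ i : ℕ, K ≤ i → f.1 (n + i) w = 0 := fun i hi => by
      have := hK (i + 1) (by omega)
      rwa [Nat.cast_succ, show n - 1 + ((i : ℤ) + 1) = n + i by ring] at this
    rw [nop_eq_sum a f m t (n - 1) w (K + 1) fun i hi => hK i (by omega),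
      nop_eq_sum a (deriv f) m t n w (K + 1) fun i hi => by
        rw [deriv_apply, add_sub_right_comm, hK i (by omega), smul_zero],
      nop_eq_sum a f (m - 1) t n w K hK']
    have h1 : (m : ℂ) • ∑ i ∈ Finset.range K, ((-1) ^ i * ch (m - 1) i) •
        a.1 (t + (m - 1) - i) (f.1 (n + i) w) =
        ∑ i ∈ Finset.range (K + 1), ((-1) ^ (i + 1) * (i * ch m i)) •
          a.1 (t + m - i) (f.1 (n - 1 + i) w) := by
      rw [Finset.sum_range_succ', Finset.smul_sum]
      simp only [Nat.cast_zero, zero_mul, mul_zero, zero_smul, add_zero]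
      refine Finset.sum_congr rfl fun i _ => ?_
      rw [smul_smul, show t + (m - 1) - (i : ℤ) = t + m - (i + 1 : ℕ) by push_cast; ring,
        show n - 1 + ((i + 1 : ℕ) : ℤ) = n + i by push_cast; ring]
      congr 1
      push_cast
      rw [succ_mul_ch, pow_add, pow_add]
      ring
    rw [h1, Finset.smul_sum, Finset.smul_sum, ← Finset.sum_sub_distrib, ← Finset.sum_sub_distrib]
    refine Finset.sum_congr rfl fun i _ => ?_
    rw [deriv_apply, map_smul, smul_smul, smul_smul, smul_smul,
      show n + (i : ℤ) - 1 = n - 1 + i by ring, ← sub_smul, ← sub_smul]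
    congr 1
    push_cast
    rw [pow_succ]
    ring
  have key' : ∀ (a f : Fld W) (m n : ℤ) (w : W), (-n : ℂ) • nop f a m (n - 1) 0 w =
      nop (deriv f) a m n 0 w + (m : ℂ) • nop f a (m - 1) n 0 w := by
    intro a f m n w
    obtain ⟨K, hK⟩ := a.exists_bound w 0
    rw [nop_eq_sum _ _ _ _ _ _ K hK, nop_eq_sum _ _ _ _ _ _ (K + 1) fun i hi => hK i (by omega),
      nop_eq_sum _ _ _ _ _ _ (K + 1) fun i hi => hK i (by omega),
      sum_range_eq_sum_range (Nat.le_succ K) fun i hi => by rw [hK i hi, map_zero, smul_zero],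
      Finset.smul_sum, Finset.smul_sum, ← Finset.sum_add_distrib]
    refine Finset.sum_congr rfl fun i _ => ?_
    rw [deriv_apply, smul_smul, smul_smul, smul_smul,
      show n - 1 + m - (i : ℤ) = n + m - i - 1 by ring,
      show n + (m - 1) - (i : ℤ) = n + m - i - 1 by ring, ← add_smul]
    congr 1
    have h := ch_mul_ch_comm m i 1
    simp only [ch, Ring.choose_one_right] at h ⊢
    push_cast at h ⊢
    linear_combination ((-1) ^ i) * h
  refine Fld.ext fun n w => ?_
  have k1 := key a f m 0 n w
  have k2 := key' a f m n w
  simp only [Int.cast_zero, add_zero, zero_smul, sub_zero] at k1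
  simp only [deriv_apply, Fld.sub_apply, Fld.smul_apply, bor_apply, smul_sub]
  rw [k1, smul_comm, k2, zpow_sub_one₀ (by norm_num)]
  rw [smul_add, smul_comm (m : ℂ) ((-1 : ℂ) ^ m * (-1)⁻¹), show (-1 : ℂ)⁻¹ = -1 by norm_num,
    mul_neg_one, neg_smul]
  abel

/-- The field `1`. -/
def one : Fld W := ⟨fun n => if n = -1 then 1 else 0, fun w => ⟨0, fun n hn => by
  rw [if_neg (by omega)]; rfl⟩⟩

theorem one_apply (n : ℤ) (w : W) : (one : Fld W).1 n w = if n = -1 then w else 0 := by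
  simp only [one]
  split_ifs <;> rfl

@[simp] theorem deriv_one : deriv (one : Fld W) = 0 := by
  refine Fld.ext fun n w => ?_
  rw [deriv_apply, one_apply]
  split_ifs with h
  · obtain rfl : n = 0 := by omega
    simp [Fld.zero_apply]
  · rw [smul_zero, Fld.zero_apply]

theorem hasComm_one (a : Fld W) : HasComm a one 0 0 :=
  ⟨fun _ _ => rfl, fun p q w => by
    rw [one_apply, one_apply]
    split_ifs <;> simp⟩

theorem fprod_one_natCast (a : Fld W) (j : ℕ) : fprod (j : ℤ) a one = 0 :=
  (hasComm_one a).fprod_natCast j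

/-- For `l = -1` all signed binomial coefficients equal `1`, so the product is the normally ordered
product. -/
theorem fprod_neg_one_apply (a f : Fld W) (n : ℤ) (w : W) (K K' : ℕ)
    (hK : ∀ i : ℕ, K ≤ i → f.1 (n + i) w = 0) (hK' : ∀ i : ℕ, K' ≤ i → a.1 i w = 0) :
    (fprod (-1) a f).1 n w = ∑ i ∈ Finset.range K, a.1 (-1 - i) (f.1 (n + i) w) +
      ∑ i ∈ Finset.range K', f.1 (n - 1 - i) (a.1 i w) := by
  have hc : ∀ i : ℕ, (-1 : ℂ) ^ i * ch (-1) i = 1 := by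
    intro i
    have h := neg_one_pow_mul_ch (-1) i
    rw [sub_neg_eq_add, sub_add_cancel, ch_natCast, Nat.choose_self, Nat.cast_one] at h
    exact h
  rw [bor_apply, nop_eq_sum _ _ _ _ _ _ K hK,
    nop_eq_sum _ _ _ _ _ _ K' fun i hi => by rw [zero_add]; exact hK' i hi]
  simp only [hc, one_smul, zero_add, zpow_neg_one]
  rw [show (-1 : ℂ)⁻¹ = -1 by norm_num, neg_one_smul, sub_neg_eq_add]
  rfl

theorem fprod_neg_one_one (a : Fld W) : fprod (-1) a one = a := by
  refine Fld.ext fun n w => ?_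
  obtain ⟨K', hK'⟩ := a.exists_bound w 0
  have hK : ∀ i : ℕ, (-n).toNat ≤ i → (one : Fld W).1 (n + i) w = 0 := fun i hi => by
    rw [one_apply, if_neg (by omega)]
  rw [fprod_neg_one_apply a one n w (-n).toNat (K' + n.toNat + 1) hK
    fun i hi => by simpa using hK' i (by omega)]
  -- The identity field has only the mode `-1`; it is met in the first sum for `n < 0` and in the
  -- second for `n ≥ 0`.
  rcases lt_or_ge n 0 with hn | hn
  · rw [Finset.sum_eq_single_of_mem (-1 - n).toNat (Finset.mem_range.2 (by omega)),
      Finset.sum_eq_zero fun i _ => by rw [one_apply, if_neg (by omega)], one_apply,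
      if_pos (by omega), add_zero]
    · congr 2
      omega
    · intro i _ hi
      rw [one_apply, if_neg (by omega), map_zero]
  · rw [Finset.sum_eq_zero fun i hi => by
        rw [one_apply, if_neg (by have := Finset.mem_range.1 hi; omega), map_zero],
      Finset.sum_eq_single_of_mem n.toNat (Finset.mem_range.2 (by omega)), one_apply,
      if_pos (by omega), zero_add]
    · congr 2
      omega
    · intro i _ hi
      rw [one_apply, if_neg (by omega)]

/-- Since `deriv one = 0`, `deriv_fprod` expresses `fprod (-1 - s) f one` up to a nonzero scalar as
an `s`-fold derivative of `f`; the nonnegative products with `one` vanish. -/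
theorem fprod_one_mem {N : Submodule ℂ (Fld W)} (hN : ∀ f ∈ N, deriv f ∈ N) {f : Fld W}
    (hf : f ∈ N) (l : ℤ) : fprod l f one ∈ N := by
  have h : ∀ s : ℕ, fprod (-1 - s) f one ∈ N := by
    intro s
    induction s with
    | zero => simpa [fprod_neg_one_one] using hf
    | succ s ih =>
      have h1 := deriv_fprod f one (-1 - s)
      rw [deriv_one, map_zero, zero_sub, ← neg_smul] at h1
      have h2 : (-((-1 - s : ℤ) : ℂ)) ≠ 0 := by
        rw [neg_ne_zero, Int.cast_ne_zero]
        omega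
      have h3 : fprod (-1 - (s + 1 : ℕ)) f one =
          (-((-1 - s : ℤ) : ℂ))⁻¹ • deriv (fprod (-1 - s) f one) := by
        rw [h1, smul_smul, inv_mul_cancel₀ h2, one_smul]
        congr 3
        push_cast
        ring
      rw [h3]
      exact N.smul_mem _ (hN _ ih)
  rcases le_or_gt 0 l with hl | hl
  · obtain ⟨j, rfl⟩ := Int.eq_ofNat_of_zero_le hl
    rw [fprod_one_natCast]
    exact N.zero_mem
  · have := h (-1 - l).toNat
    rwa [show -1 - ((-1 - l).toNat : ℤ) = l by omega] at this

theorem fprod_zero_apply (a f : Fld W) (n : ℤ) (w : W) :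
    (fprod 0 a f).1 n w = a.1 0 (f.1 n w) - f.1 n (a.1 0 w) := bor_zero a f 0 n w

end fields

end AffineSl2

end

noncomputable section

namespace AffineSl2

/-! ### Representations of the affine Lie algebra -/

theorem lie_E_F : ⁅E, F⁆ = H := by
  refine Subtype.ext ?_
  rw [LieAlgebra.SpecialLinear.sl_bracket]
  ext i j
  fin_cases i <;> fin_cases j <;> simp [E, F, H]

theorem lie_F_E : ⁅F, E⁆ = -H := by rw [← lie_skew, lie_E_F]

theorem lie_H_E : ⁅H, E⁆ = (2 : ℂ) • E := by
  refine Subtype.ext ?_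
  rw [LieAlgebra.SpecialLinear.sl_bracket]
  ext i j
  fin_cases i <;> fin_cases j <;> norm_num [E, H]

theorem lie_E_H : ⁅E, H⁆ = (-2 : ℂ) • E := by rw [← lie_skew, lie_H_E, neg_smul]

theorem lie_H_F : ⁅H, F⁆ = (-2 : ℂ) • F := by
  refine Subtype.ext ?_
  rw [LieAlgebra.SpecialLinear.sl_bracket]
  ext i j
  fin_cases i <;> fin_cases j <;> norm_num [F, H]

theorem lie_F_H : ⁅F, H⁆ = (2 : ℂ) • F := by rw [← lie_skew, lie_H_F, neg_smul, neg_neg]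

@[simp] theorem form_E_E : form E E = 0 := by simp [form_apply, E, Matrix.trace_fin_two]
@[simp] theorem form_E_F : form E F = 1 := by simp [form_apply, E, F, Matrix.trace_fin_two]
@[simp] theorem form_E_H : form E H = 0 := by simp [form_apply, E, H, Matrix.trace_fin_two]
@[simp] theorem form_F_E : form F E = 1 := by simp [form_apply, E, F, Matrix.trace_fin_two]
@[simp] theorem form_F_F : form F F = 0 := by simp [form_apply, F, Matrix.trace_fin_two]
@[simp] theorem form_F_H : form F H = 0 := by simp [form_apply, F, H, Matrix.trace_fin_two]
@[simp] theorem form_H_E : form H E = 0 := by simp [form_apply, E, H, Matrix.trace_fin_two]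
@[simp] theorem form_H_F : form H F = 0 := by simp [form_apply, F, H, Matrix.trace_fin_two]

theorem sl2_eq (a : sl2) : ∃ x y z : ℂ, a = x • E + y • F + z • H := by
  obtain ⟨M, hM⟩ := a
  have h : M 0 0 + M 1 1 = 0 := by
    rw [← Matrix.trace_fin_two]
    simpa [LieAlgebra.SpecialLinear.sl] using hM
  refine ⟨M 0 1, M 1 0, M 0 0, Subtype.ext ?_⟩
  ext i j
  fin_cases i <;> fin_cases j <;> simp [E, F, H]
  linear_combination h

/-- A representation of level `κ` of the affine Lie algebra on `W`, given by the operators `a(m)`. -/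
structure AffRep (κ : ℂ) (W : Type*) [AddCommGroup W] [Module ℂ W] where
  /-- The operator `a(m)`. -/
  op : ℤ → sl2 →ₗ[ℂ] Module.End ℂ W
  comm : ∀ (m n : ℤ) (a b : sl2) (w : W), op m a (op n b w) - op n b (op m a w) =
    op (m + n) ⁅a, b⁆ w + (if m + n = 0 then (m : ℂ) * form a b * κ else 0) • w

namespace AffRep

variable {κ : ℂ} {W : Type*} [AddCommGroup W] [Module ℂ W] (ρ : AffRep κ W)

theorem op_op (m n : ℤ) (a b : sl2) (w : W) : ρ.op m a (ρ.op n b w) = ρ.op n b (ρ.op m a w) +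
    (ρ.op (m + n) ⁅a, b⁆ w + (if m + n = 0 then (m : ℂ) * form a b * κ else 0) • w) := by
  rw [← ρ.comm]
  abel

/-- The representation is restricted. -/
def Restricted : Prop := ∀ (a : sl2) (w : W), ∃ N : ℤ, ∀ m, N ≤ m → ρ.op m a w = 0

/-- Invariant subspaces. -/
def Inv (N : Submodule ℂ W) : Prop := ∀ (m : ℤ) (a : sl2), ∀ x ∈ N, ρ.op m a x ∈ N

/-- The invariant subspace generated by a vector. -/
def cyc (w : W) : Submodule ℂ W := sInf {N | ρ.Inv N ∧ w ∈ N}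

theorem cyc_le {w : W} {N : Submodule ℂ W} (hN : ρ.Inv N) (hw : w ∈ N) : ρ.cyc w ≤ N :=
  sInf_le ⟨hN, hw⟩

theorem mem_cyc (w : W) : w ∈ ρ.cyc w := by
  simp only [cyc, Submodule.mem_sInf]
  exact fun N hN => hN.2

theorem inv_cyc (w : W) : ρ.Inv (ρ.cyc w) := by
  intro m a x hx
  simp only [cyc, Submodule.mem_sInf] at hx ⊢
  exact fun N hN => hN.1 m a x (hx N hN)

/-- The restriction of a representation to an invariant subspace. -/
def sub (N : Submodule ℂ W) (hN : ρ.Inv N) : AffRep κ N where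
  op m :=
    { toFun a := (ρ.op m a).restrict (hN m a)
      map_add' a b := by ext; simp
      map_smul' c a := by ext; simp }
  comm m n a b w := by
    exact Subtype.ext (ρ.comm m n a b w)

@[simp] theorem coe_sub_op (N : Submodule ℂ W) (hN : ρ.Inv N) (m : ℤ) (a : sl2) (x : N) :
    (((ρ.sub N hN).op m a x : N) : W) = ρ.op m a x := rfl

theorem cyc_sub_cyc (w : W) : (ρ.sub (ρ.cyc w) (ρ.inv_cyc w)).cyc ⟨w, ρ.mem_cyc w⟩ = ⊤ := by
  refine eq_top_iff.2 fun x _ => ?_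
  have h : ρ.cyc w ≤ ((ρ.sub (ρ.cyc w) (ρ.inv_cyc w)).cyc ⟨w, ρ.mem_cyc w⟩).map
      (ρ.cyc w).subtype := by
    refine ρ.cyc_le ?_ ⟨_, (ρ.sub (ρ.cyc w) (ρ.inv_cyc w)).mem_cyc _, rfl⟩
    rintro m a _ ⟨y, hy, rfl⟩
    exact ⟨_, (ρ.sub (ρ.cyc w) (ρ.inv_cyc w)).inv_cyc _ m a y hy, rfl⟩
  obtain ⟨y, hy, hyx⟩ := h x.2
  rwa [← Subtype.ext hyx]

/-- The set of vectors on which each current is truncated is invariant. -/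
theorem restricted_of_cyc {w : W} (h : ρ.cyc w = ⊤)
    (hw : ∀ a : sl2, ∃ N : ℤ, ∀ m, N ≤ m → ρ.op m a w = 0) : ρ.Restricted := by
  let T : Submodule ℂ W :=
    { carrier := {x | ∀ a : sl2, ∃ N : ℤ, ∀ m, N ≤ m → ρ.op m a x = 0}
      zero_mem' := fun a => ⟨0, fun m _ => map_zero _⟩
      add_mem' := by
        intro x y hx hy a
        obtain ⟨N, hN⟩ := hx a
        obtain ⟨N', hN'⟩ := hy a
        exact ⟨max N N', fun m hm => by
          rw [map_add, hN m (le_of_max_le_left hm), hN' m (le_of_max_le_right hm), add_zero]⟩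
      smul_mem' := by
        intro c x hx a
        obtain ⟨N, hN⟩ := hx a
        exact ⟨N, fun m hm => by rw [map_smul, hN m hm, smul_zero]⟩ }
  have hT : ρ.Inv T := by
    intro n b x hx a
    obtain ⟨N, hN⟩ := hx a
    obtain ⟨N', hN'⟩ := hx ⁅a, b⁆
    -- The bound `N' - n` deals with the bracket term, and `1 - n` keeps `m + n` positive, which
    -- removes the central term.
    refine ⟨max N (max (N' - n) (1 - n)), fun m hm => ?_⟩
    have h1 := le_of_max_le_left hm
    have h2 := le_of_max_le_left (le_of_max_le_right hm)
    have h3 := le_of_max_le_right (le_of_max_le_right hm)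
    rw [op_op, hN m h1, map_zero, hN' (m + n) (by omega), if_neg (by omega)]
    simp
  intro a x
  have : x ∈ T := ρ.cyc_le hT hw (h ▸ Submodule.mem_top)
  exact this a

variable {ρ}

/-- The current `a(x)`. -/
def cur (hρ : ρ.Restricted) : sl2 →ₗ[ℂ] Fld W where
  toFun a := ⟨fun n => ρ.op n a, hρ a⟩
  map_add' a b := Fld.ext fun n w => by
    rw [Fld.add_apply]; exact LinearMap.congr_fun (map_add (ρ.op n) a b) w
  map_smul' c a := Fld.ext fun n w => by
    rw [Fld.smul_apply]; exact LinearMap.congr_fun (map_smul (ρ.op n) c a) w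

variable (hρ : ρ.Restricted)

@[simp] theorem cur_apply (a : sl2) (n : ℤ) : (cur hρ a).1 n = ρ.op n a := rfl

/-- The coefficients of the commutator of two currents. -/
def curComm (a b : sl2) (j : ℕ) : Fld W :=
  if j = 0 then cur hρ ⁅a, b⁆ else if j = 1 then (form a b * κ) • one else 0

/-- The central term `p ⟨a, b⟩ κ δ_{p+q,0}` is `ch p 1` times a mode of a multiple of the identity
field. -/
theorem hasComm_cur (a b : sl2) : HasComm (cur hρ a) (cur hρ b) 2 (curComm hρ a b) := by
  refine ⟨fun j hj => by rw [curComm, if_neg (by omega), if_neg (by omega)], fun p q w => ?_⟩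
  rw [Finset.sum_range_succ, Finset.sum_range_one, cur_apply, cur_apply, ρ.comm]
  simp only [curComm, Fld.smul_apply, one_apply, if_true, one_ne_zero, if_false]
  simp only [ch_zero, one_smul, Nat.cast_zero, sub_zero, cur_apply]
  congr 1
  by_cases h : p + q = 0
  · rw [if_pos h, if_pos (by push_cast; omega), smul_smul]
    simp [ch, mul_assoc]
  · rw [if_neg h, if_neg (by push_cast; omega)]
    simp

end AffRep

/-! ### The space of fields generated by the currents. -/

section fields

variable {W : Type*} [AddCommGroup W] [Module ℂ W]

theorem hasComm_smul_one (c : ℂ) (f : Fld W) : HasComm (c • one) f 0 0 :=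
  ⟨fun _ _ => rfl, fun p q w => by
    rw [Fld.smul_apply, Fld.smul_apply, one_apply, one_apply]
    split_ifs <;> simp⟩

theorem fprod_one_left (f : Fld W) (l : ℤ) : fprod l one f = if l = -1 then f else 0 := by
  refine Fld.ext fun n w => ?_
  obtain ⟨K, hK⟩ := f.exists_bound w n
  rw [bor_apply, nop_eq_sum _ _ _ _ _ _ (K + 1) fun i hi => hK i (by omega),
    nop_eq_zero _ _ _ _ _ _ fun i => by rw [one_apply, if_neg (by omega)], smul_zero, sub_zero]
  split_ifs with h
  · rw [Finset.sum_eq_single_of_mem 0 (Finset.mem_range.2 (by omega))]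
    · rw [one_apply, if_pos (by simp [h])]
      simp
    · intro i _ hi
      rw [one_apply, if_neg (by omega), smul_zero]
  · rw [Fld.zero_apply]
    refine Finset.sum_eq_zero fun i _ => ?_
    rw [one_apply]
    split_ifs with h'
    -- Here `i = l + 1` with `l ≥ 0`, so the binomial coefficient is zero.
    · obtain ⟨j, rfl⟩ := Int.eq_ofNat_of_zero_le (show 0 ≤ l by omega)
      rw [ch_natCast_of_lt (by omega), mul_zero, zero_smul]
    · rw [smul_zero]

theorem HasComm.add_right {a f f' : Fld W} {J : ℕ} {g g' : ℕ → Fld W} (h : HasComm a f J g)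
    (h' : HasComm a f' J g') : HasComm a (f + f') J (g + g') := by
  refine ⟨fun j hj => by rw [Pi.add_apply, h.1 j hj, h'.1 j hj, add_zero], fun p q w => ?_⟩
  simp only [Fld.add_apply, map_add, Pi.add_apply, smul_add, Finset.sum_add_distrib, ← h.2, ← h'.2]
  abel

theorem HasComm.smul_right {a f : Fld W} {J : ℕ} {g : ℕ → Fld W} (h : HasComm a f J g) (c : ℂ) :
    HasComm a (c • f) J (c • g) := by
  refine ⟨fun j hj => by rw [Pi.smul_apply, h.1 j hj, smul_zero], fun p q w => ?_⟩
  simp only [Fld.smul_apply, map_smul, Pi.smul_apply]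
  rw [← smul_sub, h.2, Finset.smul_sum]
  exact Finset.sum_congr rfl fun j _ => smul_comm _ _ _

/-- The fields which satisfy the commutator formula with `a`. -/
def locSubmodule (a : Fld W) : Submodule ℂ (Fld W) where
  carrier := {f | Loc a f}
  zero_mem' := HasComm.loc (J := 0) (g := 0) ⟨fun _ _ => rfl, fun p q w => by
    simp [Fld.zero_apply]⟩
  add_mem' := by
    rintro f f' ⟨J, h⟩ ⟨J', h'⟩
    exact ((h.mono (le_max_left J J')).add_right (h'.mono (le_max_right J J'))).loc
  smul_mem' := by
    rintro c f ⟨J, h⟩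
    exact (h.smul_right c).loc

end fields

namespace AffRep

variable {κ : ℂ} {W : Type*} [AddCommGroup W] [Module ℂ W] {ρ : AffRep κ W} (hρ : ρ.Restricted)

/-- The action of the affine Lie algebra on fields, by products with the currents. -/
def fldRep : AffRep κ (Fld W) where
  op m := (bor (W := W) m 0).comp (cur hρ)
  comm m n a b f := by
    -- The term `j = 0` is the Lie bracket. The term `j = 1` is a product with the identity field,
    -- nonzero only for index `-1`, that is, for `m + n = 0`: it is the central term.
    have h := fprod_comm_sub (hasComm_cur hρ a b) f m n
    rw [Finset.sum_range_succ, Finset.sum_range_one] at h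
    simp only [LinearMap.comp_apply]
    rw [h]
    simp only [curComm, if_true, one_ne_zero, if_false, ch_zero, one_smul, Nat.cast_zero, sub_zero,
      map_smul, LinearMap.smul_apply, fprod_one_left]
    congr 1
    by_cases h : m + n = 0
    · rw [if_pos h, if_pos (by push_cast; omega), smul_smul]
      simp [ch, mul_assoc]
    · rw [if_neg h, if_neg (by push_cast; omega)]
      simp

@[simp] theorem fldRep_op (m : ℤ) (a : sl2) (f : Fld W) :
    (fldRep hρ).op m a f = fprod m (cur hρ a) f := rfl

/-- The fields generated by the currents. -/
def vfld : Submodule ℂ (Fld W) := (fldRep hρ).cyc one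

theorem one_mem_vfld : one ∈ vfld hρ := (fldRep hρ).mem_cyc one

theorem fprod_cur_mem {f : Fld W} (hf : f ∈ vfld hρ) (m : ℤ) (a : sl2) :
    fprod m (cur hρ a) f ∈ vfld hρ := (fldRep hρ).inv_cyc one m a f hf

theorem vfld_le {N : Submodule ℂ (Fld W)} (h1 : one ∈ N)
    (hN : ∀ (m : ℤ) (a : sl2), ∀ f ∈ N, fprod m (cur hρ a) f ∈ N) : vfld hρ ≤ N :=
  (fldRep hρ).cyc_le hN h1

theorem loc_curComm (a b : sl2) (j : ℕ) {f : Fld W} (hf : ∀ a : sl2, Loc (cur hρ a) f) :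
    Loc (curComm hρ a b j) f := by
  unfold curComm
  split_ifs
  · exact hf _
  · exact (hasComm_smul_one _ f).loc
  · simpa using (hasComm_smul_one 0 f).loc

/-- Dong's lemma applies along the generation of `vfld`, because the coefficients of the commutator
of two currents are currents or multiples of the identity. Locality with all currents has to be
carried at once. -/
theorem loc_cur {f : Fld W} (hf : f ∈ vfld hρ) (a : sl2) : Loc (cur hρ a) f := by
  have h : vfld hρ ≤ ⨅ a, locSubmodule (cur hρ a) := by
    refine vfld_le hρ ?_ ?_
    · exact (Submodule.mem_iInf _).2 fun a => (hasComm_one _).loc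
    · intro m b f hf
      have hf' : ∀ a, Loc (cur hρ a) f := fun a => (Submodule.mem_iInf _).1 hf a
      exact (Submodule.mem_iInf _).2 fun a =>
        (hasComm_cur hρ a b).loc_fprod (hf' a) (fun j _ => loc_curComm hρ a b j hf') m
  exact (Submodule.mem_iInf _).1 (h hf) a

theorem deriv_mem_vfld {f : Fld W} (hf : f ∈ vfld hρ) : deriv f ∈ vfld hρ := by
  have h : vfld hρ ≤ vfld hρ ⊓ (vfld hρ).comap deriv := by
    refine vfld_le hρ ⟨one_mem_vfld hρ, by simp⟩ ?_
    rintro m a f ⟨hf, hf'⟩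
    refine ⟨fprod_cur_mem hρ hf m a, ?_⟩
    change deriv (fprod m (cur hρ a) f) ∈ vfld hρ
    rw [deriv_fprod]
    exact sub_mem (fprod_cur_mem hρ hf' m a)
      (Submodule.smul_mem _ _ (fprod_cur_mem hρ hf _ a))
  exact (h hf).2

/-- A field generated by the currents has a commutator formula with a current whose coefficients
are generated by the currents. -/
theorem exists_hasComm_cur {v : Fld W} (hv : v ∈ vfld hρ) (a : sl2) :
    ∃ (J : ℕ) (g : ℕ → Fld W), HasComm v (cur hρ a) J g ∧ ∀ j, g j ∈ vfld hρ := by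
  obtain ⟨J, hJ⟩ := loc_cur hρ hv a
  refine ⟨J, _, hJ.skew, fun j => Submodule.sum_mem _ fun i _ => ?_⟩
  split_ifs
  · exact Submodule.smul_mem _ _ (divDeriv_mem (fun f hf => deriv_mem_vfld hρ hf) _
      (fprod_cur_mem hρ hv _ a))
  · exact Submodule.zero_mem _

/-- Induction on the generation of `u`, simultaneously for all `v`: moving `v` past a current
produces, by skew symmetry, coefficients `g j` that are again in `vfld`, and the induction
hypothesis is needed for these. -/
theorem fprod_mem_and_loc {u : Fld W} (hu : u ∈ vfld hρ) {v : Fld W} (hv : v ∈ vfld hρ) :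
    (∀ l, fprod l v u ∈ vfld hρ) ∧ Loc v u := by
  have h : vfld hρ ≤ vfld hρ ⊓ ⨅ v : vfld hρ, (⨅ l, (vfld hρ).comap (fprod l v.1)) ⊓
      locSubmodule v.1 := by
    refine vfld_le hρ ⟨one_mem_vfld hρ, (Submodule.mem_iInf _).2 fun v =>
      ⟨(Submodule.mem_iInf _).2 fun l => ?_, (hasComm_one _).loc⟩⟩ ?_
    · exact fprod_one_mem (fun f hf => deriv_mem_vfld hρ hf) v.2 l
    · rintro m a f ⟨hf, hf'⟩
      have key : ∀ v ∈ vfld hρ, (∀ l, fprod l v f ∈ vfld hρ) ∧ Loc v f := by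
        intro v hv
        have := (Submodule.mem_iInf _).1 hf' ⟨v, hv⟩
        exact ⟨fun l => (Submodule.mem_iInf _).1 this.1 l, this.2⟩
      refine ⟨fprod_cur_mem hρ hf m a, (Submodule.mem_iInf _).2 fun v => ?_⟩
      obtain ⟨J, g, hJ, hg⟩ := exists_hasComm_cur hρ v.2 a
      refine ⟨(Submodule.mem_iInf _).2 fun l => ?_,
        hJ.loc_fprod (key v.1 v.2).2 (fun j _ => (key _ (hg j)).2) m⟩
      change fprod l v.1 (fprod m (cur hρ a) f) ∈ vfld hρ
      rw [← sub_add_cancel (fprod l v.1 (fprod m (cur hρ a) f))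
        (fprod m (cur hρ a) (fprod l v.1 f)), fprod_comm_sub hJ]
      exact add_mem (Submodule.sum_mem _ fun j _ => Submodule.smul_mem _ _ ((key _ (hg j)).1 _))
        (fprod_cur_mem hρ ((key v.1 v.2).1 l) m a)
  have h' := (Submodule.mem_iInf _).1 (h hu).2 ⟨v, hv⟩
  exact ⟨fun l => (Submodule.mem_iInf _).1 h'.1 l, h'.2⟩

end AffRep

end AffineSl2

end

noncomputable section

namespace AffineSl2

/-! ### Highest weight representations -/

section linear

variable {W : Type*} [AddCommGroup W] [Module ℂ W]

/-- The sum of a sequence of endomorphisms which is finite on each vector. -/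
def lfsum (t : ℕ → Module.End ℂ W) (h : ∀ w, ∃ K, ∀ i, K ≤ i → t i w = 0) :
    Module.End ℂ W where
  toFun w := ∑ᶠ i, t i w
  map_add' x y := by
    obtain ⟨K, hK⟩ := h x
    obtain ⟨K', hK'⟩ := h y
    rw [finsum_eq_sum_range (max K K') fun i hi => hK i (le_of_max_le_left hi),
      finsum_eq_sum_range (max K K') fun i hi => hK' i (le_of_max_le_right hi),
      finsum_eq_sum_range (max K K') fun i hi => by
        rw [map_add, hK i (le_of_max_le_left hi), hK' i (le_of_max_le_right hi), add_zero],
      ← Finset.sum_add_distrib]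
    simp only [map_add]
  map_smul' c x := by
    obtain ⟨K, hK⟩ := h x
    rw [finsum_eq_sum_range K hK, finsum_eq_sum_range K fun i hi => by
      rw [map_smul, hK i hi, smul_zero], RingHom.id_apply, Finset.smul_sum]
    simp only [map_smul]

theorem lfsum_eq_sum {t : ℕ → Module.End ℂ W} (h : ∀ w, ∃ K, ∀ i, K ≤ i → t i w = 0) {w : W}
    {K : ℕ} (hK : ∀ i, K ≤ i → t i w = 0) : lfsum t h w = ∑ i ∈ Finset.range K, t i w :=
  finsum_eq_sum_range K hK

theorem aeval_mem {T : Module.End ℂ W} {N : Submodule ℂ W} (hN : ∀ x ∈ N, T x ∈ N)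
    (p : Polynomial ℂ) {x : W} (hx : x ∈ N) : Polynomial.aeval T p x ∈ N := by
  induction p using Polynomial.induction_on' with
  | add p q hp hq => rw [map_add]; exact add_mem hp hq
  | monomial n c =>
    rw [Polynomial.aeval_monomial, Module.End.mul_apply, Module.algebraMap_end_apply]
    refine N.smul_mem _ ?_
    induction n with
    | zero => simpa using hx
    | succ n ih => rw [pow_succ', Module.End.mul_apply]; exact hN _ ih

theorem aeval_eigenvector {T : Module.End ℂ W} {c : ℂ} {x : W} (h : T x = c • x)
    (p : Polynomial ℂ) : Polynomial.aeval T p x = p.eval c • x := by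
  induction p using Polynomial.induction_on' with
  | add p q hp hq => rw [map_add, LinearMap.add_apply, hp, hq, Polynomial.eval_add, add_smul]
  | monomial n a =>
    rw [Polynomial.aeval_monomial, Module.End.mul_apply, Module.algebraMap_end_apply,
      Polynomial.eval_monomial, mul_smul]
    congr 1
    induction n with
    | zero => simp
    | succ n ih => rw [pow_succ', Module.End.mul_apply, ih, map_smul, h, smul_smul, pow_succ]

/-- The vectors annihilated by `p(T)` for some polynomial `p` all of whose roots are in `R`. -/
def rootsIn (T : Module.End ℂ W) (R : Set ℂ) : Submodule ℂ W where
  carrier := {x | ∃ p : Polynomial ℂ, Polynomial.aeval T p x = 0 ∧ ∀ s, p.eval s = 0 → s ∈ R}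
  zero_mem' := ⟨1, map_zero _, fun s hs => by simp at hs⟩
  add_mem' := by
    rintro x y ⟨p, hp, hp'⟩ ⟨q, hq, hq'⟩
    refine ⟨p * q, ?_, fun s hs => ?_⟩
    · rw [map_add]
      nth_rw 1 [mul_comm]
      simp only [map_mul, Module.End.mul_apply, hp, hq, map_zero, add_zero]
    · rw [Polynomial.eval_mul, mul_eq_zero] at hs
      exact hs.elim (hp' s) (hq' s)
  smul_mem' := by
    rintro c x ⟨p, hp, hp'⟩
    exact ⟨p, by rw [map_smul, hp, smul_zero], hp'⟩

theorem mem_rootsIn {T : Module.End ℂ W} {R : Set ℂ} {c : ℂ} {x : W} (h : T x = c • x)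
    (hc : c ∈ R) : x ∈ rootsIn T R :=
  ⟨Polynomial.X - Polynomial.C c, by rw [aeval_eigenvector h]; simp, fun s hs => by
    rw [Polynomial.eval_sub, Polynomial.eval_X, Polynomial.eval_C, sub_eq_zero] at hs
    rwa [hs]⟩

theorem eigenvalue_mem_of_mem_rootsIn {T : Module.End ℂ W} {R : Set ℂ} {c : ℂ} {x : W}
    (h : T x = c • x) (hx : x ≠ 0) (hxR : x ∈ rootsIn T R) : c ∈ R := by
  obtain ⟨p, hp, hp'⟩ := hxR
  rw [aeval_eigenvector h] at hp
  exact hp' c ((smul_eq_zero.1 hp).resolve_right hx)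

/-- Strip linear factors from `p` until the quotient no longer kills `x`. -/
theorem exists_eigenvector_of_aeval {T : Module.End ℂ W} (n : ℕ) {p : Polynomial ℂ} (hp : p ≠ 0)
    (hn : p.natDegree ≤ n) {x : W} (hx : x ≠ 0) (h : Polynomial.aeval T p x = 0) :
    ∃ (c : ℂ) (q : Polynomial ℂ), Polynomial.aeval T q x ≠ 0 ∧
      T (Polynomial.aeval T q x) = c • Polynomial.aeval T q x := by
  induction n generalizing p with
  | zero =>
    rw [Polynomial.eq_C_of_natDegree_le_zero hn] at h hp
    rw [Polynomial.aeval_C, Module.algebraMap_end_apply] at h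
    rcases smul_eq_zero.1 h with h | h
    · exact absurd (by rw [h, Polynomial.C_0]) hp
    · exact absurd h hx
  | succ n ih =>
    by_cases hd : p.natDegree = 0
    · exact ih hp (by omega) h
    obtain ⟨c, hc⟩ := IsAlgClosed.exists_root p fun hd' => hd
      (Polynomial.natDegree_eq_of_degree_eq_some hd')
    obtain ⟨q, rfl⟩ := Polynomial.dvd_iff_isRoot.2 hc
    have hq : q ≠ 0 := right_ne_zero_of_mul hp
    by_cases hqx : Polynomial.aeval T q x = 0
    · rw [Polynomial.natDegree_mul (Polynomial.X_sub_C_ne_zero c) hq,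
        Polynomial.natDegree_X_sub_C] at hn
      exact ih hq (by omega) hqx
    · refine ⟨c, q, hqx, ?_⟩
      rw [map_mul, Module.End.mul_apply] at h
      simpa [sub_eq_zero] using h

/-- A nonzero vector of `rootsIn T R` generates an eigenvector under `T`. -/
theorem exists_eigenvector {T : Module.End ℂ W} {R : Set ℂ} (hR : R ≠ Set.univ) {x : W}
    (hx : x ≠ 0) (hxR : x ∈ rootsIn T R) : ∃ (c : ℂ) (q : Polynomial ℂ),
      Polynomial.aeval T q x ≠ 0 ∧ T (Polynomial.aeval T q x) = c • Polynomial.aeval T q x := by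
  obtain ⟨p, hp, hp'⟩ := hxR
  refine exists_eigenvector_of_aeval p.natDegree ?_ le_rfl hx hp
  rintro rfl
  exact hR (Set.eq_univ_of_forall fun s => hp' s (by simp))

/-- The vectors on which `f` is nilpotent. -/
def nilp (f : Module.End ℂ W) : Submodule ℂ W where
  carrier := {x | ∃ M : ℕ, (f ^ M) x = 0}
  zero_mem' := ⟨0, map_zero _⟩
  add_mem' := by
    rintro x y ⟨M, hM⟩ ⟨M', hM'⟩
    refine ⟨M + M', ?_⟩
    rw [map_add, pow_add, Module.End.mul_apply, Module.End.mul_apply, hM', map_zero, add_zero,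
      ← Module.End.mul_apply, ← pow_add, add_comm, pow_add, Module.End.mul_apply, hM, map_zero]
  smul_mem' := by
    rintro c x ⟨M, hM⟩
    exact ⟨M, by rw [map_smul, hM, smul_zero]⟩

theorem mem_nilp_of_apply {f : Module.End ℂ W} {x : W} (h : f x ∈ nilp f) : x ∈ nilp f := by
  obtain ⟨M, hM⟩ := h
  exact ⟨M + 1, by rw [pow_succ, Module.End.mul_apply, hM]⟩

/-- Induction on the order of nilpotency of `x`: `f (A x)` is `A (f x)`, where the order has
dropped, plus `B x`. -/
theorem map_nilp {f A B : Module.End ℂ W} (hB : ∀ x ∈ nilp f, B x ∈ nilp f)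
    (h : ∀ x, f (A x) = A (f x) + B x) : ∀ x ∈ nilp f, A x ∈ nilp f := by
  rintro x ⟨M, hM⟩
  induction M generalizing x with
  | zero =>
    rw [pow_zero, Module.End.one_apply] at hM
    rw [hM, map_zero]
    exact zero_mem _
  | succ M ih =>
    refine mem_nilp_of_apply ?_
    rw [h]
    exact add_mem (ih _ (by rwa [pow_succ, Module.End.mul_apply] at hM)) (hB x ⟨M + 1, hM⟩)

section sl2

variable {e f h : Module.End ℂ W} (hef : ∀ x, e (f x) = f (e x) + h x)
  (hhf : ∀ x, h (f x) = f (h x) - (2 : ℂ) • f x) {s : W} {c : ℂ} (hes : e s = 0) (hhs : h s = c • s)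
include hef hhf hes hhs

/-- The triple is abstract because it is used for both simple roots: `E(0), F(0), H(0)` and `F(1),
E(-1), k - H(0)`. -/
theorem sl2_pow (i : ℕ) : h ((f ^ i) s) = (c - 2 * i) • (f ^ i) s ∧
    e ((f ^ (i + 1)) s) = ((i + 1) * (c - i)) • (f ^ i) s := by
  induction i with
  | zero => simp [hef, hes, hhs]
  | succ i ih =>
    have h1 : h ((f ^ (i + 1)) s) = (c - 2 * (i + 1 : ℕ)) • (f ^ (i + 1)) s := by
      rw [pow_succ', Module.End.mul_apply, hhf, ih.1, map_smul, ← sub_smul]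
      push_cast
      congr 1
      ring
    refine ⟨h1, ?_⟩
    rw [pow_succ' f (i + 1), Module.End.mul_apply, hef, ih.2, h1, map_smul,
      ← Module.End.mul_apply, ← pow_succ', ← add_smul]
    push_cast
    congr 1
    ring

theorem sl2_pow_ne_zero {n : ℕ} (hc : c = n) (hs : s ≠ 0) : (f ^ n) s ≠ 0 := by
  have H : ∀ i : ℕ, i ≤ n → (f ^ i) s ≠ 0 := by
    intro i
    induction i with
    | zero => intro _; simpa using hs
    | succ i ih =>
      intro hi h0
      have h1 := (sl2_pow hef hhf hes hhs i).2
      rw [h0, map_zero, hc] at h1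
      refine (smul_ne_zero (mul_ne_zero ?_ ?_) (ih (by omega))) h1.symm
      · exact_mod_cast Nat.succ_ne_zero i
      · rw [sub_ne_zero]
        exact_mod_cast (show n ≠ i by omega)
  exact H n le_rfl

/-- If `f^(j+1) s` is the first vanishing power, applying `e` gives `(j + 1)(c - j) f^j s = 0`. -/
theorem sl2_weight {M : ℕ} (hs : s ≠ 0) (hM : (f ^ M) s = 0) : ∃ j : ℕ, c = j := by
  classical
  have hex : ∃ M, (f ^ M) s = 0 := ⟨M, hM⟩
  have h0 : Nat.find hex ≠ 0 := fun h => hs (by simpa [h] using Nat.find_spec hex)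
  obtain ⟨j, hj⟩ := Nat.exists_eq_succ_of_ne_zero h0
  refine ⟨j, ?_⟩
  have h1 := (sl2_pow hef hhf hes hhs j).2
  have h2 := Nat.find_spec hex
  rw [hj] at h2
  rw [Nat.succ_eq_add_one] at h2
  rw [h2, map_zero] at h1
  have h3 : (f ^ j) s ≠ 0 := Nat.find_min hex (by omega)
  have h4 := (smul_eq_zero.1 h1.symm).resolve_right h3
  have h5 : (j : ℂ) + 1 ≠ 0 := by exact_mod_cast Nat.succ_ne_zero j
  exact sub_eq_zero.1 ((mul_eq_zero.1 h4).resolve_left h5)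

end sl2

end linear

namespace AffRep

variable {κ : ℂ} {W : Type*} [AddCommGroup W] [Module ℂ W] (ρ : AffRep κ W)

theorem op_E_H (m n : ℤ) (w : W) : ρ.op m E (ρ.op n H w) =
    ρ.op n H (ρ.op m E w) - (2 : ℂ) • ρ.op (m + n) E w := by
  rw [op_op, lie_E_H, form_E_H]
  simp only [map_smul, LinearMap.smul_apply, mul_zero, zero_mul, ite_self, zero_smul]
  module

theorem op_F_H (m n : ℤ) (w : W) : ρ.op m F (ρ.op n H w) =
    ρ.op n H (ρ.op m F w) + (2 : ℂ) • ρ.op (m + n) F w := by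
  rw [op_op, lie_F_H, form_F_H]
  simp

theorem op_E_F (m n : ℤ) (w : W) : ρ.op m E (ρ.op n F w) =
    ρ.op n F (ρ.op m E w) + (ρ.op (m + n) H w + (if m + n = 0 then (m : ℂ) * κ else 0) • w) := by
  rw [op_op, lie_E_F, form_E_F]
  simp

theorem op_F_E (m n : ℤ) (w : W) : ρ.op m F (ρ.op n E w) =
    ρ.op n E (ρ.op m F w) + (-ρ.op (m + n) H w + (if m + n = 0 then (m : ℂ) * κ else 0) • w) := by
  rw [op_op, lie_F_E, form_F_E]
  simp

theorem op_E_E (m n : ℤ) (w : W) : ρ.op m E (ρ.op n E w) = ρ.op n E (ρ.op m E w) := by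
  rw [op_op, lie_self, form_E_E]
  simp

theorem op_F_F (m n : ℤ) (w : W) : ρ.op m F (ρ.op n F w) = ρ.op n F (ρ.op m F w) := by
  rw [op_op, lie_self, form_F_F]
  simp

theorem op_H_E (m n : ℤ) (w : W) : ρ.op m H (ρ.op n E w) =
    ρ.op n E (ρ.op m H w) + (2 : ℂ) • ρ.op (m + n) E w := by
  rw [op_op, lie_H_E, form_H_E]
  simp

theorem op_H_F (m n : ℤ) (w : W) : ρ.op m H (ρ.op n F w) =
    ρ.op n F (ρ.op m H w) - (2 : ℂ) • ρ.op (m + n) F w := by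
  rw [op_op, lie_H_F, form_H_F]
  simp only [map_smul, LinearMap.smul_apply, mul_zero, zero_mul, ite_self, zero_smul]
  module

/-- The summands of positive index of the Casimir operator. -/
def casTerm (j : ℤ) : Module.End ℂ W :=
  ρ.op (-j) H * ρ.op j H + (2 : ℂ) • (ρ.op (-j) E * ρ.op j F) +
    (2 : ℂ) • (ρ.op (-j) F * ρ.op j E)

theorem casTerm_apply (j : ℤ) (w : W) : ρ.casTerm j w = ρ.op (-j) H (ρ.op j H w) +
    (2 : ℂ) • ρ.op (-j) E (ρ.op j F w) + (2 : ℂ) • ρ.op (-j) F (ρ.op j E w) := rfl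

variable {ρ}

theorem Restricted.exists_bound (hρ : ρ.Restricted) (w : W) :
    ∃ K : ℕ, ∀ (a : sl2) (m : ℤ), K ≤ m → ρ.op m a w = 0 := by
  obtain ⟨N₁, h₁⟩ := hρ E w
  obtain ⟨N₂, h₂⟩ := hρ F w
  obtain ⟨N₃, h₃⟩ := hρ H w
  refine ⟨N₁.toNat + N₂.toNat + N₃.toNat, fun a m hm => ?_⟩
  obtain ⟨x, y, z, rfl⟩ := sl2_eq a
  simp [h₁ m (by omega), h₂ m (by omega), h₃ m (by omega)]

theorem Restricted.casTerm_eq_zero (hρ : ρ.Restricted) (w : W) :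
    ∃ K : ℕ, ∀ i : ℕ, K ≤ i → ρ.casTerm ((i : ℤ) + 1) w = 0 := by
  obtain ⟨K, hK⟩ := hρ.exists_bound w
  refine ⟨K, fun i hi => ?_⟩
  simp [casTerm_apply, hK _ ((i : ℤ) + 1) (by omega)]

/-- The Sugawara operator, up to normalization. -/
def cas (hρ : ρ.Restricted) : Module.End ℂ W :=
  (1 / 2 : ℂ) • (ρ.op 0 H * ρ.op 0 H) + ρ.op 0 H + (2 : ℂ) • (ρ.op 0 F * ρ.op 0 E) +
    lfsum (fun i : ℕ => ρ.casTerm ((i : ℤ) + 1)) hρ.casTerm_eq_zero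

theorem cas_apply (hρ : ρ.Restricted) {w : W} {K : ℕ}
    (hK : ∀ i : ℕ, K ≤ i → ρ.casTerm ((i : ℤ) + 1) w = 0) : cas hρ w =
      (1 / 2 : ℂ) • ρ.op 0 H (ρ.op 0 H w) + ρ.op 0 H w + (2 : ℂ) • ρ.op 0 F (ρ.op 0 E w) +
      ∑ i ∈ Finset.range K, ρ.casTerm ((i : ℤ) + 1) w := by
  rw [← lfsum_eq_sum hρ.casTerm_eq_zero hK]
  rfl

/-- If the commutators of `x` with the summands of the Casimir operator telescope, they add up to
the first term. -/
theorem cas_comm (hρ : ρ.Restricted) (m : ℤ) (a : sl2) (g : ℕ → Module.End ℂ W) (c : ℂ) (w : W)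
    (hg : ∃ K : ℕ, ∀ i, K ≤ i → g i w = 0)
    (h : ∀ i : ℕ, ρ.op m a (ρ.casTerm ((i : ℤ) + 1) w) = ρ.casTerm ((i : ℤ) + 1) (ρ.op m a w) +
      (g i w - g (i + 1) w) + (if i = 0 then c else 0) • ρ.op m a w) :
    ρ.op m a (cas hρ w) = cas hρ (ρ.op m a w) +
      (ρ.op m a ((1 / 2 : ℂ) • ρ.op 0 H (ρ.op 0 H w) + ρ.op 0 H w +
        (2 : ℂ) • ρ.op 0 F (ρ.op 0 E w)) -
      ((1 / 2 : ℂ) • ρ.op 0 H (ρ.op 0 H (ρ.op m a w)) + ρ.op 0 H (ρ.op m a w) +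
        (2 : ℂ) • ρ.op 0 F (ρ.op 0 E (ρ.op m a w)))) + g 0 w + c • ρ.op m a w := by
  obtain ⟨K₁, h₁⟩ := hρ.casTerm_eq_zero w
  obtain ⟨K₂, h₂⟩ := hρ.casTerm_eq_zero (ρ.op m a w)
  obtain ⟨K₃, h₃⟩ := hg
  obtain ⟨K, e₁, e₂, e₃⟩ : ∃ K : ℕ, K₁ ≤ K + 1 ∧ K₂ ≤ K + 1 ∧ K₃ ≤ K + 1 :=
    ⟨K₁ + K₂ + K₃, by omega, by omega, by omega⟩
  rw [cas_apply hρ (K := K + 1) fun i hi => h₁ i (by omega),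
    cas_apply hρ (K := K + 1) fun i hi => h₂ i (by omega), map_add, map_sum,
    Finset.sum_congr rfl fun i _ => h i, Finset.sum_add_distrib, Finset.sum_add_distrib,
    Finset.sum_range_sub', h₃ (K + 1) e₃, Finset.sum_eq_single_of_mem
    (f := fun i => (if i = 0 then c else 0) • ρ.op m a w) 0 (by simp) (fun i _ hi => by rw [if_neg hi, zero_smul]), if_pos rfl]
  module

/-- Up to the factor `2(κ + 2)`, the Sugawara operator measures the degree in `t`. Its commutators
are computed only with the Chevalley generators `E(-1)`, `F(1)`, `E(0)`, `F(0)`, which is all that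
the principal gradation requires. -/
theorem cas_E_neg_one (hρ : ρ.Restricted) (w : W) : cas hρ (ρ.op (-1) E w) =
    ρ.op (-1) E (cas hρ w) + (2 * (κ + 2)) • ρ.op (-1) E w := by
  obtain ⟨K, hK⟩ := hρ.exists_bound w
  -- These are the boundary terms left by commuting `E(-1)` with successive summands. The constant
  -- `-2κ` is the central term of `E(-1)` and `F(1)`, present only in the first summand.
  rw [cas_comm hρ (-1) E (fun i => (2 : ℂ) • (ρ.op (-((i : ℤ) + 1)) E * ρ.op i H) -
    (2 : ℂ) • (ρ.op (-((i : ℤ) + 1)) H * ρ.op i E)) (-2 * κ) w]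
  · simp only [map_add, map_smul, op_E_H, op_E_F, op_E_E ρ (-1) 0, LinearMap.sub_apply,
      LinearMap.smul_apply, Module.End.mul_apply, map_sub, Nat.cast_zero, add_zero, zero_add]
    norm_num
    module
  · exact ⟨K, fun i hi => by simp [hK _ (i : ℤ) (by omega)]⟩
  · intro i
    simp only [casTerm_apply, map_add, map_smul, op_E_H ρ (-1), op_E_F ρ (-1), op_E_E ρ (-1),
      LinearMap.sub_apply, LinearMap.smul_apply, Module.End.mul_apply, map_sub,
      show (-1 : ℤ) + -((i : ℤ) + 1) = -(((i + 1 : ℕ) : ℤ) + 1) by push_cast; ring,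
      show (-1 : ℤ) + ((i : ℤ) + 1) = i by ring,
      show ((i + 1 : ℕ) : ℤ) = (i : ℤ) + 1 by push_cast; ring,
      if_neg (show ¬ (-((i : ℤ) + 1 + 1) = 0) by omega)]
    by_cases hi : i = 0
    · subst hi
      simp
      module
    · rw [if_neg (by omega), if_neg hi]
      module

theorem cas_F_one (hρ : ρ.Restricted) (w : W) : cas hρ (ρ.op 1 F w) =
    ρ.op 1 F (cas hρ w) - (2 * (κ + 2)) • ρ.op 1 F w := by
  obtain ⟨K, hK⟩ := hρ.exists_bound w
  rw [cas_comm hρ 1 F (fun i => (2 : ℂ) • (ρ.op (-(i : ℤ)) F * ρ.op ((i : ℤ) + 1) H) -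
    (2 : ℂ) • (ρ.op (-(i : ℤ)) H * ρ.op ((i : ℤ) + 1) F)) (2 * κ) w]
  · simp only [map_add, map_smul, op_F_H, op_F_E ρ 1 0, op_F_F ρ 1 0, LinearMap.sub_apply,
      LinearMap.smul_apply, Module.End.mul_apply, map_neg, Nat.cast_zero, add_zero,
      zero_add, neg_zero]
    norm_num
    module
  · exact ⟨K, fun i hi => by simp [hK _ ((i : ℤ) + 1) (by omega)]⟩
  · intro i
    simp only [casTerm_apply, map_add, map_smul, op_F_H ρ 1, op_F_E ρ 1, op_F_F ρ 1,
      LinearMap.sub_apply, LinearMap.smul_apply, Module.End.mul_apply, map_neg,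
      show (1 : ℤ) + -((i : ℤ) + 1) = -(i : ℤ) by ring,
      show (1 : ℤ) + ((i : ℤ) + 1) = (i : ℤ) + 1 + 1 by ring,
      show ((i + 1 : ℕ) : ℤ) = (i : ℤ) + 1 by push_cast; ring,
      if_neg (show ¬ ((i : ℤ) + 1 + 1 = 0) by omega)]
    by_cases hi : i = 0
    · subst hi
      simp
      module
    · rw [if_neg (by omega), if_neg hi]
      module

theorem cas_E_zero (hρ : ρ.Restricted) (w : W) : cas hρ (ρ.op 0 E w) = ρ.op 0 E (cas hρ w) := by
  rw [cas_comm hρ 0 E 0 0 w]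
  · simp only [map_add, map_smul, op_E_H, op_E_F, map_sub, add_zero, Pi.zero_apply,
      LinearMap.zero_apply]
    norm_num
    module
  · exact ⟨0, fun i _ => rfl⟩
  · intro i
    simp only [casTerm_apply, map_add, map_smul, op_E_H ρ 0, op_E_F ρ 0, op_E_E ρ 0, map_sub,
      zero_add, Int.cast_zero, zero_mul, ite_self, zero_smul, map_zero, Pi.zero_apply,
      LinearMap.zero_apply]
    module

theorem cas_F_zero (hρ : ρ.Restricted) (w : W) : cas hρ (ρ.op 0 F w) = ρ.op 0 F (cas hρ w) := by
  rw [cas_comm hρ 0 F 0 0 w]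
  · simp only [map_add, map_smul, op_F_H, op_F_E ρ 0 0, map_neg, add_zero, Pi.zero_apply,
      LinearMap.zero_apply]
    norm_num
    module
  · exact ⟨0, fun i _ => rfl⟩
  · intro i
    simp only [casTerm_apply, map_add, map_smul, op_F_H ρ 0, op_F_E ρ 0, op_F_F ρ 0,
      map_neg, zero_add, Int.cast_zero, zero_mul, ite_self, zero_smul, map_zero, Pi.zero_apply,
      LinearMap.zero_apply]
    module

end AffRep

end AffineSl2

end

noncomputable section

namespace AffineSl2

namespace AffRep

variable {κ : ℂ} {W : Type*} [AddCommGroup W] [Module ℂ W] {ρ : AffRep κ W}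

/-! ### The principal gradation -/

/-- The operator of the principal gradation. -/
def pri (hρ : ρ.Restricted) : Module.End ℂ W := (2 / (κ + 2)) • cas hρ - ρ.op 0 H

section pri

variable (hρ : ρ.Restricted) (hκ : κ + 2 ≠ 0) (w : W)

theorem pri_apply : pri hρ w = (2 / (κ + 2)) • cas hρ w - ρ.op 0 H w := rfl

/-- With `cas = 2(κ + 2) L₀`, the operator `pri` is `4 L₀ - H(0)`: the generators `F(0)` and `E(-1)`
raise its eigenvalue by `2`, and `E(0)` and `F(1)` lower it by `2`. -/
theorem pri_E_zero : pri hρ (ρ.op 0 E w) = ρ.op 0 E (pri hρ w) - (2 : ℂ) • ρ.op 0 E w := by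
  rw [pri_apply, pri_apply, cas_E_zero, op_H_E, map_sub, map_smul, add_zero]
  module

theorem pri_F_zero : pri hρ (ρ.op 0 F w) = ρ.op 0 F (pri hρ w) + (2 : ℂ) • ρ.op 0 F w := by
  rw [pri_apply, pri_apply, cas_F_zero, op_H_F, map_sub, map_smul, add_zero]
  module

include hκ

theorem pri_E_neg_one :
    pri hρ (ρ.op (-1) E w) = ρ.op (-1) E (pri hρ w) + (2 : ℂ) • ρ.op (-1) E w := by
  rw [pri_apply, pri_apply, cas_E_neg_one, op_H_E, map_sub, map_smul, zero_add, smul_add,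
    smul_smul, show 2 / (κ + 2) * (2 * (κ + 2)) = 4 by field_simp; norm_num]
  module

theorem pri_F_one :
    pri hρ (ρ.op 1 F w) = ρ.op 1 F (pri hρ w) - (2 : ℂ) • ρ.op 1 F w := by
  rw [pri_apply, pri_apply, cas_F_one, op_H_F, map_sub, map_smul, zero_add, smul_sub,
    smul_smul, show 2 / (κ + 2) * (2 * (κ + 2)) = 4 by field_simp; norm_num]
  module

end pri

/-- `H(0)` is the commutator of `E(0)` and `F(0)`, which commute with `cas`. -/
theorem op_H_cas (hρ : ρ.Restricted) (w : W) : ρ.op 0 H (cas hρ w) = cas hρ (ρ.op 0 H w) := by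
  have h (x : W) : ρ.op 0 H x = ρ.op 0 E (ρ.op 0 F x) - ρ.op 0 F (ρ.op 0 E x) := by
    rw [op_E_F]
    simp
  rw [h, h w, map_sub, cas_E_zero, cas_F_zero, cas_F_zero, cas_E_zero]

theorem op_H_pri (hρ : ρ.Restricted) (w : W) : ρ.op 0 H (pri hρ w) = pri hρ (ρ.op 0 H w) := by
  rw [pri_apply, pri_apply, map_sub, map_smul, op_H_cas]

variable (ρ) in
/-- Highest weight vectors of weight `μ`, except that they may be zero. -/
structure HW (μ : ℂ) (w : W) : Prop where
  E_zero : ρ.op 0 E w = 0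
  pos : ∀ (m : ℤ) (a : sl2), 0 < m → ρ.op m a w = 0
  H_zero : ρ.op 0 H w = μ • w

/-- The eigenvalue of the principal gradation on highest weight vectors of weight `μ`. -/
def priVal (κ μ : ℂ) : ℂ := (2 / (κ + 2)) * (μ ^ 2 / 2 + μ) - μ

theorem HW.pri_eq {μ : ℂ} {w : W} (h : ρ.HW μ w) (hρ : ρ.Restricted) :
    pri hρ w = priVal κ μ • w := by
  rw [pri_apply, cas_apply hρ (K := 0) fun i _ => by
    simp [casTerm_apply, h.pos ((i : ℤ) + 1) _ (by omega)]]
  rw [h.H_zero, map_smul, h.H_zero, h.E_zero, priVal, map_zero, Finset.sum_range_zero]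
  module

theorem HW.restricted {μ : ℂ} {w : W} (h : ρ.HW μ w) (hw : ρ.cyc w = ⊤) : ρ.Restricted :=
  ρ.restricted_of_cyc hw fun a => ⟨1, fun m hm => h.pos m a (by omega)⟩

variable (ρ) in
/-- The vector obtained from `w` by applying a word in `F(0)` and `E(-1)`. -/
def word (w : W) : List Bool → W
  | [] => w
  | true :: l => ρ.op 0 F (word w l)
  | false :: l => ρ.op (-1) E (word w l)

variable (ρ) in
/-- The span of the words of length at least `j`. -/
def wordSpan (w : W) (j : ℕ) : Submodule ℂ W :=
  Submodule.span ℂ (ρ.word w '' {l | j ≤ l.length})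

theorem word_mem_wordSpan (w : W) {l : List Bool} {j : ℕ} (h : j ≤ l.length) :
    ρ.word w l ∈ ρ.wordSpan w j := Submodule.subset_span ⟨l, h, rfl⟩

theorem wordSpan_le {w : W} {j : ℕ} {N : Submodule ℂ W}
    (h : ∀ l : List Bool, j ≤ l.length → ρ.word w l ∈ N) : ρ.wordSpan w j ≤ N := by
  refine Submodule.span_le.2 ?_
  rintro _ ⟨l, hl, rfl⟩
  exact h l hl

theorem F_wordSpan {w : W} {j : ℕ} {x : W} (hx : x ∈ ρ.wordSpan w j) :
    ρ.op 0 F x ∈ ρ.wordSpan w (j + 1) := by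
  have : ρ.wordSpan w j ≤ (ρ.wordSpan w (j + 1)).comap (ρ.op 0 F) :=
    wordSpan_le fun l hl => word_mem_wordSpan w (l := true :: l) (by simpa using hl)
  exact this hx

theorem E_wordSpan {w : W} {j : ℕ} {x : W} (hx : x ∈ ρ.wordSpan w j) :
    ρ.op (-1) E x ∈ ρ.wordSpan w (j + 1) := by
  have : ρ.wordSpan w j ≤ (ρ.wordSpan w (j + 1)).comap (ρ.op (-1) E) :=
    wordSpan_le fun l hl => word_mem_wordSpan w (l := false :: l) (by simpa using hl)
  exact this hx

theorem wordSpan_mono (w : W) {i j : ℕ} (h : i ≤ j) : ρ.wordSpan w j ≤ ρ.wordSpan w i :=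
  wordSpan_le fun _ hl => word_mem_wordSpan w (h.trans hl)

variable (ρ) in
/-- The operator `a(m)` preserves `N`. -/
def Maps (N : Submodule ℂ W) (m : ℤ) (a : sl2) : Prop := ∀ x ∈ N, ρ.op m a x ∈ N

theorem Maps.smul {N : Submodule ℂ W} {m : ℤ} {a : sl2} (c : ℂ) (h : ρ.Maps N m a) :
    ρ.Maps N m (c • a) := fun x hx => by
  rw [map_smul, LinearMap.smul_apply]
  exact N.smul_mem _ (h x hx)

theorem Maps.of_smul {N : Submodule ℂ W} {m : ℤ} {a : sl2} {c : ℂ} (hc : c ≠ 0)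
    (h : ρ.Maps N m (c • a)) : ρ.Maps N m a := by
  have := h.smul c⁻¹
  rwa [smul_smul, inv_mul_cancel₀ hc, one_smul] at this

theorem Maps.lie {N : Submodule ℂ W} {m n : ℤ} {a b : sl2} (h : ρ.Maps N m a)
    (h' : ρ.Maps N n b) : ρ.Maps N (m + n) ⁅a, b⁆ := fun x hx => by
  rw [eq_sub_of_add_eq (ρ.comm m n a b x).symm]
  exact sub_mem (sub_mem (h _ (h' x hx)) (h' _ (h x hx))) (N.smul_mem _ hx)

theorem maps_of_basis {N : Submodule ℂ W} {m : ℤ} (hE : ρ.Maps N m E) (hF : ρ.Maps N m F)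
    (hH : ρ.Maps N m H) (a : sl2) : ρ.Maps N m a := by
  obtain ⟨x, y, z, rfl⟩ := sl2_eq a
  intro w hw
  simp only [map_add, map_smul, LinearMap.add_apply, LinearMap.smul_apply]
  exact add_mem (add_mem (N.smul_mem _ (hE w hw)) (N.smul_mem _ (hF w hw)))
    (N.smul_mem _ (hH w hw))

/-- A subspace stable under the Chevalley generators is invariant. -/
theorem inv_of_chevalley {N : Submodule ℂ W} (hE : ρ.Maps N 0 E) (hF : ρ.Maps N 0 F)
    (hE' : ρ.Maps N (-1) E) (hF' : ρ.Maps N 1 F) : ρ.Inv N := by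
  have h2 : (2 : ℂ) ≠ 0 := two_ne_zero
  have h2' : (-2 : ℂ) ≠ 0 := by norm_num
  have hH1 : ρ.Maps N 1 H := by
    have := hE.lie hF'
    rwa [lie_E_F, zero_add] at this
  have hHm : ρ.Maps N (-1) H := by
    have := hE'.lie hF
    rwa [lie_E_F, add_zero] at this
  have stepE : ∀ {m n : ℤ}, ρ.Maps N m H → ρ.Maps N n E → ρ.Maps N (m + n) E := by
    intro m n h h'
    have := h.lie h'
    rw [lie_H_E] at this
    exact this.of_smul h2
  have stepF : ∀ {m n : ℤ}, ρ.Maps N m H → ρ.Maps N n F → ρ.Maps N (m + n) F := by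
    intro m n h h'
    have := h.lie h'
    rw [lie_H_F] at this
    exact this.of_smul h2'
  have allE : ∀ n : ℤ, ρ.Maps N n E := by
    intro n
    induction n with
    | zero => exact hE
    | succ n ih => rw [add_comm]; exact stepE hH1 ih
    | pred n ih => rw [sub_eq_add_neg, add_comm]; exact stepE hHm ih
  have allF : ∀ n : ℤ, ρ.Maps N n F := by
    intro n
    induction n with
    | zero => exact hF
    | succ n ih => rw [add_comm]; exact stepF hH1 ih
    | pred n ih => rw [sub_eq_add_neg, add_comm]; exact stepF hHm ih
  have allH : ∀ n : ℤ, ρ.Maps N n H := by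
    intro n
    have := (allE n).lie (allF 0)
    rwa [lie_E_F, add_zero] at this
  exact fun m a => maps_of_basis (allE m) (allF m) (allH m) a

/-- A vector killed by the generators `E(0)` and `F(1)` is a highest weight vector. -/
theorem HW.of_chevalley {μ : ℂ} {w : W} (hE : ρ.op 0 E w = 0) (hF : ρ.op 1 F w = 0)
    (hH : ρ.op 0 H w = μ • w) : ρ.HW μ w := by
  have hl : ∀ {m n : ℤ} {a b : sl2}, ρ.op m a w = 0 → ρ.op n b w = 0 → m + n ≠ 0 →
      ρ.op (m + n) ⁅a, b⁆ w = 0 := by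
    intro m n a b h h' hmn
    have := ρ.comm m n a b w
    rw [h, h', map_zero, map_zero, sub_zero, if_neg hmn, zero_smul, add_zero] at this
    exact this.symm
  have hH1 : ρ.op 1 H w = 0 := by
    have := hl hE hF (by norm_num)
    rwa [lie_E_F, zero_add] at this
  have allE : ∀ n : ℕ, ρ.op n E w = 0 := by
    intro n
    induction n with
    | zero => exact hE
    | succ n ih =>
      have := hl hH1 ih (by omega)
      rw [lie_H_E, map_smul, LinearMap.smul_apply] at this
      rw [Nat.cast_succ, add_comm]
      exact (smul_eq_zero.1 this).resolve_left two_ne_zero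
  have allF : ∀ n : ℕ, ρ.op ((n : ℤ) + 1) F w = 0 := by
    intro n
    induction n with
    | zero => simpa using hF
    | succ n ih =>
      have := hl hH1 ih (by omega)
      rw [lie_H_F, map_smul, LinearMap.smul_apply] at this
      rw [Nat.cast_succ, add_comm]
      exact (smul_eq_zero.1 this).resolve_left (by norm_num)
  refine ⟨hE, fun m a hm => ?_, hH⟩
  obtain ⟨n, rfl⟩ : ∃ n : ℕ, m = n + 1 := ⟨(m - 1).toNat, by omega⟩
  have hH' : ρ.op ((n : ℤ) + 1) H w = 0 := by
    have := hl hE (allF n) (by omega)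
    rwa [lie_E_F, zero_add] at this
  have hE' : ρ.op ((n : ℤ) + 1) E w = 0 := by simpa using allE (n + 1)
  obtain ⟨x, y, z, rfl⟩ := sl2_eq a
  simp [allF n, hH', hE']

theorem HW.H_word {μ : ℂ} {w : W} (h : ρ.HW μ w) (l : List Bool) :
    ∃ z : ℤ, ρ.op 0 H (ρ.word w l) = (μ + 2 * z) • ρ.word w l := by
  induction l with
  | nil => exact ⟨0, by simp [word, h.H_zero]⟩
  | cons b l ih =>
    obtain ⟨z, hz⟩ := ih
    cases b with
    | true =>
      refine ⟨z - 1, ?_⟩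
      rw [word, op_H_F, hz, map_smul, add_zero, ← sub_smul]
      push_cast
      congr 1
      ring
    | false =>
      refine ⟨z + 1, ?_⟩
      rw [word, op_H_E, hz, map_smul, zero_add, ← add_smul]
      push_cast
      congr 1
      ring

/-- Commuting `E(0)` or `F(1)` through a word yields shorter words multiplied by `H(0)` eigenvalues
and central scalars, so the span of the words is stable under all Chevalley generators. -/
theorem HW.wordSpan_eq_top {μ : ℂ} {w : W} (h : ρ.HW μ w) (hw : ρ.cyc w = ⊤) :
    ρ.wordSpan w 0 = ⊤ := by
  refine eq_top_iff.2 (hw ▸ ρ.cyc_le ?_ (word_mem_wordSpan w (l := []) (Nat.zero_le _)))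
  have hH : ρ.Maps (ρ.wordSpan w 0) 0 H := by
    have : ρ.wordSpan w 0 ≤ (ρ.wordSpan w 0).comap (ρ.op 0 H) := wordSpan_le fun l _ => by
      obtain ⟨z, hz⟩ := h.H_word l
      rw [Submodule.mem_comap, hz]
      exact Submodule.smul_mem _ _ (word_mem_wordSpan w (Nat.zero_le _))
    exact this
  have hF : ρ.Maps (ρ.wordSpan w 0) 0 F := fun x hx => wordSpan_mono w (Nat.zero_le _) (F_wordSpan hx)
  have hE' : ρ.Maps (ρ.wordSpan w 0) (-1) E :=
    fun x hx => wordSpan_mono w (Nat.zero_le _) (E_wordSpan hx)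
  have hE : ρ.Maps (ρ.wordSpan w 0) 0 E := by
    have : ρ.wordSpan w 0 ≤ (ρ.wordSpan w 0).comap (ρ.op 0 E) := wordSpan_le fun l hl => by
      clear hl
      rw [Submodule.mem_comap]
      induction l with
      | nil => rw [word, h.E_zero]; exact zero_mem _
      | cons b l ih =>
        cases b with
        | true =>
          rw [word, op_E_F]
          refine add_mem (hF _ ih) (add_mem ?_ (Submodule.smul_mem _ _ ?_))
          · rw [add_zero]
            exact hH _ (word_mem_wordSpan w (Nat.zero_le _))
          · exact word_mem_wordSpan w (Nat.zero_le _)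
        | false => rw [word, op_E_E]; exact hE' _ ih
    exact this
  have hF' : ρ.Maps (ρ.wordSpan w 0) 1 F := by
    have : ρ.wordSpan w 0 ≤ (ρ.wordSpan w 0).comap (ρ.op 1 F) := wordSpan_le fun l hl => by
      clear hl
      rw [Submodule.mem_comap]
      induction l with
      | nil => rw [word, h.pos 1 F one_pos]; exact zero_mem _
      | cons b l ih =>
        cases b with
        | true => rw [word, op_F_F]; exact hF _ ih
        | false =>
          rw [word, op_F_E]
          refine add_mem (hE' _ ih) (add_mem (neg_mem ?_) (Submodule.smul_mem _ _ ?_))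
          · rw [add_neg_cancel]
            exact hH _ (word_mem_wordSpan w (Nat.zero_le _))
          · exact word_mem_wordSpan w (Nat.zero_le _)
    exact this
  exact inv_of_chevalley hE hF hE' hF'

/-- Induction on words for the vectors of a highest weight representation. -/
theorem HW.mem_of_words {μ : ℂ} {w : W} (h : ρ.HW μ w) (hw : ρ.cyc w = ⊤) {N : Submodule ℂ W}
    (h0 : w ∈ N) (hF : ρ.Maps N 0 F) (hE : ρ.Maps N (-1) E) (x : W) : x ∈ N := by
  have : ρ.wordSpan w 0 ≤ N := wordSpan_le fun l hl => by
    clear hl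
    induction l with
    | nil => exact h0
    | cons b l ih =>
      cases b with
      | true => exact hF _ ih
      | false => exact hE _ ih
  exact this (h.wordSpan_eq_top hw ▸ Submodule.mem_top)

/-- The operators `a(m)` with `m < 0` raise the principal gradation. -/
theorem neg_mem_wordSpan_one {μ : ℂ} {w : W} (h : ρ.HW μ w) (hw : ρ.cyc w = ⊤) {m : ℤ}
    (hm : m < 0) (a : sl2) (x : W) : ρ.op m a x ∈ ρ.wordSpan w 1 := by
  have top : ∀ x, x ∈ ρ.wordSpan w 0 := fun x => h.wordSpan_eq_top hw ▸ Submodule.mem_top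
  have lie : ∀ {m n : ℤ} {a b : sl2}, (∀ x, ρ.op m a x ∈ ρ.wordSpan w 1) →
      (∀ x, ρ.op n b x ∈ ρ.wordSpan w 1) → m + n ≠ 0 →
      ∀ x, ρ.op (m + n) ⁅a, b⁆ x ∈ ρ.wordSpan w 1 := by
    intro m n a b h h' hmn x
    have := ρ.comm m n a b x
    rw [if_neg hmn, zero_smul, add_zero] at this
    rw [← this]
    exact sub_mem (h _) (h' _)
  have hF : ∀ x, ρ.op 0 F x ∈ ρ.wordSpan w 1 := fun x => F_wordSpan (top x)
  have hE : ∀ x, ρ.op (-1) E x ∈ ρ.wordSpan w 1 := fun x => E_wordSpan (top x)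
  have hHm : ∀ x, ρ.op (-1) H x ∈ ρ.wordSpan w 1 := by
    have := lie hE hF (by norm_num)
    rwa [lie_E_F, add_zero] at this
  have div : ∀ {c : ℂ} {m : ℤ} {a : sl2}, c ≠ 0 → (∀ x, ρ.op m (c • a) x ∈ ρ.wordSpan w 1) →
      ∀ x, ρ.op m a x ∈ ρ.wordSpan w 1 := by
    intro c m a hc h x
    have := Submodule.smul_mem _ c⁻¹ (h x)
    rwa [map_smul, LinearMap.smul_apply, smul_smul, inv_mul_cancel₀ hc, one_smul] at this
  have allE : ∀ n : ℕ, ∀ x, ρ.op (-1 - n) E x ∈ ρ.wordSpan w 1 := by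
    intro n
    induction n with
    | zero => simpa using hE
    | succ n ih =>
      have := lie hHm ih (by omega)
      rw [lie_H_E, show -1 + (-1 - (n : ℤ)) = -1 - (n + 1 : ℕ) by push_cast; ring] at this
      exact div two_ne_zero this
  have allF : ∀ n : ℕ, ∀ x, ρ.op (-n) F x ∈ ρ.wordSpan w 1 := by
    intro n
    induction n with
    | zero => simpa using hF
    | succ n ih =>
      have := lie hHm ih (by omega)
      rw [lie_H_F, show -1 + (-(n : ℤ)) = -(n + 1 : ℕ) by push_cast; ring] at this
      exact div (by norm_num) this
  obtain ⟨n, rfl⟩ : ∃ n : ℕ, m = -1 - n := ⟨(-1 - m).toNat, by omega⟩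
  have hH : ∀ x, ρ.op (-1 - n) H x ∈ ρ.wordSpan w 1 := by
    have := lie (allE n) hF (by omega)
    rwa [lie_E_F, add_zero] at this
  have hF' : ∀ x, ρ.op (-1 - n) F x ∈ ρ.wordSpan w 1 := by
    have := allF (n + 1)
    rwa [show (-((n + 1 : ℕ) : ℤ)) = -1 - n by push_cast; ring] at this
  obtain ⟨x', y, z, rfl⟩ := sl2_eq a
  simp only [map_add, map_smul, LinearMap.add_apply, LinearMap.smul_apply]
  exact add_mem (add_mem (Submodule.smul_mem _ _ (allE n x)) (Submodule.smul_mem _ _ (hF' x)))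
    (Submodule.smul_mem _ _ (hH x))

/-- The eigenvalues of the principal gradation on words of length at least `j`. -/
def priRoots (κ μ : ℂ) (j : ℕ) : Set ℂ := {s | ∃ l : ℕ, j ≤ l ∧ s = priVal κ μ + 2 * l}

theorem HW.pri_word {μ : ℂ} {w : W} (h : ρ.HW μ w) (hρ : ρ.Restricted) (hκ : κ + 2 ≠ 0)
    (l : List Bool) :
    pri hρ (ρ.word w l) = (priVal κ μ + 2 * (l.length : ℂ)) • ρ.word w l := by
  induction l with
  | nil => simp [word, h.pri_eq hρ]
  | cons b l ih =>
    cases b with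
    | true =>
      rw [word, pri_F_zero hρ, ih, map_smul, ← add_smul, List.length_cons]
      push_cast
      congr 1
      ring
    | false =>
      rw [word, pri_E_neg_one hρ hκ, ih, map_smul, ← add_smul, List.length_cons]
      push_cast
      congr 1
      ring

theorem HW.wordSpan_le_rootsIn {μ : ℂ} {w : W} (h : ρ.HW μ w) (hρ : ρ.Restricted)
    (hκ : κ + 2 ≠ 0) (j : ℕ) : ρ.wordSpan w j ≤ rootsIn (pri hρ) (priRoots κ μ j) :=
  wordSpan_le fun l hl => mem_rootsIn (h.pri_word hρ hκ l) ⟨l.length, hl, rfl⟩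

theorem priVal_notMem_priRoots (κ μ : ℂ) : priVal κ μ ∉ priRoots κ μ 1 := by
  rintro ⟨l, hl, h⟩
  have h' : (l : ℂ) = 0 := by linear_combination (-1 / 2 : ℂ) * h
  rw [Nat.cast_eq_zero] at h'
  omega

/-- The principal eigenvalue of `w` differs from those of all words of positive length. -/
theorem HW.notMem_wordSpan_one {μ : ℂ} {w : W} (h : ρ.HW μ w) (hρ : ρ.Restricted)
    (hκ : κ + 2 ≠ 0) (hw : w ≠ 0) : w ∉ ρ.wordSpan w 1 := fun hw' =>
  priVal_notMem_priRoots κ μ (eigenvalue_mem_of_mem_rootsIn (h.pri_eq hρ) hw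
    (h.wordSpan_le_rootsIn hρ hκ 1 hw'))

theorem pri_mem (hρ : ρ.Restricted) {N : Submodule ℂ W} (hN : ρ.Inv N) {x : W} (hx : x ∈ N) :
    pri hρ x ∈ N := by
  obtain ⟨K, hK⟩ := hρ.casTerm_eq_zero x
  rw [pri_apply, cas_apply hρ hK]
  refine sub_mem (N.smul_mem _ ?_) (hN _ _ _ hx)
  refine add_mem (add_mem (add_mem (N.smul_mem _ (hN _ _ _ (hN _ _ _ hx))) (hN _ _ _ hx))
    (N.smul_mem _ (hN _ _ _ (hN _ _ _ hx)))) (Submodule.sum_mem _ fun i _ => ?_)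
  rw [casTerm_apply]
  exact add_mem (add_mem (hN _ _ _ (hN _ _ _ hx)) (N.smul_mem _ (hN _ _ _ (hN _ _ _ hx))))
    (N.smul_mem _ (hN _ _ _ (hN _ _ _ hx)))

theorem HW.exists_decomp {μ : ℂ} {w : W} (h : ρ.HW μ w) (hw : ρ.cyc w = ⊤) (x : W) :
    ∃ c : ℂ, x - c • w ∈ ρ.wordSpan w 1 := by
  have : ρ.wordSpan w 0 ≤ Submodule.span ℂ {w} ⊔ ρ.wordSpan w 1 := wordSpan_le fun l _ => by
    cases l with
    | nil => exact Submodule.mem_sup_left (Submodule.mem_span_singleton_self w)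
    | cons b l => exact Submodule.mem_sup_right (word_mem_wordSpan w (by simp))
  obtain ⟨y, hy, z, hz, hyz⟩ := Submodule.mem_sup.1
    (this (h.wordSpan_eq_top hw ▸ Submodule.mem_top : x ∈ ρ.wordSpan w 0))
  obtain ⟨c, rfl⟩ := Submodule.mem_span_singleton.1 hy
  exact ⟨c, by rwa [← hyz, add_sub_cancel_left]⟩

/-- Proper invariant subspaces of a highest weight representation do not meet the highest weight
space. -/
theorem HW.le_wordSpan_one {μ : ℂ} {w : W} (h : ρ.HW μ w) (hw : ρ.cyc w = ⊤)
    (hκ : κ + 2 ≠ 0) {N : Submodule ℂ W} (hN : ρ.Inv N) (hN' : N ≠ ⊤) : N ≤ ρ.wordSpan w 1 := by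
  have hρ := h.restricted hw
  intro x hx
  obtain ⟨c, hc⟩ := h.exists_decomp hw x
  -- The polynomial `p` in `pri` kills the part of positive degree and sends `x` to a multiple of
  -- `w`, with factor `p.eval (priVal κ μ) ≠ 0` on the component along `w`. Hence `N` contains `w`
  -- unless that component is zero.
  obtain ⟨p, hp, hp'⟩ := h.wordSpan_le_rootsIn hρ hκ 1 hc
  rw [map_sub, map_smul, sub_eq_zero, aeval_eigenvector (h.pri_eq hρ), smul_smul] at hp
  have h1 : (c * p.eval (priVal κ μ)) • w ∈ N := hp ▸ aeval_mem (fun y hy => pri_mem hρ hN hy) p hx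
  by_cases hc0 : c * p.eval (priVal κ μ) = 0
  · rcases mul_eq_zero.1 hc0 with h0 | h0
    · rwa [h0, zero_smul, sub_zero] at hc
    · exact absurd (hp' _ h0) (priVal_notMem_priRoots κ μ)
  · refine absurd (eq_top_iff.2 (hw ▸ ρ.cyc_le hN ?_)) hN'
    have := N.smul_mem (c * p.eval (priVal κ μ))⁻¹ h1
    rwa [smul_smul, inv_mul_cancel₀ hc0, one_smul] at this

variable (ρ) in
/-- Irreducibility; the zero representation is allowed. -/
def Irr : Prop := ∀ N, ρ.Inv N → N = ⊥ ∨ N = ⊤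

theorem Irr.cyc_eq_top (hi : ρ.Irr) {w : W} (hw : w ≠ 0) : ρ.cyc w = ⊤ :=
  (hi _ (ρ.inv_cyc w)).resolve_left fun h => hw ((Submodule.mem_bot ℂ).1 (h ▸ ρ.mem_cyc w))

/-- The eigenvectors of the principal gradation for the highest eigenvalue. -/
theorem HW.mem_span_of_pri {μ : ℂ} {w : W} (h : ρ.HW μ w) (hw : ρ.cyc w = ⊤) (hκ : κ + 2 ≠ 0)
    {x : W} (hx : pri (h.restricted hw) x = priVal κ μ • x) : ∃ c : ℂ, x = c • w := by
  have hρ := h.restricted hw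
  obtain ⟨c, hc⟩ := h.exists_decomp hw x
  refine ⟨c, sub_eq_zero.1 ?_⟩
  by_contra hne
  refine priVal_notMem_priRoots κ μ (eigenvalue_mem_of_mem_rootsIn (x := x - c • w) ?_ hne
    (h.wordSpan_le_rootsIn hρ hκ 1 hc))
  rw [map_sub, map_smul, hx, h.pri_eq, smul_sub, smul_comm]

/-- Uniqueness of highest weight vectors in an irreducible representation. -/
theorem HW.unique {μ μ' : ℂ} {w v : W} (h : ρ.HW μ w) (h' : ρ.HW μ' v) (hi : ρ.Irr)
    (hκ : κ + 2 ≠ 0) (hw : w ≠ 0) (hv : v ≠ 0) : ∃ c : ℂ, v = c • w := by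
  have hcw := hi.cyc_eq_top hw
  have hcv := hi.cyc_eq_top hv
  have hρ := h.restricted hcw
  -- Each vector generates the representation, so each principal eigenvalue exceeds the other by a
  -- nonnegative even integer; they coincide.
  obtain ⟨l, -, hl⟩ := eigenvalue_mem_of_mem_rootsIn (h'.pri_eq hρ) hv
    (h.wordSpan_le_rootsIn hρ hκ 0 (h.wordSpan_eq_top hcw ▸ Submodule.mem_top))
  obtain ⟨l', -, hl'⟩ := eigenvalue_mem_of_mem_rootsIn (h.pri_eq hρ) hw
    (h'.wordSpan_le_rootsIn hρ hκ 0 (h'.wordSpan_eq_top hcv ▸ Submodule.mem_top))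
  have h0 : ((l + l' : ℕ) : ℂ) = 0 := by
    push_cast
    linear_combination (-1 / 2 : ℂ) * hl + (-1 / 2 : ℂ) * hl'
  rw [Nat.cast_eq_zero] at h0
  obtain rfl : l = 0 := by omega
  refine h.mem_span_of_pri hcw hκ ?_
  rw [h'.pri_eq, hl]
  simp

theorem HW.weight_unique {μ μ' : ℂ} {w v : W} (h : ρ.HW μ w) (h' : ρ.HW μ' v) (hi : ρ.Irr)
    (hκ : κ + 2 ≠ 0) (hw : w ≠ 0) (hv : v ≠ 0) : μ' = μ := by
  obtain ⟨c, rfl⟩ := h.unique h' hi hκ hw hv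
  have := h'.H_zero
  rw [map_smul, h.H_zero, smul_smul, smul_smul, ← sub_eq_zero, ← sub_smul] at this
  have hc : c ≠ 0 := fun hc => hv (by rw [hc, zero_smul])
  have := (smul_eq_zero.1 this).resolve_right hw
  have h2 : c * (μ' - μ) = 0 := by linear_combination -this
  exact sub_eq_zero.1 ((mul_eq_zero.1 h2).resolve_left hc)

end AffRep

end AffineSl2

end

/-! ### Integrability, and irreducibility of integrable vacuum representations. -/

noncomputable section

namespace AffineSl2

namespace AffRep

section dominant

variable {k : ℕ} {W : Type*} [AddCommGroup W] [Module ℂ W] {ρ : AffRep (k : ℂ) W} {w : W}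

/-- Bracketing with `F(0)` takes `E(-1)` to `H(-1)`, then to `F(-1)`, then to `0`, up to scalars.
Applying `map_nilp` backwards along this chain makes the nilpotent vectors stable under the lowering
generators. -/
theorem HW.mem_nilp_F {μ : ℂ} (h : ρ.HW μ w) (hw : ρ.cyc w = ⊤) (hF : w ∈ nilp (ρ.op 0 F))
    (x : W) : x ∈ nilp (ρ.op 0 F) := by
  have h0 : ∀ x ∈ nilp (ρ.op 0 F), (0 : Module.End ℂ W) x ∈ nilp (ρ.op 0 F) :=
    fun x _ => zero_mem _
  have h1 := map_nilp (A := ρ.op (-1) F) h0 fun x => by simp [op_F_F ρ 0 (-1)]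
  have h2 := map_nilp (A := ρ.op (-1) H) (B := (2 : ℂ) • ρ.op (-1) F)
    (fun x hx => Submodule.smul_mem _ _ (h1 x hx)) fun x => by simp [op_F_H ρ 0 (-1)]
  have h3 := map_nilp (A := ρ.op (-1) E) (B := -ρ.op (-1) H)
    (fun x hx => neg_mem (h2 x hx)) fun x => by simp [op_F_E ρ 0 (-1)]
  exact h.mem_of_words hw hF (map_nilp h0 fun x => by simp) h3 x

theorem HW.mem_nilp_E {μ : ℂ} (h : ρ.HW μ w) (hw : ρ.cyc w = ⊤) (hE : w ∈ nilp (ρ.op (-1) E))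
    (x : W) : x ∈ nilp (ρ.op (-1) E) := by
  have h0 : ∀ x ∈ nilp (ρ.op (-1) E), (0 : Module.End ℂ W) x ∈ nilp (ρ.op (-1) E) :=
    fun x _ => zero_mem _
  have h1 := map_nilp (A := ρ.op (-2) E) h0 fun x => by simp [op_E_E ρ (-1) (-2)]
  have h2 := map_nilp (A := ρ.op (-1) H) (B := (-2 : ℂ) • ρ.op (-2) E)
    (fun x hx => Submodule.smul_mem _ _ (h1 x hx)) fun x => by
      rw [op_E_H]; norm_num [sub_eq_add_neg]
  have h3 := map_nilp (A := ρ.op 0 F) (B := ρ.op (-1) H) h2 fun x => by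
    simp [op_E_F ρ (-1) 0]
  exact h.mem_of_words hw hE h3 (map_nilp h0 fun x => by simp) x

/-- The weight of a highest weight vector on which `F(0)` and `E(-1)` are nilpotent. -/
theorem HW.dominant {μ : ℂ} (h : ρ.HW μ w) (hw : w ≠ 0) (hF : w ∈ nilp (ρ.op 0 F))
    (hE : w ∈ nilp (ρ.op (-1) E)) : ∃ i j : ℕ, μ = i ∧ i + j = k := by
  obtain ⟨M, hM⟩ := hF
  obtain ⟨M', hM'⟩ := hE
  obtain ⟨i, hi⟩ := sl2_weight (e := ρ.op 0 E) (f := ρ.op 0 F) (h := ρ.op 0 H)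
    (fun x => by simp [op_E_F]) (fun x => by simp [op_H_F]) h.E_zero h.H_zero hw hM
  -- The triple of the affine simple root, for which the weight of `w` is `k - μ`.
  obtain ⟨j, hj⟩ := sl2_weight (e := ρ.op 1 F) (f := ρ.op (-1) E)
    (h := (k : ℂ) • (1 : Module.End ℂ W) - ρ.op 0 H) (c := k - μ)
    (fun x => by simp [op_F_E]; abel) (fun x => by simp [op_H_E]; abel) (h.pos 1 F one_pos)
    (by simp [h.H_zero, sub_smul]) hw hM'
  refine ⟨i, j, hi, ?_⟩
  have : ((i + j : ℕ) : ℂ) = k := by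
    push_cast
    linear_combination -hi - hj
  exact_mod_cast this

theorem HW.mem_rootsIn_H {μ : ℂ} (h : ρ.HW μ w) (hw : ρ.cyc w = ⊤) (x : W) :
    x ∈ rootsIn (ρ.op 0 H) {c | ∃ z : ℤ, c = μ + 2 * z} := by
  have : ρ.wordSpan w 0 ≤ rootsIn (ρ.op 0 H) {c | ∃ z : ℤ, c = μ + 2 * z} :=
    wordSpan_le fun l _ => by
      obtain ⟨z, hz⟩ := h.H_word l
      exact mem_rootsIn hz ⟨z, rfl⟩
  exact this (h.wordSpan_eq_top hw ▸ Submodule.mem_top)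

theorem priRoots_ne_univ (κ μ : ℂ) : priRoots κ μ 0 ≠ Set.univ := fun h => by
  obtain ⟨l, -, hl⟩ := (h ▸ Set.mem_univ (priVal κ μ - 2) : priVal κ μ - 2 ∈ priRoots κ μ 0)
  have : ((l + 1 : ℕ) : ℂ) = 0 := by
    push_cast
    linear_combination (-1 / 2 : ℂ) * hl
  rw [Nat.cast_eq_zero] at this
  omega

/-- Cyclic highest weight representations with dominant weight `0` on which `F(0)` and `E(-1)` are
locally nilpotent are irreducible. -/
theorem HW.irr (h : ρ.HW 0 w) (hw : ρ.cyc w = ⊤) (hF : w ∈ nilp (ρ.op 0 F))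
    (hE : w ∈ nilp (ρ.op (-1) E)) : ρ.Irr := by
  classical
  intro N hN
  refine or_iff_not_imp_left.2 fun hN0 => ?_
  have hρ := h.restricted hw
  have hκ : (k : ℂ) + 2 ≠ 0 := by exact_mod_cast Nat.succ_ne_zero (k + 1)
  have hroots : ∀ x, x ∈ rootsIn (pri hρ) (priRoots k 0 0) := fun x =>
    h.wordSpan_le_rootsIn hρ hκ 0 (h.wordSpan_eq_top hw ▸ Submodule.mem_top)
  have hp0 : priVal (k : ℂ) 0 = 0 := by simp [priVal]
  -- Principal degrees in `N` are nonnegative even integers. A vector of the least one is killed by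
  -- `E(0)` and `F(1)`, which would lower its degree.
  have hex : ∃ l : ℕ, ∃ x ∈ N, x ≠ 0 ∧ pri hρ x = (2 * (l : ℂ)) • x := by
    obtain ⟨x, hx, hx0⟩ := Submodule.exists_mem_ne_zero_of_ne_bot hN0
    obtain ⟨c, q, hq, hc⟩ := exists_eigenvector (priRoots_ne_univ k 0) hx0 (hroots x)
    obtain ⟨l, -, rfl⟩ := eigenvalue_mem_of_mem_rootsIn hc hq (hroots _)
    rw [hp0, zero_add] at hc
    exact ⟨l, _, aeval_mem (fun y hy => pri_mem hρ hN hy) q hx, hq, hc⟩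
  obtain ⟨x, hx, hx0, hpx⟩ := Nat.find_spec hex
  have hmin : ∀ y ∈ N, pri hρ y = (2 * (Nat.find hex : ℂ) - 2) • y → y = 0 := by
    intro y hy hpy
    by_contra hy0
    obtain ⟨l, -, hl⟩ := eigenvalue_mem_of_mem_rootsIn hpy hy0 (hroots _)
    rw [hp0, zero_add] at hl
    have hl' : ((l + 1 : ℕ) : ℂ) = Nat.find hex := by
      push_cast
      linear_combination (-1 / 2 : ℂ) * hl
    have hl'' : l + 1 = Nat.find hex := by exact_mod_cast hl'
    exact Nat.find_min hex (m := l) (by omega) ⟨y, hy, hy0, by rw [hpy, hl]⟩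
  -- The weights lie in `2ℤ`, which omits `1`. A polynomial in `H(0)` then produces a weight vector
  -- without leaving `N` or the degree, since `H(0)` commutes with `pri`.
  obtain ⟨μ, q, hq, hμ⟩ := exists_eigenvector (T := ρ.op 0 H) (fun hu => by
    obtain ⟨z, hz⟩ := (hu ▸ Set.mem_univ (1 : ℂ) : (1 : ℂ) ∈ {c : ℂ | ∃ z : ℤ, c = 0 + 2 * z})
    rw [zero_add] at hz
    have : (1 : ℤ) = 2 * z := by exact_mod_cast hz
    omega) hx0 (h.mem_rootsIn_H hw x)
  obtain ⟨hsN, hsp⟩ : Polynomial.aeval (ρ.op 0 H) q x ∈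
      N ⊓ Module.End.eigenspace (pri hρ) (2 * (Nat.find hex : ℂ)) := by
    refine aeval_mem ?_ q ⟨hx, Module.End.mem_eigenspace_iff.2 hpx⟩
    rintro y ⟨hy, hy'⟩
    refine ⟨hN _ _ _ hy, Module.End.mem_eigenspace_iff.2 ?_⟩
    rw [← op_H_pri, Module.End.mem_eigenspace_iff.1 hy', map_smul]
  generalize Polynomial.aeval (ρ.op 0 H) q x = s at hq hμ hsN hsp
  replace hsp := Module.End.mem_eigenspace_iff.1 hsp
  have hs : ρ.HW μ s := by
    refine HW.of_chevalley (hmin _ (hN _ _ _ hsN) ?_) (hmin _ (hN _ _ _ hsN) ?_) hμ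
    · rw [pri_E_zero, hsp, map_smul, sub_smul]
    · rw [pri_F_one hρ hκ, hsp, map_smul, sub_smul]
  obtain ⟨i, j, rfl, hij⟩ := hs.dominant hq (h.mem_nilp_F hw hF s) (h.mem_nilp_E hw hE s)
  have hv : priVal (k : ℂ) i = 2 * (Nat.find hex : ℂ) := by
    have := hs.pri_eq hρ
    rw [hsp, ← sub_eq_zero, ← sub_smul] at this
    exact (sub_eq_zero.1 ((smul_eq_zero.1 this).resolve_right hq)).symm
  -- The Sugawara formula gives degree `-ij/(k + 2)`, where `i + j = k`; by choice it is `2 *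
  -- Nat.find hex`. Two nonnegative integers with sum zero both vanish.
  have hnat : ((i * j + 2 * Nat.find hex * (k + 2) : ℕ) : ℂ) = 0 := by
    have hk : (k : ℂ) = i + j := by rw [← hij]; push_cast; ring
    push_cast
    rw [mul_assoc, ← mul_assoc, ← hv, priVal]
    field_simp
    rw [hk]
    ring
  rw [Nat.cast_eq_zero] at hnat
  have hl0 : Nat.find hex = 0 := by
    have := (Nat.add_eq_zero_iff.1 hnat).2
    rcases Nat.mul_eq_zero.1 this with h | h <;> omega
  obtain ⟨c, rfl⟩ := h.mem_span_of_pri hw hκ (x := s) (by rw [hsp, hl0, hp0]; simp)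
  refine eq_top_iff.2 (hw ▸ ρ.cyc_le hN ?_)
  have hc : c ≠ 0 := fun hc => hq (by rw [hc, zero_smul])
  have := N.smul_mem c⁻¹ hsN
  rwa [smul_smul, inv_mul_cancel₀ hc, one_smul] at this

end dominant

/-! ### Uniqueness of irreducible highest weight representations -/

section prod

variable {κ : ℂ} {W₁ W₂ : Type*} [AddCommGroup W₁] [Module ℂ W₁] [AddCommGroup W₂] [Module ℂ W₂]

/-- The direct sum of two representations. -/
def prod (ρ₁ : AffRep κ W₁) (ρ₂ : AffRep κ W₂) : AffRep κ (W₁ × W₂) where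
  op m :=
    { toFun a := (ρ₁.op m a).prodMap (ρ₂.op m a)
      map_add' a b := by ext <;> simp
      map_smul' c a := by ext <;> simp }
  comm m n a b w := Prod.ext (ρ₁.comm m n a b w.1) (ρ₂.comm m n a b w.2)

variable {ρ₁ : AffRep κ W₁} {ρ₂ : AffRep κ W₂}

@[simp] theorem prod_op (m : ℤ) (a : sl2) (x : W₁ × W₂) :
    (ρ₁.prod ρ₂).op m a x = (ρ₁.op m a x.1, ρ₂.op m a x.2) := rfl

theorem Restricted.prod (h₁ : ρ₁.Restricted) (h₂ : ρ₂.Restricted) : (ρ₁.prod ρ₂).Restricted := by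
  intro a w
  obtain ⟨N₁, hN₁⟩ := h₁ a w.1
  obtain ⟨N₂, hN₂⟩ := h₂ a w.2
  exact ⟨max N₁ N₂, fun m hm => by
    rw [prod_op, hN₁ m (le_of_max_le_left hm), hN₂ m (le_of_max_le_right hm), Prod.mk_zero_zero]⟩

/-- A linear map that commutes with the actions. -/
def Equivariant (ρ₁ : AffRep κ W₁) (ρ₂ : AffRep κ W₂) (f : W₁ →ₗ[ℂ] W₂) : Prop :=
  ∀ m a x, f (ρ₁.op m a x) = ρ₂.op m a (f x)

theorem Equivariant.bijective {f : W₁ →ₗ[ℂ] W₂} (hf : Equivariant ρ₁ ρ₂ f) {w : W₁}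
    (hw : ρ₂.cyc (f w) = ⊤) (hker : LinearMap.ker f = ⊥) : Function.Bijective f := by
  refine ⟨LinearMap.ker_eq_bot.1 hker, LinearMap.range_eq_top.1 (eq_top_iff.2 ?_)⟩
  rw [← hw]
  refine ρ₂.cyc_le ?_ ⟨w, rfl⟩
  rintro m a _ ⟨x, rfl⟩
  exact ⟨_, hf m a x⟩

/-- The subrepresentation `G` generated by `(w₁, w₂)` in the direct sum is the graph of the
isomorphism. The kernels of its projections are proper, hence contained in `wordSpan w 1`. If one
kernel mapped onto the other factor, the generator would be a sum of elements of the two kernels,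
which is impossible; by irreducibility both kernels vanish. -/
theorem HW.exists_equiv {μ : ℂ} {w₁ : W₁} {w₂ : W₂} (h₁ : ρ₁.HW μ w₁) (h₂ : ρ₂.HW μ w₂)
    (hi₁ : ρ₁.Irr) (hi₂ : ρ₂.Irr) (hκ : κ + 2 ≠ 0) (hw₁ : w₁ ≠ 0) (hw₂ : w₂ ≠ 0) :
    ∃ f : W₁ ≃ₗ[ℂ] W₂, f w₁ = w₂ ∧ Equivariant ρ₁ ρ₂ (f : W₁ →ₗ[ℂ] W₂) := by
  let ρ := ρ₁.prod ρ₂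
  let G := ρ.cyc (w₁, w₂)
  have hG : ρ.Inv G := ρ.inv_cyc _
  let σ := ρ.sub G hG
  let w : G := ⟨(w₁, w₂), ρ.mem_cyc _⟩
  have hcw : σ.cyc w = ⊤ := ρ.cyc_sub_cyc _
  have hw : σ.HW μ w := ⟨Subtype.ext (Prod.ext h₁.E_zero h₂.E_zero),
    fun m a hm => Subtype.ext (Prod.ext (h₁.pos m a hm) (h₂.pos m a hm)),
    Subtype.ext (Prod.ext h₁.H_zero h₂.H_zero)⟩
  let p₁ : G →ₗ[ℂ] W₁ := LinearMap.fst ℂ W₁ W₂ ∘ₗ G.subtype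
  let p₂ : G →ₗ[ℂ] W₂ := LinearMap.snd ℂ W₁ W₂ ∘ₗ G.subtype
  have hp₁ : Equivariant σ ρ₁ p₁ := fun m a x => rfl
  have hp₂ : Equivariant σ ρ₂ p₂ := fun m a x => rfl
  have hk₁ : LinearMap.ker p₁ ≤ σ.wordSpan w 1 := hw.le_wordSpan_one hcw hκ
    (fun m a x hx => by rw [LinearMap.mem_ker] at hx ⊢; rw [hp₁, hx, map_zero])
    fun h => hw₁ (LinearMap.mem_ker.1 (h ▸ Submodule.mem_top : w ∈ LinearMap.ker p₁))
  have hk₂ : LinearMap.ker p₂ ≤ σ.wordSpan w 1 := hw.le_wordSpan_one hcw hκ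
    (fun m a x hx => by rw [LinearMap.mem_ker] at hx ⊢; rw [hp₂, hx, map_zero])
    fun h => hw₂ (LinearMap.mem_ker.1 (h ▸ Submodule.mem_top : w ∈ LinearMap.ker p₂))
  have hnot : ∀ g₁ ∈ LinearMap.ker p₂, ∀ g₂ ∈ LinearMap.ker p₁, g₁ + g₂ ≠ w := by
    intro g₁ hg₁ g₂ hg₂ h
    have hmem := add_mem (hk₂ hg₁) (hk₁ hg₂)
    rw [h] at hmem
    refine hw.notMem_wordSpan_one (hw.restricted hcw) hκ (fun h0 => hw₁ ?_) hmem
    exact congrArg (fun g : G => g.1.1) h0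
  have hb₁ : LinearMap.ker p₁ = ⊥ := by
    have hinv : ρ₂.Inv ((LinearMap.ker p₁).map p₂) := by
      rintro m a _ ⟨x, hx, rfl⟩
      refine ⟨σ.op m a x, ?_, hp₂ m a x⟩
      rw [SetLike.mem_coe, LinearMap.mem_ker] at hx ⊢
      rw [hp₁, hx, map_zero]
    rcases hi₂ _ hinv with h | h
    · refine (Submodule.eq_bot_iff _).2 fun x hx => Subtype.ext (Prod.ext hx ?_)
      exact (Submodule.mem_bot ℂ).1 (h ▸ Submodule.mem_map_of_mem hx : p₂ x ∈ (⊥ : Submodule ℂ W₂))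
    · obtain ⟨x, hx, hx'⟩ := (h ▸ Submodule.mem_top : w₂ ∈ (LinearMap.ker p₁).map p₂)
      refine absurd (sub_add_cancel w x) (hnot _ ?_ x hx)
      rw [LinearMap.mem_ker, map_sub, hx', sub_eq_zero]
      rfl
  have hb₂ : LinearMap.ker p₂ = ⊥ := by
    have hinv : ρ₁.Inv ((LinearMap.ker p₂).map p₁) := by
      rintro m a _ ⟨x, hx, rfl⟩
      refine ⟨σ.op m a x, ?_, hp₁ m a x⟩
      rw [SetLike.mem_coe, LinearMap.mem_ker] at hx ⊢
      rw [hp₂, hx, map_zero]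
    rcases hi₁ _ hinv with h | h
    · refine (Submodule.eq_bot_iff _).2 fun x hx => Subtype.ext (Prod.ext ?_ hx)
      exact (Submodule.mem_bot ℂ).1 (h ▸ Submodule.mem_map_of_mem hx : p₁ x ∈ (⊥ : Submodule ℂ W₁))
    · obtain ⟨x, hx, hx'⟩ := (h ▸ Submodule.mem_top : w₁ ∈ (LinearMap.ker p₂).map p₁)
      refine absurd (add_sub_cancel x w) (hnot x hx _ ?_)
      rw [LinearMap.mem_ker, map_sub, hx', sub_eq_zero]
      rfl
  let e₁ := LinearEquiv.ofBijective p₁ (hp₁.bijective (w := w) (hi₁.cyc_eq_top hw₁) hb₁)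
  let e₂ := LinearEquiv.ofBijective p₂ (hp₂.bijective (w := w) (hi₂.cyc_eq_top hw₂) hb₂)
  refine ⟨e₁.symm.trans e₂, ?_, fun m a x => ?_⟩
  · rw [LinearEquiv.trans_apply, (LinearEquiv.symm_apply_eq e₁).2 (show w₁ = e₁ w from rfl)]
    rfl
  · obtain ⟨g, rfl⟩ := e₁.surjective x
    rw [LinearEquiv.coe_coe, LinearEquiv.trans_apply, LinearEquiv.trans_apply,
      LinearEquiv.symm_apply_apply, (LinearEquiv.symm_apply_eq e₁).2 (show ρ₁.op m a (e₁ g) =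
        e₁ (σ.op m a g) from (hp₁ m a g).symm)]
    exact hp₂ m a g

end prod

end AffRep

end AffineSl2

end

noncomputable section

namespace AffineSl2

/-! ### Representations of the affine Lie algebra as modules over the enveloping algebra -/

theorem loop_add (a b : sl2) (m : ℤ) : loop (a + b) m = loop a m + loop b m := by
  rw [loop, loop, loop, ← LieAlgebra.of_add, TensorProduct.tmul_add]
  simp only [Prod.mk_add_mk, add_zero]

theorem loop_smul (c : ℂ) (a : sl2) (m : ℤ) : loop (c • a) m = c • loop a m := by
  rw [loop, loop, ← LieAlgebra.of_smul, TensorProduct.tmul_smul]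
  simp only [Prod.smul_mk, smul_zero]

theorem affine_induction {p : Affine → Prop} (hl : ∀ a m, p (loop a m)) (hc : p central)
    (ha : ∀ x y, p x → p y → p (x + y)) (hs : ∀ (c : ℂ) x, p x → p (c • x)) (x : Affine) : p x := by
  have h0 : p 0 := by simpa using hs 0 _ hc
  have key : ∀ y : LieAlgebra.loopAlgebra ℂ ℤ sl2, p (LieAlgebra.ofProd cocycle (y, 0)) := by
    intro y
    induction y using TensorProduct.induction_on with
    | zero => exact h0
    | add y z hy hz => simpa only [← LieAlgebra.of_add, Prod.mk_add_mk, add_zero] using ha _ _ hy hz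
    | tmul f a =>
      induction f using AddMonoidAlgebra.induction_linear with
      | zero => rw [TensorProduct.zero_tmul]; exact h0
      | add f g hf hg =>
        rw [TensorProduct.add_tmul]
        simpa only [← LieAlgebra.of_add, Prod.mk_add_mk, add_zero] using ha _ _ hf hg
      | single m c =>
        have := hs c _ (hl a m)
        rw [loop, ← LieAlgebra.of_smul, Prod.smul_mk, smul_zero, TensorProduct.smul_tmul',
          AddMonoidAlgebra.smul_single, smul_eq_mul, mul_one] at this
        exact this
  obtain ⟨⟨y, z⟩, rfl⟩ := (LieAlgebra.ofProd cocycle).surjective x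
  have := ha _ _ (key y) (hs ((TrivialLieModule.equiv ℂ _ ℂ) z) _ hc)
  rw [central, ← LieAlgebra.of_smul, ← LieAlgebra.of_add, Prod.smul_mk, ← map_smul, smul_eq_mul,
    mul_one, LinearEquiv.symm_apply_apply, smul_zero, Prod.mk_add_mk, add_zero, zero_add] at this
  exact this

theorem mem_of_inU_mem {S : Subalgebra ℂ U} (h : ∀ x, inU x ∈ S) (u : U) : u ∈ S := by
  let f : Affine →ₗ⁅ℂ⁆ S :=
    { toFun x := ⟨inU x, h x⟩
      map_add' x y := Subtype.ext (map_add _ x y)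
      map_smul' c x := Subtype.ext (map_smul _ c x)
      map_lie' := Subtype.ext (LieHom.map_lie _ _ _) }
  have : S.val.comp (UniversalEnvelopingAlgebra.lift ℂ f) = AlgHom.id ℂ U := by
    refine UniversalEnvelopingAlgebra.hom_ext (R := ℂ) (L := Affine) (A := U) ?_
    ext x
    change S.val (UniversalEnvelopingAlgebra.lift ℂ f (inU x)) = inU x
    rw [UniversalEnvelopingAlgebra.lift_ι_apply ℂ f]
    rfl
  have hu : ((UniversalEnvelopingAlgebra.lift ℂ f u : S) : U) = u :=
    congrArg (fun g : U →ₐ[ℂ] U => g u) this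
  rw [← hu]
  exact (UniversalEnvelopingAlgebra.lift ℂ f u).2

namespace AffRep

section toLie

variable {κ : ℂ} {W : Type*} [AddCommGroup W] [Module ℂ W] (ρ : AffRep κ W)

/-- The linear map underlying `toLie`. -/
def toLin : Affine →ₗ[ℂ] Module.End ℂ W where
  toFun x := Finsupp.lsum ℂ ρ.op (LieAlgebra.LoopAlgebra.toFinsupp ℂ ℤ sl2
    ((LieAlgebra.ofProd cocycle).symm x).1) +
      (TrivialLieModule.equiv ℂ _ ℂ ((LieAlgebra.ofProd cocycle).symm x).2 * κ) • 1
  map_add' x y := by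
    simp only [LieAlgebra.of_symm_add, Prod.fst_add, Prod.snd_add, map_add, add_mul, add_smul]
    abel
  map_smul' c x := by
    simp only [LieAlgebra.of_symm_smul, Prod.smul_fst, Prod.smul_snd, map_smul, smul_eq_mul,
      mul_assoc, mul_smul, smul_add, RingHom.id_apply]

theorem toLin_loop (a : sl2) (m : ℤ) : ρ.toLin (loop a m) = ρ.op m a := by
  change Finsupp.lsum ℂ ρ.op (LieAlgebra.LoopAlgebra.toFinsupp ℂ ℤ sl2
    ((LieAlgebra.ofProd cocycle).symm (loop a m)).1) +
      (TrivialLieModule.equiv ℂ _ ℂ ((LieAlgebra.ofProd cocycle).symm (loop a m)).2 * κ) • 1 = _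
  rw [loop, Equiv.symm_apply_apply]
  simp only [LieAlgebra.LoopAlgebra.toFinsupp_single_tmul, map_zero, zero_mul, zero_smul, add_zero]
  simp

theorem toLin_central : ρ.toLin central = κ • 1 := by
  change Finsupp.lsum ℂ ρ.op (LieAlgebra.LoopAlgebra.toFinsupp ℂ ℤ sl2
    ((LieAlgebra.ofProd cocycle).symm central).1) +
      (TrivialLieModule.equiv ℂ _ ℂ ((LieAlgebra.ofProd cocycle).symm central).2 * κ) • 1 = _
  rw [central, Equiv.symm_apply_apply]
  simp

/-- The homomorphism given by a representation. -/
def toLie : Affine →ₗ⁅ℂ⁆ Module.End ℂ W where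
  __ := ρ.toLin
  map_lie' {x y} := by
    change ρ.toLin ⁅x, y⁆ = ⁅ρ.toLin x, ρ.toLin y⁆
    induction x using affine_induction with
    | hc => rw [central_bracket, map_zero, toLin_central, LieRing.of_associative_ring_bracket,
        smul_mul_assoc, mul_smul_comm, one_mul, mul_one, sub_self]
    | ha x x' hx hx' => rw [add_lie, map_add, hx, hx', map_add, add_lie]
    | hs c x hx => rw [smul_lie, map_smul, hx, map_smul, smul_lie]
    | hl a m =>
      induction y using affine_induction with
      | hc => rw [← lie_skew, central_bracket, toLin_central, LieRing.of_associative_ring_bracket,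
          smul_mul_assoc, mul_smul_comm, one_mul, mul_one, sub_self, neg_zero, map_zero]
      | ha x x' hx hx' => rw [lie_add, map_add, hx, hx', map_add, lie_add]
      | hs c x hx => rw [lie_smul, map_smul, hx, map_smul, lie_smul]
      | hl b n =>
        rw [loop_bracket, map_add, map_smul, toLin_loop, toLin_loop, toLin_loop, toLin_central]
        ext w
        have := ρ.comm m n a b w
        rw [LieRing.of_associative_ring_bracket, LinearMap.sub_apply, Module.End.mul_apply,
          Module.End.mul_apply, this, smul_smul]
        simp only [LinearMap.add_apply, LinearMap.smul_apply, Module.End.one_apply, ite_mul,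
          zero_mul]

@[simp] theorem toLie_loop (a : sl2) (m : ℤ) : ρ.toLie (loop a m) = ρ.op m a := ρ.toLin_loop a m

@[simp] theorem toLie_central : ρ.toLie central = κ • 1 := ρ.toLin_central

/-- Highest weight vectors of the associated representation of the affine Lie algebra. -/
theorem HW.isHighestWeightVector {ρ : AffRep κ W} {μ : ℂ} {w : W} (h : ρ.HW μ w) (hw : w ≠ 0) :
    IsHighestWeightVector ρ.toLie κ μ w where
  ne_zero := hw
  annihilated := by
    rintro x (rfl | ⟨a, m, hm, rfl⟩)
    · rw [toLie_loop, h.E_zero]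
    · rw [toLie_loop, h.pos m a hm]
  level := by simp
  weight := by rw [toLie_loop, h.H_zero]

end toLie

section ofModule

variable {κ : ℂ} {W : Type*} [AddCommGroup W] [Module ℂ W]

/-- The operators `a(m)` of a homomorphism from the affine Lie algebra. -/
def ofLie (ρ : Affine →ₗ⁅ℂ⁆ Module.End ℂ W) (hκ : ρ central = κ • 1) : AffRep κ W where
  op m :=
    { toFun a := ρ (loop a m)
      map_add' a b := by rw [loop_add, map_add]
      map_smul' c a := by rw [loop_smul, map_smul, RingHom.id_apply] }
  comm m n a b w := by
    have := LinearMap.congr_fun (LieHom.map_lie ρ (loop a m) (loop b n)) w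
    rw [loop_bracket, map_add, map_smul, hκ, LieRing.of_associative_ring_bracket,
      LinearMap.sub_apply, Module.End.mul_apply, Module.End.mul_apply] at this
    simp only [LinearMap.coe_mk, AddHom.coe_mk]
    rw [← this, LinearMap.add_apply, smul_smul, ite_mul, zero_mul]
    rfl

variable [Module U W] [IsScalarTower ℂ U W]

/-- A subspace stable under the affine Lie algebra is a submodule. -/
def toSubmodule {hκ : act W central = κ • 1} (N : Submodule ℂ W) (hN : (ofLie (act W) hκ).Inv N) :
    Submodule U W where
  __ := N
  smul_mem' u x hx := by
    let S : Subalgebra ℂ U :=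
      { carrier := {u | ∀ x ∈ N, u • x ∈ N}
        mul_mem' := fun {u v} hu hv x hx => by rw [mul_smul]; exact hu _ (hv x hx)
        add_mem' := fun {u v} hu hv x hx => by rw [add_smul]; exact add_mem (hu x hx) (hv x hx)
        algebraMap_mem' := fun c x hx => by
          rw [algebraMap_smul]
          exact N.smul_mem c hx }
    have : u ∈ S := by
      refine mem_of_inU_mem (fun y => ?_) u
      intro x hx
      rw [← act_apply]
      induction y using affine_induction with
      | hl a m => exact hN m a x hx
      | hc => rw [hκ]; exact N.smul_mem κ hx
      | ha y z hy hz => rw [map_add]; exact add_mem hy hz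
      | hs c y hy => rw [map_smul]; exact N.smul_mem c hy
    exact this x hx

end ofModule

end AffRep

/-! ### The modules `L(k, n)` -/

/-- The image of `central` commutes with the whole enveloping algebra, so its eigenvalue on a cyclic
vector is its value everywhere. -/
theorem act_central {W : Type*} [AddCommGroup W] [Module ℂ W] [Module U W] [IsScalarTower ℂ U W]
    {κ : ℂ} {w : W} (hw : ∀ x : W, ∃ u : U, x = u • w) (h : inU central • w = κ • w) :
    act W central = κ • 1 := by
  ext x
  obtain ⟨u, rfl⟩ := hw x
  have hu : u ∈ Subalgebra.centralizer ℂ {inU central} := by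
    refine mem_of_inU_mem (fun y => ?_) u
    rw [Subalgebra.mem_centralizer_iff]
    rintro _ rfl
    have := LieHom.map_lie (UniversalEnvelopingAlgebra.ι ℂ) central y
    rw [central_bracket, map_zero, LieRing.of_associative_ring_bracket] at this
    exact (sub_eq_zero.1 this.symm)
  rw [Subalgebra.mem_centralizer_iff] at hu
  have hu' := hu _ rfl
  rw [act_apply, ← mul_smul, hu', mul_smul, h, LinearMap.smul_apply, Module.End.one_apply]
  exact smul_algebra_smul_comm κ u w

section verma

variable (κ μ : ℂ)

/-- The canonical highest weight vector of the Verma module. -/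
def vermaVec : Verma κ μ := (vermaIdeal κ μ).mkQ 1

theorem exists_smul_vermaVec (x : Verma κ μ) : ∃ u : U, x = u • vermaVec κ μ := by
  obtain ⟨u, rfl⟩ := (vermaIdeal κ μ).mkQ_surjective x
  exact ⟨u, by rw [vermaVec, ← map_smul, smul_eq_mul, mul_one]⟩

theorem smul_vermaVec_eq_zero {u : U} (hu : u ∈ vermaIdeal κ μ) : u • vermaVec κ μ = 0 := by
  rw [vermaVec, ← map_smul, smul_eq_mul, mul_one]
  exact (Submodule.Quotient.mk_eq_zero _).2 hu

theorem verma_central_smul : inU central • vermaVec κ μ = κ • vermaVec κ μ := by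
  have := smul_vermaVec_eq_zero κ μ
    (Submodule.subset_span (Or.inr (Or.inl rfl)) : inU central - algebraMap ℂ U κ ∈ _)
  rwa [sub_smul, algebraMap_smul, sub_eq_zero] at this

theorem verma_H_smul : inU (loop H 0) • vermaVec κ μ = μ • vermaVec κ μ := by
  have := smul_vermaVec_eq_zero κ μ
    (Submodule.subset_span (Or.inr (Or.inr rfl)) : inU (loop H 0) - algebraMap ℂ U μ ∈ _)
  rwa [sub_smul, algebraMap_smul, sub_eq_zero] at this

theorem verma_nPlus_smul {x : Affine} (hx : x ∈ nPlus) : inU x • vermaVec κ μ = 0 :=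
  smul_vermaVec_eq_zero κ μ (Submodule.subset_span (Or.inl ⟨x, hx, rfl⟩))

/-- The Verma module as a representation. -/
def vermaRep : AffRep κ (Verma κ μ) := .ofLie (act (Verma κ μ))
  (act_central (exists_smul_vermaVec κ μ) (verma_central_smul κ μ))

theorem vermaRep_hw : (vermaRep κ μ).HW μ (vermaVec κ μ) where
  E_zero := verma_nPlus_smul κ μ (Or.inl rfl)
  pos m a hm := verma_nPlus_smul κ μ (Or.inr ⟨a, m, hm, rfl⟩)
  H_zero := verma_H_smul κ μ

theorem vermaRep_cyc : (vermaRep κ μ).cyc (vermaVec κ μ) = ⊤ := by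
  refine eq_top_iff.2 fun x _ => ?_
  obtain ⟨u, rfl⟩ := exists_smul_vermaVec κ μ x
  exact (AffRep.toSubmodule _ ((vermaRep κ μ).inv_cyc (vermaVec κ μ))).smul_mem u
    ((vermaRep κ μ).mem_cyc _)

/-- Verma modules are universal. -/
theorem vermaVec_ne_zero {W : Type*} [AddCommGroup W] [Module ℂ W] {ρ : AffRep κ W} {w : W}
    (h : ρ.HW μ w) (hw : w ≠ 0) : vermaVec κ μ ≠ 0 := by
  intro h0
  let φ : U →ₐ[ℂ] Module.End ℂ W := UniversalEnvelopingAlgebra.lift ℂ ρ.toLie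
  have hφ (x : Affine) : φ (inU x) = ρ.toLie x := UniversalEnvelopingAlgebra.lift_ι_apply ℂ _ x
  -- The annihilator of `w`: it contains the generators of the Verma ideal but not `1`.
  let N : Submodule U U :=
    { carrier := {u | φ u w = 0}
      zero_mem' := by simp
      add_mem' := fun {u v} (hu : φ u w = 0) (hv : φ v w = 0) => by simp [hu, hv]
      smul_mem' := fun u v (hv : φ v w = 0) => by simp [hv] }
  have hN : vermaIdeal κ μ ≤ N := by
    refine Submodule.span_le.2 ?_
    have hv := h.isHighestWeightVector hw
    rintro _ (⟨x, hx, rfl⟩ | rfl | rfl)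
    · change φ (inU x) w = 0
      rw [hφ, hv.annihilated x hx]
    · change φ (inU central - algebraMap ℂ U κ) w = 0
      rw [map_sub, hφ, AlgHom.commutes, LinearMap.sub_apply, hv.level,
        Module.algebraMap_end_apply, sub_self]
    · change φ (inU (loop H 0) - algebraMap ℂ U μ) w = 0
      rw [map_sub, hφ, AlgHom.commutes, LinearMap.sub_apply, hv.weight,
        Module.algebraMap_end_apply, sub_self]
  have h1 : (1 : U) ∈ N := hN ((Submodule.Quotient.mk_eq_zero _).1 h0)
  have h2 : φ 1 w = 0 := h1
  rw [map_one] at h2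
  exact hw h2

/-- Away from the critical level every proper submodule lies in the span of the words of positive
length, hence so does their sum, and the generator does not. -/
theorem vermaVec_notMem_maxSubmodule (hκ : κ + 2 ≠ 0) (h : vermaVec κ μ ≠ 0) :
    vermaVec κ μ ∉ maxSubmodule κ μ := by
  intro hmem
  have hw := vermaRep_hw κ μ
  have hc := vermaRep_cyc κ μ
  refine hw.notMem_wordSpan_one (hw.restricted hc) hκ h ?_
  rw [maxSubmodule, sSup_eq_iSup'] at hmem
  refine Submodule.iSup_induction _ (motive := fun x => x ∈ (vermaRep κ μ).wordSpan _ 1) hmem ?_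
    (zero_mem _) fun x y => add_mem
  rintro ⟨N, hN⟩ x hx
  refine hw.le_wordSpan_one hc hκ (N := N.restrictScalars ℂ) (fun m a y hy => N.smul_mem _ hy)
    (fun h => hN ?_) hx
  rwa [Submodule.restrictScalars_eq_top_iff] at h

end verma

section L

variable (k n : ℕ)

theorem exists_smul_hwVec (x : L k n) : ∃ u : U, x = u • hwVec k n := by
  obtain ⟨y, rfl⟩ := (maxSubmodule (k : ℂ) n).mkQ_surjective x
  obtain ⟨u, rfl⟩ := exists_smul_vermaVec k n y
  exact ⟨u, map_smul _ _ _⟩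

theorem smul_hwVec (u : U) : u • hwVec k n = (maxSubmodule (k : ℂ) n).mkQ (u • vermaVec k n) :=
  (map_smul _ _ _).symm

theorem act_L_central : act (L k n) central = (k : ℂ) • 1 :=
  act_central (exists_smul_hwVec k n) (by rw [smul_hwVec, verma_central_smul]; rfl)

/-- `L(k, n)` as a representation. -/
def lRep : AffRep (k : ℂ) (L k n) := .ofLie (act (L k n)) (act_L_central k n)

theorem lRep_op (m : ℤ) (a : sl2) : (lRep k n).op m a = act (L k n) (loop a m) := rfl

theorem lRep_hw : (lRep k n).HW n (hwVec k n) where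
  E_zero := (smul_hwVec k n (inU (loop E 0))).trans
    (by rw [verma_nPlus_smul k n (Or.inl rfl), map_zero])
  pos m a hm := (smul_hwVec k n (inU (loop a m))).trans
    (by rw [verma_nPlus_smul k n (Or.inr ⟨a, m, hm, rfl⟩), map_zero])
  H_zero := (smul_hwVec k n (inU (loop H 0))).trans (by rw [verma_H_smul]; rfl)

theorem lRep_cyc : (lRep k n).cyc (hwVec k n) = ⊤ := by
  refine eq_top_iff.2 fun x _ => ?_
  obtain ⟨u, rfl⟩ := exists_smul_hwVec k n x
  exact (AffRep.toSubmodule _ ((lRep k n).inv_cyc (hwVec k n))).smul_mem u ((lRep k n).mem_cyc _)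

theorem lRep_restricted : (lRep k n).Restricted := (lRep_hw k n).restricted (lRep_cyc k n)

/-- A proper invariant subspace pulls back to a proper submodule of the Verma module, which is
contained in `maxSubmodule` and vanishes in the quotient. -/
theorem lRep_irr : (lRep k n).Irr := by
  intro N hN
  refine or_iff_not_imp_right.2 fun hN' => (Submodule.eq_bot_iff _).2 fun x hx => ?_
  let N' : Submodule U (Verma (k : ℂ) n) :=
    (AffRep.toSubmodule N hN).comap (maxSubmodule (k : ℂ) n).mkQ
  obtain ⟨y, rfl⟩ := (maxSubmodule (k : ℂ) n).mkQ_surjective x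
  refine (Submodule.Quotient.mk_eq_zero _).2 ((le_sSup ?_ : N' ≤ maxSubmodule (k : ℂ) n) hx)
  intro htop
  refine hN' (eq_top_iff.2 fun z _ => ?_)
  obtain ⟨y, rfl⟩ := (maxSubmodule (k : ℂ) n).mkQ_surjective z
  exact (htop ▸ Submodule.mem_top : y ∈ N')

variable {k n}

theorem level_add_two_ne_zero (k : ℕ) : (k : ℂ) + 2 ≠ 0 := by
  exact_mod_cast Nat.succ_ne_zero (k + 1)

/-- Nonvanishing of `L(k, n)` is inferred from any representation containing a nonzero highest
weight vector of that weight. -/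
theorem hwVec_ne_zero {W : Type*} [AddCommGroup W] [Module ℂ W] {ρ : AffRep (k : ℂ) W} {w : W}
    (h : ρ.HW n w) (hw : w ≠ 0) : hwVec k n ≠ 0 := fun h0 =>
  vermaVec_notMem_maxSubmodule k n (level_add_two_ne_zero k) (vermaVec_ne_zero k n h hw)
    ((Submodule.Quotient.mk_eq_zero _).1 h0)

theorem eq_zero_of_hwVec_eq_zero (h : hwVec k n = 0) (x : L k n) : x = 0 := by
  obtain ⟨u, rfl⟩ := exists_smul_hwVec k n x
  rw [h, smul_zero]

/-- `L(k, n)` maps isomorphically to the irreducible highest weight representations of the same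
highest weight. -/
theorem exists_equiv_L {W : Type*} [AddCommGroup W] [Module ℂ W] {ρ : AffRep (k : ℂ) W} {w : W}
    (h : ρ.HW n w) (hi : ρ.Irr) (hw : w ≠ 0) : ∃ f : L k n ≃ₗ[ℂ] W, f (hwVec k n) = w ∧
      AffRep.Equivariant (lRep k n) ρ (f : L k n →ₗ[ℂ] W) :=
  (lRep_hw k n).exists_equiv h (lRep_irr k n) hi (level_add_two_ne_zero k) (hwVec_ne_zero h hw) hw

end L

end AffineSl2

end

/-! ### The finite-dimensional `sl₂`-module on a highest weight vector. -/

noncomputable section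

namespace AffineSl2

namespace AffRep

section zeroSpan

variable {κ : ℂ} {W : Type*} [AddCommGroup W] [Module ℂ W] {ρ : AffRep κ W}

variable (ρ) in
/-- The representation of `sl₂` generated by a highest weight vector. -/
def zeroSpan (w : W) : Submodule ℂ W := Submodule.span ℂ (Set.range fun i : ℕ => (ρ.op 0 F ^ i) w)

theorem F_pow_mem_zeroSpan (w : W) (i : ℕ) : (ρ.op 0 F ^ i) w ∈ ρ.zeroSpan w :=
  Submodule.subset_span ⟨i, rfl⟩

theorem self_mem_zeroSpan (w : W) : w ∈ ρ.zeroSpan w := F_pow_mem_zeroSpan w 0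

theorem zeroSpan_le {w : W} {N : Submodule ℂ W} (h : ∀ i : ℕ, (ρ.op 0 F ^ i) w ∈ N) :
    ρ.zeroSpan w ≤ N := by
  refine Submodule.span_le.2 ?_
  rintro _ ⟨i, rfl⟩
  exact h i

variable {μ : ℂ} {w : W}

theorem HW.sl2_pow (h : ρ.HW μ w) (i : ℕ) :
    ρ.op 0 H ((ρ.op 0 F ^ i) w) = (μ - 2 * i) • (ρ.op 0 F ^ i) w ∧
      ρ.op 0 E ((ρ.op 0 F ^ (i + 1)) w) = ((i + 1) * (μ - i)) • (ρ.op 0 F ^ i) w :=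
  AffineSl2.sl2_pow (e := ρ.op 0 E) (f := ρ.op 0 F) (h := ρ.op 0 H) (fun x => by simp [op_E_F])
    (fun x => by simp [op_H_F]) h.E_zero h.H_zero i

theorem HW.F_pow_pos (h : ρ.HW μ w) (i : ℕ) : ∀ (m : ℤ) (a : sl2), 0 < m →
    ρ.op m a ((ρ.op 0 F ^ i) w) = 0 := by
  induction i with
  | zero => exact h.pos
  | succ i ih =>
    intro m a hm
    rw [pow_succ', Module.End.mul_apply, op_op, ih m a hm, add_zero, ih m _ hm,
      if_neg (by omega), map_zero, zero_smul, add_zero, add_zero]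

theorem HW.zeroSpan_pos (h : ρ.HW μ w) {m : ℤ} (hm : 0 < m) (a : sl2) {x : W}
    (hx : x ∈ ρ.zeroSpan w) : ρ.op m a x = 0 := by
  have : ρ.zeroSpan w ≤ LinearMap.ker (ρ.op m a) := zeroSpan_le fun i => h.F_pow_pos i m a hm
  exact this hx

theorem HW.zeroSpan_maps (h : ρ.HW μ w) (a : sl2) : ρ.Maps (ρ.zeroSpan w) 0 a := by
  refine maps_of_basis (fun x hx => ?_) (fun x hx => ?_) (fun x hx => ?_) a
  · have : ρ.zeroSpan w ≤ (ρ.zeroSpan w).comap (ρ.op 0 E) := zeroSpan_le fun i => by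
      rw [Submodule.mem_comap]
      cases i with
      | zero => rw [pow_zero, Module.End.one_apply, h.E_zero]; exact zero_mem _
      | succ i => rw [(h.sl2_pow i).2]; exact Submodule.smul_mem _ _ (F_pow_mem_zeroSpan w i)
    exact this hx
  · have : ρ.zeroSpan w ≤ (ρ.zeroSpan w).comap (ρ.op 0 F) := zeroSpan_le fun i => by
      rw [Submodule.mem_comap, ← Module.End.mul_apply, ← pow_succ']
      exact F_pow_mem_zeroSpan w _
    exact this hx
  · have : ρ.zeroSpan w ≤ (ρ.zeroSpan w).comap (ρ.op 0 H) := zeroSpan_le fun i => by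
      rw [Submodule.mem_comap, (h.sl2_pow i).1]
      exact Submodule.smul_mem _ _ (F_pow_mem_zeroSpan w i)
    exact this hx

/-- Otherwise `F(0)^(n+1) w` would be a second singular vector, of weight `-n - 2`, contrary to
`HW.weight_unique`. -/
theorem HW.F_pow_eq_zero {n : ℕ} (h : ρ.HW n w) (hi : ρ.Irr) (hκ : κ + 2 ≠ 0) {i : ℕ}
    (hn : n < i) : (ρ.op 0 F ^ i) w = 0 := by
  have key : (ρ.op 0 F ^ (n + 1)) w = 0 := by
    by_contra hne
    have hw : w ≠ 0 := by
      rintro rfl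
      exact hne (map_zero _)
    have h1 : ρ.HW ((n : ℂ) - 2 * (n + 1 : ℕ)) ((ρ.op 0 F ^ (n + 1)) w) := by
      refine ⟨?_, h.F_pow_pos _, (h.sl2_pow _).1⟩
      rw [(h.sl2_pow n).2, sub_self, mul_zero, zero_smul]
    have h2 := h.weight_unique h1 hi hκ hw hne
    rw [sub_eq_self, mul_eq_zero] at h2
    rcases h2 with h2 | h2
    · exact two_ne_zero h2
    · exact Nat.succ_ne_zero n (Nat.cast_eq_zero.1 h2)
  obtain ⟨j, rfl⟩ := Nat.exists_eq_add_of_le (show n + 1 ≤ i by omega)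
  rw [add_comm, pow_add, Module.End.mul_apply, key, map_zero]

/-- The module is spanned by `F(0)^i w` with `i ≤ n ≤ k`, and each `E(0)` lowers `i` by one. -/
theorem HW.E_pow_zeroSpan {n k : ℕ} (h : ρ.HW n w) (hi : ρ.Irr) (hκ : κ + 2 ≠ 0)
    (hn : n ≤ k) {x : W} (hx : x ∈ ρ.zeroSpan w) : (ρ.op 0 E ^ (k + 1)) x = 0 := by
  have key : ∀ i j : ℕ, i < j → (ρ.op 0 E ^ j) ((ρ.op 0 F ^ i) w) = 0 := by
    intro i
    induction i with
    | zero =>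
      intro j hj
      obtain ⟨j, rfl⟩ := Nat.exists_eq_succ_of_ne_zero hj.ne'
      rw [pow_zero, Module.End.one_apply, pow_succ, Module.End.mul_apply, h.E_zero, map_zero]
    | succ i ih =>
      intro j hj
      obtain ⟨j, rfl⟩ := Nat.exists_eq_succ_of_ne_zero (Nat.ne_zero_of_lt hj)
      rw [pow_succ (ρ.op 0 E), Module.End.mul_apply, (h.sl2_pow i).2, map_smul, ih j (by omega),
        smul_zero]
  have : ρ.zeroSpan w ≤ LinearMap.ker (ρ.op 0 E ^ (k + 1)) := zeroSpan_le fun i => by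
    rw [LinearMap.mem_ker]
    by_cases hin : i ≤ n
    · exact key i _ (by omega)
    · rw [h.F_pow_eq_zero hi hκ (by omega), map_zero]
  exact this hx

end zeroSpan

/-! ### The fields generated by the currents form an irreducible representation -/

section fields

variable {k : ℕ} {W : Type*} [AddCommGroup W] [Module ℂ W] {ρ : AffRep (k : ℂ) W}
  (hρ : ρ.Restricted)

theorem fldRep_one {κ : ℂ} {ρ : AffRep κ W} (hρ : ρ.Restricted) {m : ℤ} (hm : 0 ≤ m) (a : sl2) :
    (fldRep hρ).op m a one = 0 := by
  obtain ⟨j, rfl⟩ := Int.eq_ofNat_of_zero_le hm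
  exact fprod_one_natCast _ j

theorem hw_one {κ : ℂ} {ρ : AffRep κ W} (hρ : ρ.Restricted) : (fldRep hρ).HW 0 one where
  E_zero := fldRep_one hρ le_rfl E
  pos m a hm := fldRep_one hρ hm.le a
  H_zero := by rw [fldRep_one hρ le_rfl, zero_smul]

/-- In the triple `F(1), E(-1), k - H(0)` the vector `w` has weight `k`, so `F(1)` kills the power
`k + 1` of `E(-1)` on `w`. This is the singular vector that must be shown to vanish among the
fields. -/
theorem hw_E_pow {σ : AffRep (k : ℂ) W} {w : W} (h : σ.HW 0 w) :
    σ.HW (2 * ((k : ℂ) + 1)) ((σ.op (-1) E ^ (k + 1)) w) := by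
  have hH : ∀ i : ℕ, σ.op 0 H ((σ.op (-1) E ^ i) w) = (2 * (i : ℂ)) • (σ.op (-1) E ^ i) w := by
    intro i
    induction i with
    | zero => simp [h.H_zero]
    | succ i ih =>
      rw [pow_succ', Module.End.mul_apply, op_H_E, ih, map_smul, zero_add, ← add_smul]
      push_cast
      congr 1
      ring
  have hE : ∀ i : ℕ, σ.op 0 E ((σ.op (-1) E ^ i) w) = 0 := by
    intro i
    induction i with
    | zero => simp [h.E_zero]
    | succ i ih => rw [pow_succ', Module.End.mul_apply, op_E_E, ih, map_zero]
  refine HW.of_chevalley (hE _) ?_ ?_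
  · have := (sl2_pow (e := σ.op 1 F) (f := σ.op (-1) E)
      (h := (k : ℂ) • (1 : Module.End ℂ W) - σ.op 0 H) (c := k)
      (fun x => by simp [op_F_E]; abel) (fun x => by simp [op_H_E]; abel) (h.pos 1 F one_pos)
      (by simp [h.H_zero]) k).2
    rw [this, sub_self, mul_zero, zero_smul]
  · rw [hH]
    push_cast
    rfl

variable (ρ) in
/-- The span of the images of the operators `a(m)` with `m < 0`. -/
def negSpan : Submodule ℂ W :=
  Submodule.span ℂ {x | ∃ (m : ℤ) (a : sl2) (y : W), m < 0 ∧ x = ρ.op m a y}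

theorem mem_negSpan {m : ℤ} (hm : m < 0) (a : sl2) (y : W) : ρ.op m a y ∈ ρ.negSpan :=
  Submodule.subset_span ⟨m, a, y, hm, rfl⟩

theorem negSpan_maps {m : ℤ} (hm : m ≤ 0) (a : sl2) : ρ.Maps ρ.negSpan m a := by
  rcases hm.lt_or_eq with hm | rfl
  · exact fun x _ => mem_negSpan hm a x
  · have : ρ.negSpan ≤ ρ.negSpan.comap (ρ.op 0 a) := by
      refine Submodule.span_le.2 ?_
      rintro _ ⟨m, b, y, hm, rfl⟩
      rw [SetLike.mem_coe, Submodule.mem_comap, op_op, if_neg (by omega), zero_smul, add_zero,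
        zero_add]
      exact add_mem (mem_negSpan hm b _) (mem_negSpan hm _ _)
    exact fun x hx => this hx

theorem HW.negSpan_le {μ : ℂ} {w : W} (h : ρ.HW μ w) (hw : ρ.cyc w = ⊤) :
    ρ.negSpan ≤ ρ.wordSpan w 1 := by
  refine Submodule.span_le.2 ?_
  rintro _ ⟨m, a, y, hm, rfl⟩
  exact neg_mem_wordSpan_one h hw hm a y

/-- Modulo `negSpan`, the modes of the powers of the current of `E` are powers of `E(0)` on the
lowest component of a highest weight representation. -/
theorem HW.E_pow_field {μ : ℂ} {w : W} (h : ρ.HW μ w) (i : ℕ) : ∀ (n : ℤ), ∀ x ∈ ρ.zeroSpan w,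
    (((fldRep hρ).op (-1) E ^ i) one).1 n x - (one : Fld W).1 (n - i) ((ρ.op 0 E ^ i) x) ∈
      ρ.negSpan := by
  induction i with
  | zero => intro n x _; simp
  | succ i ih =>
    intro n x hx
    obtain ⟨K, hK⟩ := Fld.exists_bound (((fldRep hρ).op (-1) E ^ i) one) x n
    -- In the normally ordered product, the terms with a negative mode of `E` on the left lie in
    -- `negSpan`. Of the nonnegative modes acting first, only `E(0)` is nonzero on `zeroSpan w`.
    rw [pow_succ', Module.End.mul_apply, fldRep_op, fprod_neg_one_apply _ _ n x K 1 hK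
      fun i hi => h.zeroSpan_pos (by omega) E hx, Finset.sum_range_one, add_sub_assoc]
    refine add_mem (Submodule.sum_mem _ fun j _ => mem_negSpan (by omega) E _) ?_
    rw [pow_succ (ρ.op 0 E), Module.End.mul_apply]
    simpa only [Nat.cast_zero, sub_zero, cur_apply, Nat.cast_succ, sub_sub, add_comm (i : ℤ) 1]
      using ih (n - 1) _ (h.zeroSpan_maps E x hx)

/-- If the modes of a highest weight field generated by the currents map the highest weight vector
of an irreducible representation to `negSpan`, the field vanishes. -/
theorem HW.field_eq_zero {μ ν : ℂ} {w : W} (h : ρ.HW μ w) (hcw : ρ.cyc w = ⊤)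
    (hi : ρ.Irr) {φ : Fld W}
    (hφ : (fldRep hρ).HW ν φ) (hmem : φ ∈ vfld hρ)
    (hw : ∀ n, ∀ x ∈ ρ.zeroSpan w, φ.1 n x ∈ ρ.negSpan) : φ = 0 := by
  by_cases hw0 : w = 0
  · subst hw0
    have hall : ∀ x : W, x = 0 := fun x => by
      have : ρ.cyc (0 : W) ≤ ⊥ := ρ.cyc_le (fun m a x hx => by
        rw [(Submodule.mem_bot ℂ).1 hx, map_zero]; exact zero_mem _) (zero_mem _)
      exact (Submodule.mem_bot ℂ).1 (this (hcw ▸ Submodule.mem_top))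
    exact Fld.ext fun n x => by rw [hall x, map_zero, map_zero]
  have hmem' : ∀ f ∈ (fldRep hρ).zeroSpan φ, f ∈ vfld hρ := by
    have : (fldRep hρ).zeroSpan φ ≤ vfld hρ := zeroSpan_le fun i => by
      induction i with
      | zero => exact hmem
      | succ i ih => rw [pow_succ', Module.End.mul_apply]; exact fprod_cur_mem hρ ih 0 F
    exact this
  -- The positive modes kill these fields, so only the term `j = 0` of the commutator formula
  -- remains: the fields form a tensor operator for the affine algebra.
  have hcomm : ∀ f ∈ (fldRep hρ).zeroSpan φ, ∀ (m n : ℤ) (a : sl2) (x : W),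
      ρ.op m a (f.1 n x) - f.1 n (ρ.op m a x) = ((fldRep hρ).op 0 a f).1 (m + n) x := by
    intro f hf m n a x
    obtain ⟨J, hJ1, hJ⟩ := (loc_cur hρ (hmem' f hf) a).exists_hasComm 1
    refine (hJ.2 m n x).trans ?_
    rw [Finset.sum_eq_single_of_mem 0 (Finset.mem_range.2 hJ1)]
    · simp
    · intro j _ hj
      have := hφ.zeroSpan_pos (m := j) (by omega) a hf
      rw [fldRep_op] at this
      simp only [this, Fld.zero_apply, smul_zero]
  have hlow : ∀ f ∈ (fldRep hρ).zeroSpan φ, ∀ n, ∀ x ∈ ρ.zeroSpan w, f.1 n x ∈ ρ.negSpan := by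
    intro f hf
    let N : Submodule ℂ (Fld W) :=
      { carrier := {f | ∀ n, ∀ x ∈ ρ.zeroSpan w, f.1 n x ∈ ρ.negSpan}
        zero_mem' := fun n x _ => by rw [Fld.zero_apply]; exact zero_mem _
        add_mem' := fun hf hg n x hx => by
          rw [Fld.add_apply]; exact add_mem (hf n x hx) (hg n x hx)
        smul_mem' := fun c f hf n x hx => by
          rw [Fld.smul_apply]; exact Submodule.smul_mem _ c (hf n x hx) }
    have : (fldRep hρ).zeroSpan φ ≤ N := zeroSpan_le fun i => by
      induction i with
      | zero => exact hw
      | succ i ih =>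
        intro n x hx
        rw [pow_succ', Module.End.mul_apply, fldRep_op, fprod_zero_apply]
        exact sub_mem (negSpan_maps le_rfl F _ (ih n x hx)) (ih n _ (h.zeroSpan_maps F x hx))
    exact this hf
  -- From the generator to all of `W`: the operators `a(m)` with `m ≤ 0` preserve `negSpan` and, by
  -- `hcomm`, permute the modes of fields in `zeroSpan φ` up to such terms.
  have hall : ∀ x : W, ∀ f ∈ (fldRep hρ).zeroSpan φ, ∀ n, f.1 n x ∈ ρ.negSpan := by
    let N : Submodule ℂ W :=
      { carrier := {x | ∀ f ∈ (fldRep hρ).zeroSpan φ, ∀ n, f.1 n x ∈ ρ.negSpan}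
        zero_mem' := fun f _ n => by rw [map_zero]; exact zero_mem _
        add_mem' := fun hx hy f hf n => by rw [map_add]; exact add_mem (hx f hf n) (hy f hf n)
        smul_mem' := fun c x hx f hf n => by
          rw [map_smul]; exact Submodule.smul_mem _ c (hx f hf n) }
    have hN : ∀ m ≤ 0, ∀ a, ρ.Maps N m a := by
      intro m hm a x hx f hf n
      rw [← sub_sub_cancel (ρ.op m a (f.1 n x)) (f.1 n (ρ.op m a x)), hcomm f hf]
      exact sub_mem (negSpan_maps hm a _ (hx f hf n)) (hx _ (hφ.zeroSpan_maps a f hf) _)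
    exact fun x => h.mem_of_words hcw (N := N) (fun f hf n => hlow f hf n w (self_mem_zeroSpan w))
      (hN 0 le_rfl F) (hN (-1) (by omega) E) x
  -- The span of all these modes is invariant by `hcomm` and contained in `negSpan`, which misses
  -- `w`; irreducibility makes it zero.
  let Z : Submodule ℂ W :=
    Submodule.span ℂ {y | ∃ f ∈ (fldRep hρ).zeroSpan φ, ∃ (n : ℤ) (x : W), y = f.1 n x}
  have hZ : ρ.Inv Z := by
    intro m a y hy
    have : Z ≤ Z.comap (ρ.op m a) := by
      refine Submodule.span_le.2 ?_
      rintro _ ⟨f, hf, n, x, rfl⟩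
      rw [SetLike.mem_coe, Submodule.mem_comap, eq_add_of_sub_eq (hcomm f hf m n a x)]
      exact add_mem (Submodule.subset_span ⟨_, hφ.zeroSpan_maps a f hf, _, _, rfl⟩)
        (Submodule.subset_span ⟨f, hf, _, _, rfl⟩)
    exact this hy
  have hZle : Z ≤ ρ.negSpan := by
    refine Submodule.span_le.2 ?_
    rintro _ ⟨f, hf, n, x, rfl⟩
    exact hall x f hf n
  have hZ0 : Z = ⊥ := (hi Z hZ).resolve_right fun htop =>
    h.notMem_wordSpan_one hρ (level_add_two_ne_zero k) hw0
      (h.negSpan_le hcw (hZle (htop ▸ Submodule.mem_top)))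
  refine Fld.ext fun n x => ?_
  rw [Fld.zero_apply]
  exact (Submodule.mem_bot ℂ).1
    (hZ0 ▸ Submodule.subset_span ⟨φ, self_mem_zeroSpan φ, n, x, rfl⟩ : φ.1 n x ∈ (⊥ : Submodule ℂ W))

/-- The integrability relation `E(x)^(k+1) = 0`: on the top component, modulo `negSpan`, the modes
reduce to `E(0)^(k+1)`, which is zero there because `n ≤ k`. -/
theorem HW.E_pow_field_eq_zero {n : ℕ} {w : W} (h : ρ.HW n w)
    (hcw : ρ.cyc w = ⊤) (hi : ρ.Irr) (hn : n ≤ k) :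
    ((fldRep hρ).op (-1) E ^ (k + 1)) one = 0 := by
  refine h.field_eq_zero hρ hcw hi (hw_E_pow (hw_one hρ)) ?_ fun m x hx => ?_
  · have : ∀ i : ℕ, ((fldRep hρ).op (-1) E ^ i) one ∈ vfld hρ := by
      intro i
      induction i with
      | zero => exact one_mem_vfld hρ
      | succ i ih => rw [pow_succ', Module.End.mul_apply]; exact fprod_cur_mem hρ ih _ _
    exact this _
  · have := h.E_pow_field hρ (k + 1) m x hx
    rwa [h.E_pow_zeroSpan hi (level_add_two_ne_zero k) hn hx, map_zero, sub_zero] at this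

theorem coe_sub_op_pow {κ : ℂ} {ρ : AffRep κ W} (N : Submodule ℂ W) (hN : ρ.Inv N) (m : ℤ)
    (a : sl2) (i : ℕ) (x : N) :
    ((((ρ.sub N hN).op m a ^ i) x : N) : W) = (ρ.op m a ^ i) (x : W) := by
  induction i with
  | zero => rfl
  | succ i ih => rw [pow_succ', pow_succ', Module.End.mul_apply, Module.End.mul_apply, coe_sub_op, ih]

/-- The state-field correspondence. -/
theorem exists_fieldMap (hE : ((fldRep hρ).op (-1) E ^ (k + 1)) one = 0) :
    ∃ Y : L k 0 →ₗ[ℂ] Fld W, Y (hwVec k 0) = one ∧ Equivariant (lRep k 0) (fldRep hρ) Y := by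
  -- The identity field vanishes only for `W = 0`, where the zero map serves. Otherwise it is a
  -- nonzero highest weight vector.
  by_cases h1 : (one : Fld W) = 0
  · have hx : ∀ x : W, x = 0 := fun x => by
      have := one_apply (-1) x
      rwa [h1, Fld.zero_apply, if_pos rfl, eq_comm] at this
    exact ⟨0, by rw [h1, LinearMap.zero_apply], fun m a x => Fld.ext fun n w => by
      rw [hx w, map_zero, map_zero]⟩
  let σ := (fldRep hρ).sub (vfld hρ) ((fldRep hρ).inv_cyc one)
  let w : vfld hρ := ⟨one, one_mem_vfld hρ⟩
  have hw : σ.HW 0 w := ⟨Subtype.ext (hw_one hρ).E_zero,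
    fun m a hm => Subtype.ext ((hw_one hρ).pos m a hm), Subtype.ext (hw_one hρ).H_zero⟩
  have hcw : σ.cyc w = ⊤ := (fldRep hρ).cyc_sub_cyc one
  -- On the identity field `F(0)` is zero and `E(-1)^(k+1)` is zero by hypothesis, so the generated
  -- fields form an irreducible representation of weight `0`, that is, a copy of `L(k, 0)`.
  have hi : σ.Irr := hw.irr hcw
    ⟨1, Subtype.ext (by rw [pow_one]; exact fldRep_one hρ le_rfl F)⟩
    ⟨k + 1, Subtype.ext ((coe_sub_op_pow _ _ _ _ _ _).trans hE)⟩
  obtain ⟨f, hf, hf'⟩ := exists_equiv_L (k := k) (n := 0) (ρ := σ) (w := w) (by simpa using hw) hi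
    fun h => h1 (congrArg Subtype.val h)
  refine ⟨(vfld hρ).subtype ∘ₗ (f : L k 0 →ₗ[ℂ] vfld hρ), ?_, fun m a x => ?_⟩
  · exact congrArg Subtype.val hf
  · exact congrArg Subtype.val (hf' m a x)

end fields

end AffRep

end AffineSl2

end

/-! ### Intertwining fields, and field maps as homomorphisms for products. -/

noncomputable section

namespace AffineSl2

section intertwine

variable {W W' : Type*} [AddCommGroup W] [Module ℂ W] [AddCommGroup W'] [Module ℂ W']

/-- The linear map `π` commutes with the modes of the fields `f` and `f'`. -/
def Fld.Intertwines (π : W →ₗ[ℂ] W') (f : Fld W) (f' : Fld W') : Prop :=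
  ∀ n w, π (f.1 n w) = f'.1 n (π w)

variable {π : W →ₗ[ℂ] W'} {a f : Fld W} {a' f' g' : Fld W'}

theorem Fld.Intertwines.one : Fld.Intertwines π one one := fun n w => by
  rw [one_apply, one_apply]
  split_ifs <;> simp

theorem Fld.Intertwines.nop (ha : Fld.Intertwines π a a') (hf : Fld.Intertwines π f f')
    (l p n : ℤ) (w : W) : π (nop a f l p n w) = AffineSl2.nop a' f' l p n (π w) := by
  obtain ⟨K, hK⟩ := f.exists_bound w n
  rw [nop_eq_sum a f l p n w K hK, nop_eq_sum a' f' l p n (π w) K fun i hi => by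
    rw [← hf, hK i hi, map_zero], map_sum]
  exact Finset.sum_congr rfl fun i _ => by rw [map_smul, ha, hf]

theorem Fld.Intertwines.bor (ha : Fld.Intertwines π a a') (hf : Fld.Intertwines π f f')
    (l p : ℤ) : Fld.Intertwines π (bor l p a f) (AffineSl2.bor l p a' f') := fun n w => by
  rw [bor_apply, bor_apply, map_sub, map_smul, ha.nop hf, hf.nop ha]

theorem Fld.Intertwines.unique (hπ : Function.Surjective π) (hf : Fld.Intertwines π f f')
    (hg : Fld.Intertwines π f g') : f' = g' := Fld.ext fun n w => by
  obtain ⟨w, rfl⟩ := hπ w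
  rw [← hf, ← hg]

theorem Fld.Intertwines.eq_zero_of_prod {f : Fld (W × W')}
    (h : Fld.Intertwines (LinearMap.fst ℂ W W') f 0)
    (h' : Fld.Intertwines (LinearMap.snd ℂ W W') f 0) : f = 0 :=
  Fld.ext fun n w => Prod.ext (h n w) (h' n w)

end intertwine

namespace AffRep

/-! ### Field maps -/

section stateField

variable {κ : ℂ} {V W W' : Type*} [AddCommGroup V] [Module ℂ V] [AddCommGroup W] [Module ℂ W]
  [AddCommGroup W'] [Module ℂ W'] {σ : AffRep κ V} {v₀ : V} {ρ : AffRep κ W} {hρ : ρ.Restricted}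
  {ρ' : AffRep κ W'} {hρ' : ρ'.Restricted}

variable (hρ hρ') in
theorem Equivariant.intertwines_cur {π : W →ₗ[ℂ] W'} (hπ : Equivariant ρ ρ' π) (a : sl2) :
    Fld.Intertwines π (cur hρ a) (cur hρ' a) := fun n w => hπ n a w

variable (hρ hρ') in
theorem Equivariant.intertwines_pow {π : W →ₗ[ℂ] W'} (hπ : Equivariant ρ ρ' π) (a : sl2)
    (m : ℤ) (i : ℕ) : Fld.Intertwines π (((fldRep hρ).op m a ^ i) one)
      (((fldRep hρ').op m a ^ i) one) := by
  induction i with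
  | zero => exact Fld.Intertwines.one
  | succ i ih =>
    rw [pow_succ', pow_succ', Module.End.mul_apply, Module.End.mul_apply, fldRep_op, fldRep_op]
    exact (hπ.intertwines_cur hρ hρ' a).bor ih m 0

variable (σ v₀ hρ) in
/-- `Y` is an equivariant map from states to fields which sends the vacuum `v₀` to the identity. -/
structure IsStateField (Y : V →ₗ[ℂ] Fld W) : Prop where
  map_vac : Y v₀ = one
  map_op : Equivariant σ (fldRep hρ) Y

theorem cyc_induction (hc : σ.cyc v₀ = ⊤) {N : Submodule ℂ V} (h : v₀ ∈ N) (hN : σ.Inv N) (v : V) :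
    v ∈ N :=
  σ.cyc_le hN h (hc ▸ Submodule.mem_top)

variable {Y : V →ₗ[ℂ] Fld W} {Y' : V →ₗ[ℂ] Fld W'}

theorem IsStateField.mem_vfld (hc : σ.cyc v₀ = ⊤) (h : IsStateField σ v₀ hρ Y) (v : V) :
    Y v ∈ vfld hρ := by
  refine cyc_induction hc (N := (vfld hρ).comap Y) ?_ (fun m a x hx => ?_) v
  · rw [Submodule.mem_comap, h.map_vac]
    exact one_mem_vfld hρ
  · rw [Submodule.mem_comap, h.map_op]
    exact fprod_cur_mem hρ hx m a

theorem IsStateField.exists_of_mem (h : IsStateField σ v₀ hρ Y) {f : Fld W} (hf : f ∈ vfld hρ) :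
    ∃ v, Y v = f := by
  refine vfld_le hρ (N := LinearMap.range Y) ⟨_, h.map_vac⟩ ?_ hf
  rintro m a _ ⟨v, rfl⟩
  exact ⟨_, h.map_op m a v⟩

/-- All fields are built from the identity and the currents by products, and an equivariant map
respects each of these. With `π` the identity this is uniqueness of field maps. -/
theorem IsStateField.intertwines (hc : σ.cyc v₀ = ⊤) (h : IsStateField σ v₀ hρ Y)
    (h' : IsStateField σ v₀ hρ' Y') {π : W →ₗ[ℂ] W'} (hπ : Equivariant ρ ρ' π) (v : V) :
    Fld.Intertwines π (Y v) (Y' v) := by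
  let N : Submodule ℂ V :=
    { carrier := {v | Fld.Intertwines π (Y v) (Y' v)}
      zero_mem' := fun n w => by
        rw [map_zero, map_zero, Fld.zero_apply, Fld.zero_apply, map_zero]
      add_mem' := fun hu hv n w => by
        rw [map_add, map_add, Fld.add_apply, Fld.add_apply, map_add, hu, hv]
      smul_mem' := fun c u hu n w => by
        rw [map_smul, map_smul, Fld.smul_apply, Fld.smul_apply, map_smul, hu] }
  refine cyc_induction hc (N := N) ?_ (fun m a u hu => ?_) v
  · change Fld.Intertwines π (Y _) (Y' _)
    rw [h.map_vac, h'.map_vac]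
    exact Fld.Intertwines.one
  · change Fld.Intertwines π (Y _) (Y' _)
    rw [h.map_op, h'.map_op]
    exact (hπ.intertwines_cur hρ hρ' a).bor hu m 0

theorem IsStateField.map_pow (h : IsStateField σ v₀ hρ Y) (m : ℤ) (a : sl2) (i : ℕ) :
    Y ((σ.op m a ^ i) v₀) = ((fldRep hρ).op m a ^ i) one := by
  induction i with
  | zero => exact h.map_vac
  | succ i ih =>
    rw [pow_succ', pow_succ', Module.End.mul_apply, Module.End.mul_apply, h.map_op, ih]

theorem IsStateField.creation (hc : σ.cyc v₀ = ⊤) (h0 : ∀ (m : ℤ) (a : sl2), 0 ≤ m → σ.op m a v₀ = 0)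
    {hσ : σ.Restricted} {Y : V →ₗ[ℂ] Fld V} (h : IsStateField σ v₀ hσ Y) (v : V) :
    (∀ n, 0 ≤ n → (Y v).1 n v₀ = 0) ∧ (Y v).1 (-1) v₀ = v := by
  let N : Submodule ℂ V :=
    { carrier := {v | (∀ n, 0 ≤ n → (Y v).1 n v₀ = 0) ∧ (Y v).1 (-1) v₀ = v}
      zero_mem' := ⟨fun n _ => by rw [map_zero, Fld.zero_apply], by rw [map_zero, Fld.zero_apply]⟩
      add_mem' := fun hu hv => ⟨fun n hn => by
        rw [map_add, Fld.add_apply, hu.1 n hn, hv.1 n hn, add_zero], by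
        rw [map_add, Fld.add_apply, hu.2, hv.2]⟩
      smul_mem' := fun c u hu => ⟨fun n hn => by
        rw [map_smul, Fld.smul_apply, hu.1 n hn, smul_zero], by
        rw [map_smul, Fld.smul_apply, hu.2]⟩ }
  refine cyc_induction hc (N := N) ?_ (fun m a u hu => ?_) v
  · refine ⟨fun n hn => ?_, ?_⟩
    · rw [h.map_vac, one_apply, if_neg (by omega)]
    · rw [h.map_vac, one_apply, if_pos rfl]
  · have key : ∀ n, -1 ≤ n → (Y (σ.op m a u)).1 n v₀ = σ.op m a ((Y u).1 n v₀) := by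
      intro n hn
      rw [h.map_op, fldRep_op, bor_apply, nop_eq_zero (Y u) (cur hσ a) m n 0 _ fun i => by
        rw [cur_apply]; exact h0 _ a (by omega), smul_zero, sub_zero,
        nop_eq_sum (cur hσ a) (Y u) m 0 n v₀ 1 fun i hi => hu.1 _ (by omega)]
      simp
    refine ⟨fun n hn => ?_, ?_⟩
    · rw [key n (by omega), hu.1 n hn, map_zero]
    · rw [key (-1) le_rfl, hu.2]

/-- Field maps send products of states to products of fields. -/
theorem IsStateField.map_mode_of_prod (hc : σ.cyc v₀ = ⊤)
    (h0 : ∀ (m : ℤ) (a : sl2), 0 ≤ m → σ.op m a v₀ = 0) {hσ : σ.Restricted}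
    {Y : V →ₗ[ℂ] Fld V} (h : IsStateField σ v₀ hσ Y) (h' : IsStateField σ v₀ hρ' Y')
    {Z : V →ₗ[ℂ] Fld (V × W')} (hZ : IsStateField σ v₀ (hσ.prod hρ') Z) (u v : V) (l : ℤ) :
    Y' ((Y u).1 l v) = fprod l (Y' u) (Y' v) := by
  have h1 : ∀ v, Fld.Intertwines (LinearMap.fst ℂ V W') (Z v) (Y v) :=
    hZ.intertwines hc h fun _ _ _ => rfl
  have h2 : ∀ v, Fld.Intertwines (LinearMap.snd ℂ V W') (Z v) (Y' v) :=
    hZ.intertwines hc h' fun _ _ _ => rfl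
  obtain ⟨x, hx⟩ := hZ.exists_of_mem
    ((fprod_mem_and_loc _ (hZ.mem_vfld hc v) (hZ.mem_vfld hc u)).1 l)
  have hx1 : Y x = fprod l (Y u) (Y v) :=
    (h1 x).unique Prod.fst_surjective (hx ▸ (h1 u).bor (h1 v) l 0)
  have hx2 : Y' x = fprod l (Y' u) (Y' v) :=
    (h2 x).unique Prod.snd_surjective (hx ▸ (h2 u).bor (h2 v) l 0)
  have hxv : x = (Y u).1 l v := by
    rw [← (h.creation hc h0 x).2, hx1, bor_apply, nop_eq_zero (Y v) (Y u) l (-1) 0 _ fun i =>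
      (h.creation hc h0 u).1 _ (by omega), smul_zero, sub_zero,
      nop_eq_sum (Y u) (Y v) l 0 (-1) v₀ 1 fun i hi => (h.creation hc h0 v).1 _ (by omega)]
    simp [(h.creation hc h0 v).2]
  rw [← hxv, hx2]

end stateField

section fieldMap

variable {k : ℕ} {W W' : Type*} [AddCommGroup W] [Module ℂ W] [AddCommGroup W'] [Module ℂ W']
  {ρ : AffRep (k : ℂ) W} {hρ : ρ.Restricted} {ρ' : AffRep (k : ℂ) W'} {hρ' : ρ'.Restricted}

variable (hρ) in
/-- `Y` is the field map of the representation `ρ` of level `k`. -/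
abbrev IsFieldMap (Y : L k 0 →ₗ[ℂ] Fld W) : Prop := IsStateField (lRep k 0) (hwVec k 0) hρ Y

variable {Y : L k 0 →ₗ[ℂ] Fld W} {Y' : L k 0 →ₗ[ℂ] Fld W'}

theorem HW.op_zero_eq_zero {κ : ℂ} {ρ : AffRep κ W} {w : W} (h : ρ.HW (0 : ℕ) w) (hi : ρ.Irr)
    (hκ : κ + 2 ≠ 0) (m : ℤ) (a : sl2) (hm : 0 ≤ m) : ρ.op m a w = 0 := by
  rcases hm.lt_or_eq with hm | rfl
  · exact h.pos m a hm
  · have hF : ρ.op 0 F w = 0 := by simpa using h.F_pow_eq_zero hi hκ one_pos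
    have hE := h.E_zero
    have hH := h.H_zero
    rw [Nat.cast_zero, zero_smul] at hH
    obtain ⟨x, y, z, rfl⟩ := sl2_eq a
    simp [hE, hF, hH]

theorem HW.E_pow_eq_zero {w : W} (h : ρ.HW 0 w) (hi : ρ.Irr) :
    (ρ.op (-1) E ^ (k + 1)) w = 0 := by
  by_contra hne
  have h0 : w ≠ 0 := fun h => hne (by rw [h, map_zero])
  have h2 := h.weight_unique (hw_E_pow h) hi (level_add_two_ne_zero k) h0 hne
  rw [mul_eq_zero] at h2
  rcases h2 with h2 | h2
  · exact two_ne_zero h2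
  · exact Nat.succ_ne_zero k (by exact_mod_cast h2)

theorem lRep_hw_zero (k : ℕ) : (lRep k 0).HW 0 (hwVec k 0) := Nat.cast_zero (R := ℂ) ▸ lRep_hw k 0

theorem op_hwVec_zero (k : ℕ) (m : ℤ) (a : sl2) (hm : 0 ≤ m) :
    (lRep k 0).op m a (hwVec k 0) = 0 :=
  (lRep_hw k 0).op_zero_eq_zero (lRep_irr k 0) (level_add_two_ne_zero k) m a hm

/-- The relation holds for the vacuum vector of `L(k, 0)` and is carried to the fields by the field
map. -/
theorem IsFieldMap.E_pow (h : IsFieldMap hρ Y) :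
    ((fldRep hρ).op (-1) E ^ (k + 1)) one = 0 := by
  rw [← h.map_pow, (lRep_hw_zero k).E_pow_eq_zero (lRep_irr k 0), map_zero]

/-- The field `E(x)^(k+1)` on a direct sum vanishes when both of its components do, so the criterion
of `exists_fieldMap` passes to direct sums. -/
theorem IsFieldMap.exists_prod (h : IsFieldMap hρ Y) (h' : IsFieldMap hρ' Y') :
    ∃ Z : L k 0 →ₗ[ℂ] Fld (W × W'), IsFieldMap (hρ.prod hρ') Z := by
  obtain ⟨Z, hZ, hZ'⟩ := exists_fieldMap (hρ.prod hρ') (Fld.Intertwines.eq_zero_of_prod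
    (IsFieldMap.E_pow h ▸ Equivariant.intertwines_pow (ρ := ρ.prod ρ') (ρ' := ρ) (hρ.prod hρ') hρ
      (fun _ _ _ => rfl) E (-1) (k + 1))
    (IsFieldMap.E_pow h' ▸ Equivariant.intertwines_pow (ρ := ρ.prod ρ') (ρ' := ρ') (hρ.prod hρ') hρ'
      (fun _ _ _ => rfl) E (-1) (k + 1)))
  exact ⟨Z, hZ, hZ'⟩

theorem IsFieldMap.map_mode {h₀ : (lRep k 0).Restricted} {Y₀ : L k 0 →ₗ[ℂ] Fld (L k 0)}
    (h : IsFieldMap h₀ Y₀) (h' : IsFieldMap hρ' Y') (u v : L k 0) (l : ℤ) :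
    Y' ((Y₀ u).1 l v) = fprod l (Y' u) (Y' v) := by
  obtain ⟨Z, hZ⟩ := IsFieldMap.exists_prod h h'
  exact h.map_mode_of_prod (lRep_cyc k 0) (op_hwVec_zero k) h' hZ u v l

end fieldMap

end AffRep

/-! ### Fields and vertex operators -/

section vertexOperator

variable {W : Type*} [AddCommGroup W] [Module ℂ W]

theorem Fld.bddBelow_support (f : Fld W) (w : W) :
    BddBelow (Function.support fun n : ℤ => f.1 (-n - 1) w) := by
  obtain ⟨N, hN⟩ := f.2 w
  refine ⟨-N, fun n hn => ?_⟩
  by_contra h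
  exact hn (hN _ (by omega))

/-- The vertex operator of a field. -/
def toVertexOperator : Fld W →ₗ[ℂ] VertexOperator ℂ W where
  toFun f := VertexOperator.of_coeff (fun n => f.1 (-n - 1)) f.bddBelow_support
  map_add' _ _ := rfl
  map_smul' _ _ := rfl

@[simp] theorem nthMode_toVertexOperator (f : Fld W) (n : ℤ) :
    nthMode (toVertexOperator f) n = f.1 n := by
  have h := VertexOperator.ncoeff_of_coeff (R := ℂ) (fun n => f.1 (-n - 1)) f.bddBelow_support n
  refine h.trans ?_
  rw [show -(-n - 1) - 1 = n by ring]

/-- The field of a vertex operator. -/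
def ofVertexOperator : VertexOperator ℂ W →ₗ[ℂ] Fld W where
  toFun A := ⟨fun n => nthMode A n, fun w =>
    ⟨-HahnSeries.order ((HahnModule.of ℂ).symm (A w)), fun n hn =>
      VertexOperator.ncoeff_eq_zero_of_lt_order A n w (by omega)⟩⟩
  map_add' A B := Fld.ext fun n w => by
    rw [Fld.add_apply]
    exact LinearMap.congr_fun (congrFun (map_add VertexOperator.ncoeff A B) n) w
  map_smul' c A := Fld.ext fun n w => by
    rw [Fld.smul_apply]
    exact LinearMap.congr_fun (congrFun (map_smul VertexOperator.ncoeff c A) n) w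

@[simp] theorem ofVertexOperator_apply (A : VertexOperator ℂ W) (n : ℤ) :
    (ofVertexOperator A).1 n = nthMode A n := rfl

@[simp] theorem ofVertexOperator_toVertexOperator (f : Fld W) :
    ofVertexOperator (toVertexOperator f) = f :=
  Fld.ext fun n w => by rw [ofVertexOperator_apply, nthMode_toVertexOperator]

theorem jacobiIdentity_iff {V : Type*} [AddCommGroup V] [Module ℂ V]
    (Y : V →ₗ[ℂ] VertexOperator ℂ V) (YW : V →ₗ[ℂ] VertexOperator ℂ W) :
    JacobiIdentity Y YW ↔ ∀ (u v : V) (w : W) (l m n : ℤ),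
      (bor l m (ofVertexOperator (YW u)) (ofVertexOperator (YW v))).1 n w =
        ∑ᶠ i : ℕ, ch m i •
          (ofVertexOperator (YW (nthMode (Y u) (l + i) v))).1 (m + n - i) w := by
  refine forall_congr' fun u => forall_congr' fun v => forall_congr' fun w =>
    forall_congr' fun l => forall_congr' fun m => forall_congr' fun n => ?_
  rw [bor_apply, nop_apply, nop_apply, smul_finsum]
  simp only [smul_smul, ← mul_assoc]
  rfl

/-- At `m = 0` the right-hand side of the Jacobi identity has a single term. -/
theorem nthMode_mode {V : Type*} [AddCommGroup V] [Module ℂ V]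
    {Y : V →ₗ[ℂ] VertexOperator ℂ V} {YW : V →ₗ[ℂ] VertexOperator ℂ W}
    (h : JacobiIdentity Y YW) (u v : V) (l : ℤ) :
    ofVertexOperator (YW (nthMode (Y u) l v)) =
      fprod l (ofVertexOperator (YW u)) (ofVertexOperator (YW v)) := Fld.ext fun n w => by
  rw [(jacobiIdentity_iff Y YW).1 h u v w l 0 n, finsum_eq_sum_range 1]
  · simp
  · intro i hi
    obtain ⟨i, rfl⟩ := Nat.exists_eq_add_of_le' hi
    rw [ch_zero_succ, zero_smul]

end vertexOperator

/-! ### The vertex algebra `L(k, 0)` and its modules -/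

section modules

open AffRep

variable {k : ℕ} {W : Type*} [AddCommGroup W] [Module ℂ W] {ρ : AffRep (k : ℂ) W}
  {hρ : ρ.Restricted}

/-- By `IsFieldMap.map_mode` the states on the right become products of fields, and the identity is
the one for local fields. -/
theorem IsFieldMap.jacobi {h₀ : (lRep k 0).Restricted} {Y₀ : L k 0 →ₗ[ℂ] Fld (L k 0)}
    (h : IsFieldMap h₀ Y₀) {Y : L k 0 →ₗ[ℂ] Fld W} (h' : IsFieldMap hρ Y) :
    JacobiIdentity (toVertexOperator ∘ₗ Y₀) (toVertexOperator ∘ₗ Y) := by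
  rw [jacobiIdentity_iff]
  intro u v w l m n
  simp only [LinearMap.comp_apply, ofVertexOperator_toVertexOperator, nthMode_toVertexOperator]
  obtain ⟨J, hJ⟩ := (fprod_mem_and_loc hρ (h'.mem_vfld (lRep_cyc k 0) v) (h'.mem_vfld (lRep_cyc k 0) u)).2
  have hK : ∀ i : ℕ, ((J : ℤ) - l).toNat ≤ i → fprod (l + i) (Y u) (Y v) = 0 := fun i hi => by
    have := hJ.1 (l + i).toNat (by omega)
    simpa only [show (((l + i).toNat : ℕ) : ℤ) = l + i by omega] using this
  simp only [IsFieldMap.map_mode h h']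
  rw [hJ.bor_eq l m n w ((J : ℤ) - l).toNat (by omega), finsum_eq_sum_range _ fun i hi => by
    rw [hK i hi, Fld.zero_apply, smul_zero]]

theorem IsFieldMap.map_gen {Y : L k 0 →ₗ[ℂ] Fld W} (h : IsFieldMap hρ Y) (a : sl2) :
    Y (gen k a) = cur hρ a := by
  have := h.map_op (-1) a (hwVec k 0)
  rwa [h.map_vac, fldRep_op, fprod_neg_one_one] at this

theorem exists_fieldMap_L (k : ℕ) :
    ∃ Y : L k 0 →ₗ[ℂ] Fld (L k 0), IsFieldMap (lRep_restricted k 0) Y := by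
  obtain ⟨Y, hY, hY'⟩ := exists_fieldMap (lRep_restricted k 0)
    ((lRep_hw k 0).E_pow_field_eq_zero _ (lRep_cyc k 0) (lRep_irr k 0) (Nat.zero_le k))
  exact ⟨Y, hY, hY'⟩

/-- The vertex algebra structure on `L(k, 0)`. -/
def IsFieldMap.vertexAlgebra {Y : L k 0 →ₗ[ℂ] Fld (L k 0)}
    (h : IsFieldMap (lRep_restricted k 0) Y) : VertexAlgebra (L k 0) where
  vac := hwVec k 0
  Y := toVertexOperator ∘ₗ Y
  vac_mode n := by
    rw [LinearMap.comp_apply, nthMode_toVertexOperator, h.map_vac]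
    rfl
  creation v n hn := by
    rw [LinearMap.comp_apply, nthMode_toVertexOperator]
    exact (h.creation (lRep_cyc k 0) (op_hwVec_zero k) v).1 n hn
  creation_limit v := by
    rw [LinearMap.comp_apply, nthMode_toVertexOperator]
    exact (h.creation (lRep_cyc k 0) (op_hwVec_zero k) v).2
  jacobi := IsFieldMap.jacobi h h

theorem IsFieldMap.isAffineVertexAlgebra {Y : L k 0 →ₗ[ℂ] Fld (L k 0)}
    (h : IsFieldMap (lRep_restricted k 0) Y) : IsAffineVertexAlgebra k (IsFieldMap.vertexAlgebra h) := by
  refine ⟨rfl, fun a n => ?_⟩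
  change nthMode (toVertexOperator (Y (gen k a))) n = _
  rw [nthMode_toVertexOperator, IsFieldMap.map_gen h]
  rfl

/-- The field maps of the modules over `L(k, 0)`. -/
theorem isFieldMap_of_module {𝒱 : VertexAlgebra (L k 0)} (h𝒱 : IsAffineVertexAlgebra k 𝒱)
    {YW : L k 0 →ₗ[ℂ] VertexOperator ℂ W}
    (hvac : ∀ n : ℤ, nthMode (YW 𝒱.vac) n = if n = -1 then 1 else 0)
    (hj : JacobiIdentity 𝒱.Y YW) (h : ∀ a m, nthMode (YW (gen k a)) m = ρ.op m a) :
    IsFieldMap hρ (ofVertexOperator ∘ₗ YW) where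
  map_vac := by
    rw [LinearMap.comp_apply, ← h𝒱.1]
    exact Fld.ext fun n w => by rw [ofVertexOperator_apply, hvac]; rfl
  map_op m a v := by
    rw [lRep_op, ← h𝒱.2, LinearMap.comp_apply, nthMode_mode hj, fldRep_op]
    congr 2
    exact Fld.ext fun n w => by rw [ofVertexOperator_apply, h]; rfl

theorem isFieldMap_of_isAffineVertexAlgebra {𝒱 : VertexAlgebra (L k 0)}
    (h𝒱 : IsAffineVertexAlgebra k 𝒱) :
    IsFieldMap (lRep_restricted k 0) (ofVertexOperator ∘ₗ 𝒱.Y) :=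
  isFieldMap_of_module h𝒱 𝒱.vac_mode 𝒱.jacobi h𝒱.2

/-- The module structure given by a field map. -/
def IsFieldMap.vertexModule {𝒱 : VertexAlgebra (L k 0)} (h𝒱 : IsAffineVertexAlgebra k 𝒱)
    {Y : L k 0 →ₗ[ℂ] Fld W} (h : IsFieldMap hρ Y) : VertexModule 𝒱 W where
  Y := toVertexOperator ∘ₗ Y
  vac_mode n := by
    rw [h𝒱.1, LinearMap.comp_apply, nthMode_toVertexOperator, h.map_vac]
    rfl
  jacobi := by
    have := IsFieldMap.jacobi (isFieldMap_of_isAffineVertexAlgebra h𝒱) h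
    rw [jacobiIdentity_iff] at this ⊢
    simpa using this

theorem IsFieldMap.vertexModule_mode {𝒱 : VertexAlgebra (L k 0)}
    (h𝒱 : IsAffineVertexAlgebra k 𝒱) {Y : L k 0 →ₗ[ℂ] Fld W} (h : IsFieldMap hρ Y) (v : L k 0)
    (n : ℤ) : nthMode ((IsFieldMap.vertexModule h𝒱 h).Y v) n = (Y v).1 n :=
  nthMode_toVertexOperator _ _

/-- Irreducible highest weight representations of weight at most the level are modules. -/
theorem exists_isFieldMap {n : ℕ} {w : W} (hρ : ρ.Restricted) (hw : ρ.HW n w)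
    (hcw : ρ.cyc w = ⊤) (hi : ρ.Irr) (hn : n ≤ k) : ∃ Y : L k 0 →ₗ[ℂ] Fld W, IsFieldMap hρ Y := by
  obtain ⟨Y, hY, hY'⟩ := exists_fieldMap hρ (hw.E_pow_field_eq_zero _ hcw hi hn)
  exact ⟨Y, hY, hY'⟩

end modules

end AffineSl2

end

noncomputable section

namespace AffineSl2

theorem sl2_induction {p : sl2 → Prop} (hE : p E) (hF : p F) (hH : p H)
    (hadd : ∀ a b, p a → p b → p (a + b)) (hsmul : ∀ (c : ℂ) a, p a → p (c • a)) (a : sl2) : p a := by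
  obtain ⟨x, y, z, rfl⟩ := sl2_eq a
  exact hadd _ _ (hadd _ _ (hsmul x _ hE) (hsmul y _ hF)) (hsmul z _ hH)

namespace AffRep

/-! ### The twist by the spectral flow -/

section twist

variable {κ : ℂ} {W : Type*} [AddCommGroup W] [Module ℂ W] (ρ : AffRep κ W)

/-- The operators of the twisted representation. -/
def twistOp (m : ℤ) : sl2 →ₗ[ℂ] Module.End ℂ W where
  toFun a := a.1 0 1 • ρ.op (m + 1) E + a.1 1 0 • ρ.op (m - 1) F +
    a.1 0 0 • (ρ.op m H + if m = 0 then κ • 1 else 0)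
  map_add' a b := by
    change (a.1 0 1 + b.1 0 1) • _ + (a.1 1 0 + b.1 1 0) • _ + (a.1 0 0 + b.1 0 0) • _ = _
    module
  map_smul' c a := by
    change (c * a.1 0 1) • _ + (c * a.1 1 0) • _ + (c * a.1 0 0) • _ = c • _
    module

theorem twistOp_E (m : ℤ) (w : W) : ρ.twistOp m E w = ρ.op (m + 1) E w := by
  simp [twistOp, E]

theorem twistOp_F (m : ℤ) (w : W) : ρ.twistOp m F w = ρ.op (m - 1) F w := by
  simp [twistOp, F]

theorem twistOp_H (m : ℤ) (w : W) :
    ρ.twistOp m H w = ρ.op m H w + (if m = 0 then κ else 0) • w := by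
  simp only [twistOp, LinearMap.coe_mk, AddHom.coe_mk, H]
  split_ifs <;> simp

/-- The twist of a representation by the spectral flow `E(m) ↦ E(m + 1)`, `F(m) ↦ F(m - 1)`. -/
def twist : AffRep κ W where
  op := ρ.twistOp
  comm m n a b w := by
    induction a using sl2_induction with
    | hadd a a' ha ha' =>
      simp only [map_add, LinearMap.add_apply, add_lie, mul_add, add_mul] at ha ha' ⊢
      rw [add_sub_add_comm, ha, ha']
      split_ifs <;> module
    | hsmul c a ha =>
      simp only [map_smul, LinearMap.smul_apply, smul_lie, smul_eq_mul] at ha ⊢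
      rw [← smul_sub, ha]
      split_ifs <;> module
    | hE =>
      induction b using sl2_induction with
      | hadd b b' hb hb' =>
        simp only [map_add, LinearMap.add_apply, lie_add, mul_add, add_mul] at hb hb' ⊢
        rw [add_sub_add_comm, hb, hb']
        split_ifs <;> module
      | hsmul c b hb =>
        simp only [map_smul, LinearMap.smul_apply, lie_smul, smul_eq_mul] at hb ⊢
        rw [← smul_sub, hb]
        split_ifs <;> module
      | hE => simp [twistOp_E, op_E_E ρ (m + 1)]
      | hF =>
        -- The bracket of `E(m + 1)` and `F(n - 1)` has central term `(m + 1)κ`. Shifting `H(0)` by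
        -- `κ` absorbs the excess over `mκ`.
        rw [lie_E_F]
        simp only [twistOp_E, twistOp_F, twistOp_H, op_E_F, form_E_F,
          show m + 1 + (n - 1) = m + n by ring, Int.cast_add, Int.cast_one]
        split_ifs <;> module
      | hH =>
        rw [lie_E_H, map_smul, LinearMap.smul_apply]
        simp only [twistOp_E, twistOp_H, op_E_H, form_E_H, map_add, map_smul,
          show m + 1 + n = m + n + 1 by ring]
        split_ifs <;> module
    | hF =>
      induction b using sl2_induction with
      | hadd b b' hb hb' =>
        simp only [map_add, LinearMap.add_apply, lie_add, mul_add, add_mul] at hb hb' ⊢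
        rw [add_sub_add_comm, hb, hb']
        split_ifs <;> module
      | hsmul c b hb =>
        simp only [map_smul, LinearMap.smul_apply, lie_smul, smul_eq_mul] at hb ⊢
        rw [← smul_sub, hb]
        split_ifs <;> module
      | hE =>
        rw [lie_F_E, map_neg, LinearMap.neg_apply]
        simp only [twistOp_E, twistOp_F, twistOp_H, op_F_E, form_F_E,
          show m - 1 + (n + 1) = m + n by ring, Int.cast_sub, Int.cast_one]
        split_ifs <;> module
      | hF => simp [twistOp_F, op_F_F ρ (m - 1)]
      | hH =>
        rw [lie_F_H, map_smul, LinearMap.smul_apply]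
        simp only [twistOp_F, twistOp_H, op_F_H, form_F_H, map_add, map_smul,
          show m - 1 + n = m + n - 1 by ring]
        split_ifs <;> module
    | hH =>
      induction b using sl2_induction with
      | hadd b b' hb hb' =>
        simp only [map_add, LinearMap.add_apply, lie_add, mul_add, add_mul] at hb hb' ⊢
        rw [add_sub_add_comm, hb, hb']
        split_ifs <;> module
      | hsmul c b hb =>
        simp only [map_smul, LinearMap.smul_apply, lie_smul, smul_eq_mul] at hb ⊢
        rw [← smul_sub, hb]
        split_ifs <;> module
      | hE =>
        rw [lie_H_E, map_smul, LinearMap.smul_apply]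
        simp only [twistOp_E, twistOp_H, op_H_E, form_H_E, map_add, map_smul,
          show m + (n + 1) = m + n + 1 by ring]
        split_ifs <;> module
      | hF =>
        rw [lie_H_F, map_smul, LinearMap.smul_apply]
        simp only [twistOp_F, twistOp_H, op_H_F, form_H_F, map_add, map_smul,
          show m + (n - 1) = m + n - 1 by ring]
        split_ifs <;> module
      | hH =>
        simp only [twistOp_H, map_add, map_smul, op_op ρ m n H H, lie_self, map_zero,
          LinearMap.zero_apply]
        split_ifs <;> module

@[simp] theorem twist_op_E (m : ℤ) (w : W) : ρ.twist.op m E w = ρ.op (m + 1) E w :=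
  ρ.twistOp_E m w

@[simp] theorem twist_op_F (m : ℤ) (w : W) : ρ.twist.op m F w = ρ.op (m - 1) F w :=
  ρ.twistOp_F m w

theorem twist_op_H (m : ℤ) (w : W) :
    ρ.twist.op m H w = ρ.op m H w + (if m = 0 then κ else 0) • w := ρ.twistOp_H m w

variable {ρ}

theorem Inv.of_twist {N : Submodule ℂ W} (hN : ρ.twist.Inv N) : ρ.Inv N := by
  refine fun m a => maps_of_basis (fun x hx => ?_) (fun x hx => ?_) (fun x hx => ?_) a
  · simpa using hN (m - 1) E x hx
  · simpa using hN (m + 1) F x hx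
  · have := hN m H x hx
    rw [twist_op_H] at this
    exact (Submodule.add_mem_iff_left N (N.smul_mem _ hx)).1 this

theorem Irr.twist (hi : ρ.Irr) : ρ.twist.Irr := fun N hN => hi N hN.of_twist

theorem Restricted.twist (hρ : ρ.Restricted) : ρ.twist.Restricted := by
  intro a w
  obtain ⟨K, hK⟩ := hρ.exists_bound w
  refine ⟨K + 1, fun m hm => ?_⟩
  obtain ⟨x, y, z, rfl⟩ := sl2_eq a
  simp only [map_add, map_smul, LinearMap.add_apply, LinearMap.smul_apply, twist_op_E, twist_op_F,
    twist_op_H, hK E (m + 1) (by omega), hK F (m - 1) (by omega), hK H m (by omega),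
    if_neg (show m ≠ 0 by omega), smul_zero, zero_smul, add_zero]

/-- The raising generators of the twist are the old `E(1)` and `F(0)`. Both kill the lowest vector
`F(0)^n w` of the top component, whose weight `-n` is shifted by `κ`. -/
theorem HW.twist {n : ℕ} {w : W} (h : ρ.HW n w) (hi : ρ.Irr) (hκ : κ + 2 ≠ 0) :
    ρ.twist.HW (κ - n) ((ρ.op 0 F ^ n) w) := by
  refine HW.of_chevalley ?_ ?_ ?_
  · rw [twist_op_E]
    exact h.F_pow_pos n _ E (by omega)
  · rw [twist_op_F, sub_self, ← Module.End.mul_apply, ← pow_succ']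
    exact h.F_pow_eq_zero hi hκ (Nat.lt_succ_self n)
  · rw [twist_op_H, (h.sl2_pow n).1, if_pos rfl]
    module

theorem HW.F_pow_ne_zero {n : ℕ} {w : W} (h : ρ.HW n w) (hw : w ≠ 0) : (ρ.op 0 F ^ n) w ≠ 0 :=
  sl2_pow_ne_zero (e := ρ.op 0 E) (f := ρ.op 0 F) (h := ρ.op 0 H) (fun x => by simp [op_E_F])
    (fun x => by simp [op_H_F]) h.E_zero h.H_zero rfl hw

end twist

end AffRep

open AffRep

section vertexModule

variable {k : ℕ} {W W' : Type*} [AddCommGroup W] [Module ℂ W] [AddCommGroup W'] [Module ℂ W']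
  {ρ : AffRep (k : ℂ) W} {hρ : ρ.Restricted} {ρ' : AffRep (k : ℂ) W'} {hρ' : ρ'.Restricted}
  {𝒱 : VertexAlgebra (L k 0)} {Y : L k 0 →ₗ[ℂ] Fld W}

theorem IsFieldMap.isomorphic (h𝒱 : IsAffineVertexAlgebra k 𝒱) (h : IsFieldMap hρ Y)
    {M' : VertexModule 𝒱 W'} (h' : IsFieldMap hρ' (ofVertexOperator ∘ₗ M'.Y)) (f : W' ≃ₗ[ℂ] W)
    (hf : Equivariant ρ' ρ (f : W' →ₗ[ℂ] W)) : (IsFieldMap.vertexModule h𝒱 h).Isomorphic M' := by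
  refine ⟨f.symm, fun v m w => ?_⟩
  obtain ⟨w, rfl⟩ := f.surjective w
  rw [LinearEquiv.symm_apply_apply, LinearEquiv.symm_apply_eq, IsFieldMap.vertexModule_mode]
  exact (h'.intertwines (lRep_cyc k 0) h hf v m w).symm

theorem IsFieldMap.isHighestWeightVector (h𝒱 : IsAffineVertexAlgebra k 𝒱) (h : IsFieldMap hρ Y)
    {μ : ℂ} {w : W} (hw : ρ.HW μ w) (hw0 : w ≠ 0) :
    (IsFieldMap.vertexModule h𝒱 h).IsHighestWeightVector k μ w := by
  refine ⟨ρ.toLie, fun a m => ?_, hw.isHighestWeightVector hw0⟩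
  rw [toLie_loop, IsFieldMap.vertexModule_mode, IsFieldMap.map_gen h]
  rfl

end vertexModule

/-! ### The twist of `L(k, n)` as an irreducible highest weight representation. -/

section twistL

variable {k n : ℕ}

theorem lRep_twist_hw (hn : n ≤ k) :
    (lRep k n).twist.HW ((k - n : ℕ) : ℂ) (((lRep k n).op 0 F ^ n) (hwVec k n)) :=
  Nat.cast_sub (R := ℂ) hn ▸ (lRep_hw k n).twist (lRep_irr k n) (level_add_two_ne_zero k)

theorem lRep_F_pow_ne_zero (h : hwVec k n ≠ 0) : ((lRep k n).op 0 F ^ n) (hwVec k n) ≠ 0 :=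
  (lRep_hw k n).F_pow_ne_zero h

theorem lRep_twist_cyc (k n : ℕ) :
    (lRep k n).twist.cyc (((lRep k n).op 0 F ^ n) (hwVec k n)) = ⊤ := by
  by_cases h : hwVec k n = 0
  · refine eq_top_iff.2 fun x _ => ?_
    rw [eq_zero_of_hwVec_eq_zero h x]
    exact zero_mem _
  · exact (lRep_irr k n).twist.cyc_eq_top (lRep_F_pow_ne_zero h)

theorem exists_isFieldMap_twist (hn : n ≤ k) :
    ∃ Y : L k 0 →ₗ[ℂ] Fld (L k n), IsFieldMap (lRep_restricted k n).twist Y :=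
  exists_isFieldMap _ (lRep_twist_hw hn) (lRep_twist_cyc k n) (lRep_irr k n).twist (Nat.sub_le k n)

theorem hwVec_sub_ne_zero (hn : n ≤ k) (h : hwVec k n ≠ 0) : hwVec k (k - n) ≠ 0 :=
  hwVec_ne_zero (lRep_twist_hw hn) (lRep_F_pow_ne_zero h)

/-- The twist of `L(k, n)` is `L(k, k - n)`. -/
theorem exists_equiv_twist (hn : n ≤ k) : ∃ f : L k (k - n) ≃ₗ[ℂ] L k n,
    Equivariant (lRep k (k - n)) (lRep k n).twist (f : L k (k - n) →ₗ[ℂ] L k n) := by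
  by_cases h : hwVec k n = 0
  -- If `L(k, k - n)` were nonzero, its twist would provide a nonzero highest weight vector of
  -- weight `k - (k - n) = n`. So both spaces vanish together.
  · have h' : hwVec k (k - n) = 0 := by
      by_contra h'
      refine hwVec_sub_ne_zero (Nat.sub_le k n) h' ?_
      rwa [Nat.sub_sub_self hn]
    refine ⟨⟨0, 0, fun x => (eq_zero_of_hwVec_eq_zero h' x).symm,
      fun x => (eq_zero_of_hwVec_eq_zero h x).symm⟩, fun m a x => ?_⟩
    rw [eq_zero_of_hwVec_eq_zero h' x, map_zero, map_zero, map_zero]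
  · obtain ⟨f, -, hf⟩ := exists_equiv_L (lRep_twist_hw hn) (lRep_irr k n).twist
      (lRep_F_pow_ne_zero h)
    exact ⟨f, hf⟩

/-- The level and weight of `v` are arbitrary in the hypothesis; uniqueness of the highest weight in
an irreducible representation forces `μ = n`. -/
theorem lRep_hw_of_isHighestWeightVector {𝒱 : VertexAlgebra (L k 0)} {M : VertexModule 𝒱 (L k n)}
    (hM : IsAffineVertexModule M) {κ μ : ℂ} {v : L k n} (hv : M.IsHighestWeightVector κ μ v) :
    v ≠ 0 ∧ (lRep k n).HW n v := by
  obtain ⟨τ, hτ, hv⟩ := hv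
  have hτ' (m : ℤ) (a : sl2) (w : L k n) : (lRep k n).op m a w = τ (loop a m) w := by
    rw [hτ, hM, lRep_op]
  have hvw : (lRep k n).HW μ v :=
    { E_zero := (hτ' _ _ _).trans (hv.annihilated _ (Or.inl rfl))
      pos := fun m a hm => (hτ' _ _ _).trans (hv.annihilated _ (Or.inr ⟨a, m, hm, rfl⟩))
      H_zero := (hτ' _ _ _).trans hv.weight }
  have h0 : hwVec k n ≠ 0 := fun h0 => hv.ne_zero (eq_zero_of_hwVec_eq_zero h0 v)
  refine ⟨hv.ne_zero, ?_⟩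
  rwa [(lRep_hw k n).weight_unique hvw (lRep_irr k n) (level_add_two_ne_zero k) h0 hv.ne_zero]
    at hvw

end twistL

end AffineSl2

end

/-! ### Exponentials of operator-valued series, and conjugation by the exponential factor of `Δ`. -/

noncomputable section

namespace AffineSl2

open Finset.HasAntidiagonal (antidiagonal mem_antidiagonal)

section exponential

variable {V : Type*} [AddCommGroup V] [Module ℂ V]

local notation "𝓔" => PowerSeries (Module.End ℂ V)

/-- The operator `z d/dz`. -/
def theta (B : 𝓔) : 𝓔 := PowerSeries.mk fun n => (n : ℂ) • PowerSeries.coeff n B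

theorem coeff_theta (B : 𝓔) (n : ℕ) :
    PowerSeries.coeff n (theta B) = (n : ℂ) • PowerSeries.coeff n B := PowerSeries.coeff_mk _ _

theorem theta_mul (B C : 𝓔) : theta (B * C) = theta B * C + B * theta C := by
  ext1 n
  rw [coeff_theta, map_add, PowerSeries.coeff_mul, PowerSeries.coeff_mul, PowerSeries.coeff_mul,
    Finset.smul_sum, ← Finset.sum_add_distrib]
  refine Finset.sum_congr rfl fun p hp => ?_
  rw [← mem_antidiagonal.1 hp, coeff_theta, coeff_theta, smul_mul_assoc, mul_smul_comm,
    ← add_smul, Nat.cast_add]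

theorem theta_one : theta (1 : 𝓔) = 0 := by
  ext1 n
  rw [coeff_theta, PowerSeries.coeff_one]
  split_ifs with h <;> simp [h]

theorem theta_C (a : Module.End ℂ V) : theta (PowerSeries.C a : 𝓔) = 0 := by
  ext1 n
  rw [coeff_theta, PowerSeries.coeff_C]
  split_ifs with h <;> simp [h]

theorem theta_pow {A : 𝓔} (h : Commute A (theta A)) (j : ℕ) :
    theta (A ^ (j + 1)) = ((j : ℂ) + 1) • (theta A * A ^ j) := by
  induction j with
  | zero => simp
  | succ j ih =>
    rw [pow_succ' A (j + 1), theta_mul, ih, mul_smul_comm, ← mul_assoc, h.eq, mul_assoc,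
      ← pow_succ']
    push_cast
    module

theorem coeff_pow_eq_zero {A : 𝓔} (h : PowerSeries.coeff 0 A = 0) {b j : ℕ} (hb : b < j) :
    PowerSeries.coeff b (A ^ j) = 0 := by
  induction j generalizing b with
  | zero => omega
  | succ j ih =>
    rw [pow_succ', PowerSeries.coeff_mul]
    refine Finset.sum_eq_zero fun p hp => ?_
    have := mem_antidiagonal.1 hp
    by_cases h0 : p.1 = 0
    · rw [h0, h, zero_mul]
    · rw [ih (by omega), mul_zero]

/-- The exponential of a series without constant term. -/
def expSeries (A : 𝓔) : 𝓔 := PowerSeries.mk (expCoeff A)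

@[simp] theorem coeff_expSeries (A : 𝓔) (p : ℕ) :
    PowerSeries.coeff p (expSeries A) = expCoeff A p := PowerSeries.coeff_mk _ _

theorem expCoeff_zero (A : 𝓔) : expCoeff A 0 = 1 := by
  simp [expCoeff]

/-- The usual derivative of an exponential, as `A` commutes with its derivative. Truncation of the
exponential sums is harmless because `A` has no constant term. -/
theorem theta_expSeries {A : 𝓔} (h0 : PowerSeries.coeff 0 A = 0) (h : Commute A (theta A)) :
    theta (expSeries A) = theta A * expSeries A := by
  ext1 p
  have h1 : ∀ j : ℕ, (p : ℂ) • ((j.factorial : ℂ)⁻¹ • PowerSeries.coeff p (A ^ j)) =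
      (j.factorial : ℂ)⁻¹ • PowerSeries.coeff p (theta (A ^ j)) := fun j => by
    rw [coeff_theta, smul_comm]
  have h2 : ∀ j : ℕ, ((j + 1).factorial : ℂ)⁻¹ • PowerSeries.coeff p (theta (A ^ (j + 1))) =
      (j.factorial : ℂ)⁻¹ • PowerSeries.coeff p (theta A * A ^ j) := fun j => by
    have : (j : ℂ) + 1 ≠ 0 := by exact_mod_cast Nat.succ_ne_zero j
    rw [theta_pow h, Nat.factorial_succ]
    change _ • ((j : ℂ) + 1) • PowerSeries.coeff p (theta A * A ^ j) = _
    rw [smul_smul]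
    congr 1
    push_cast
    field_simp
  rw [coeff_theta, coeff_expSeries, expCoeff, Finset.smul_sum, Finset.sum_congr rfl fun j _ => h1 j,
    Finset.sum_range_succ', pow_zero, theta_one, map_zero, smul_zero, add_zero,
    Finset.sum_congr rfl fun j _ => h2 j]
  simp only [PowerSeries.coeff_mul, Finset.smul_sum]
  rw [Finset.sum_comm]
  refine Finset.sum_congr rfl fun q hq => ?_
  have hq' := mem_antidiagonal.1 hq
  by_cases hq0 : q.1 = 0
  · simp [hq0, coeff_theta]
  · rw [coeff_expSeries, expCoeff, Finset.mul_sum]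
    symm
    refine (Finset.sum_subset (s₂ := Finset.range p) ?_ fun j _ hj => ?_).trans ?_
    · exact Finset.range_subset_range.2 (by omega)
    · rw [coeff_pow_eq_zero h0 (by rw [Finset.mem_range] at hj; omega), smul_zero, mul_zero]
    · exact Finset.sum_congr rfl fun j _ => mul_smul_comm _ _ _

/-- As `B` has no constant term, the equation determines `n` times the `n`-th coefficient from the
earlier ones. -/
theorem eq_of_theta_eq {B Y Z : 𝓔} (hB : PowerSeries.coeff 0 B = 0) (hY : theta Y = B * Y)
    (hZ : theta Z = B * Z) (h : PowerSeries.coeff 0 Y = PowerSeries.coeff 0 Z) : Y = Z := by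
  ext1 n
  induction n using Nat.strong_induction_on with
  | _ n ih =>
    by_cases hn : n = 0
    · rw [hn, h]
    · have key : (n : ℂ) • PowerSeries.coeff n Y = (n : ℂ) • PowerSeries.coeff n Z := by
        rw [← coeff_theta, ← coeff_theta, hY, hZ, PowerSeries.coeff_mul, PowerSeries.coeff_mul]
        refine Finset.sum_congr rfl fun p hp => ?_
        have hp' := mem_antidiagonal.1 hp
        by_cases hp0 : p.1 = 0
        · rw [hp0, hB, zero_mul, zero_mul]
        · rw [ih p.2 (by omega)]
      exact (smul_right_injective _ (Nat.cast_ne_zero.2 hn : (n : ℂ) ≠ 0)) key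

/-- Conjugation by an exponential, as the solution of a differential equation. -/
theorem expSeries_mul_C {A G : 𝓔} (h0 : PowerSeries.coeff 0 A = 0) (h : Commute A (theta A))
    (hG : theta A * G - G * theta A = theta G) :
    expSeries A * PowerSeries.C (PowerSeries.coeff 0 G) = G * expSeries A := by
  refine eq_of_theta_eq (B := theta A) (by simp [coeff_theta]) ?_ ?_ ?_
  · rw [theta_mul, theta_expSeries h0 h, theta_C, mul_zero, add_zero, mul_assoc]
  · rw [theta_mul, theta_expSeries h0 h, ← hG]
    noncomm_ring
  · simp [PowerSeries.coeff_mul, expCoeff_zero]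

theorem coeff_commutator (B G : 𝓔) (n : ℕ) : PowerSeries.coeff n (B * G - G * B) =
    ∑ p ∈ antidiagonal n, (PowerSeries.coeff p.1 B * PowerSeries.coeff p.2 G -
      PowerSeries.coeff p.2 G * PowerSeries.coeff p.1 B) := by
  rw [map_sub, PowerSeries.coeff_mul, PowerSeries.coeff_mul, Finset.sum_sub_distrib,
    ← Finset.Nat.sum_antidiagonal_swap (f := fun p : ℕ × ℕ =>
      PowerSeries.coeff p.1 G * PowerSeries.coeff p.2 B)]
  rfl

theorem commute_theta {A : 𝓔}
    (h : ∀ a b, Commute (PowerSeries.coeff a A) (PowerSeries.coeff b A)) : Commute A (theta A) := by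
  refine sub_eq_zero.1 ?_
  ext1 n
  rw [coeff_commutator, map_zero]
  refine Finset.sum_eq_zero fun p _ => ?_
  rw [coeff_theta, mul_smul_comm, smul_mul_assoc, (h p.1 p.2).eq, sub_self]

end exponential

namespace AffRep

/-! ### Li's operators on a representation -/

section delta

variable {κ : ℂ} {V : Type*} [AddCommGroup V] [Module ℂ V] (σ : AffRep κ V)

theorem coweight_E (m n : ℤ) (x : V) : σ.op m coweight (σ.op n E x) =
    σ.op n E (σ.op m coweight x) + σ.op (m + n) E x := by
  simp only [coweight, map_smul, LinearMap.smul_apply, op_H_E]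
  module

theorem coweight_F (m n : ℤ) (x : V) : σ.op m coweight (σ.op n F x) =
    σ.op n F (σ.op m coweight x) - σ.op (m + n) F x := by
  simp only [coweight, map_smul, LinearMap.smul_apply, op_H_F]
  module

theorem coweight_coweight {m n : ℤ} (h : m + n ≠ 0 ∨ m = 0) (x : V) :
    σ.op m coweight (σ.op n coweight x) = σ.op n coweight (σ.op m coweight x) := by
  rw [op_op, lie_self, map_zero, LinearMap.zero_apply, zero_add]
  rcases h with h | h
  · rw [if_neg h, zero_smul, add_zero]
  · simp [h]

/-- The exponent of Li's operator. -/
def deltaExp : PowerSeries (Module.End ℂ V) :=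
  PowerSeries.mk fun n => if n = 0 then 0 else ((-1 : ℂ) ^ n / (-(n : ℂ))) • σ.op n coweight

theorem coeff_zero_deltaExp : PowerSeries.coeff 0 σ.deltaExp = 0 := by
  rw [deltaExp, PowerSeries.coeff_mk, if_pos rfl]

theorem coeff_theta_deltaExp (n : ℕ) : PowerSeries.coeff n (theta σ.deltaExp) =
    if n = 0 then 0 else (-(-1 : ℂ) ^ n) • σ.op n coweight := by
  rw [coeff_theta, deltaExp, PowerSeries.coeff_mk]
  split_ifs with h
  · rw [smul_zero]
  · have : (n : ℂ) ≠ 0 := Nat.cast_ne_zero.2 h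
    rw [smul_smul]
    congr 1
    field_simp

theorem commute_deltaExp : Commute σ.deltaExp (theta σ.deltaExp) := by
  refine commute_theta fun a b => ?_
  simp only [deltaExp, PowerSeries.coeff_mk]
  split_ifs with ha hb hb
  · exact Commute.zero_left _
  · exact Commute.zero_left _
  · exact Commute.zero_right _
  · refine Commute.smul_left (Commute.smul_right ?_ _) _
    exact LinearMap.ext fun x => σ.coweight_coweight (Or.inl (by omega)) x

/-- The coefficients of the exponential factor of Li's operator. -/
def deltaPart (p : ℕ) : Module.End ℂ V := expCoeff σ.deltaExp p

@[simp] theorem deltaPart_zero : σ.deltaPart 0 = 1 := expCoeff_zero _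

/-- A solution `G` of this differential equation is the conjugate of its constant term by the
exponential. The commutation rules below come from guessing `G`. -/
theorem deltaPart_mul {G : PowerSeries (Module.End ℂ V)}
    (hG : theta σ.deltaExp * G - G * theta σ.deltaExp = theta G) (p : ℕ) :
    σ.deltaPart p * PowerSeries.coeff 0 G =
      ∑ q ∈ antidiagonal p, PowerSeries.coeff q.1 G * σ.deltaPart q.2 := by
  have := congrArg (PowerSeries.coeff p)
    (expSeries_mul_C σ.coeff_zero_deltaExp σ.commute_deltaExp hG)
  rw [PowerSeries.coeff_mul_C, coeff_expSeries, PowerSeries.coeff_mul] at this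
  exact this.trans (Finset.sum_congr rfl fun q _ => by rw [coeff_expSeries]; rfl)

/-- Conjugation multiplies `F ⊗ t^m` by `(1 + zt)⁻¹`, since `coweight` has eigenvalue `-1` on `F`;
hence the geometric series for `G`. -/
theorem deltaPart_F (m : ℤ) (p : ℕ) (x : V) : σ.deltaPart p (σ.op m F x) =
    ∑ q ∈ antidiagonal p, (-1 : ℂ) ^ q.1 • σ.op (m + q.1) F (σ.deltaPart q.2 x) := by
  have := σ.deltaPart_mul (G := PowerSeries.mk fun n => (-1 : ℂ) ^ n • σ.op (m + n) F) ?_ p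
  · simpa using LinearMap.congr_fun this x
  ext1 n
  rw [coeff_commutator]
  simp only [coeff_theta_deltaExp, PowerSeries.coeff_mk, coeff_theta (PowerSeries.mk _)]
  have key : ∀ q ∈ antidiagonal n,
      ((if q.1 = 0 then 0 else (-(-1 : ℂ) ^ q.1) • σ.op q.1 coweight) *
        ((-1 : ℂ) ^ q.2 • σ.op (m + q.2) F) -
      ((-1 : ℂ) ^ q.2 • σ.op (m + q.2) F) *
        (if q.1 = 0 then 0 else (-(-1 : ℂ) ^ q.1) • σ.op q.1 coweight) : Module.End ℂ V) =
      if q.1 = 0 then 0 else (-1 : ℂ) ^ n • σ.op (m + n) F := by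
    intro q hq
    rw [← mem_antidiagonal.1 hq]
    split_ifs with h
    · rw [zero_mul, mul_zero, sub_zero]
    · ext x
      simp only [LinearMap.sub_apply, Module.End.mul_apply, LinearMap.smul_apply, map_smul,
        coweight_F, show (q.1 : ℤ) + (m + q.2) = m + ((q.1 + q.2 : ℕ) : ℤ) by push_cast; ring,
        pow_add]
      module
  rw [Finset.sum_congr rfl key]
  cases n with
  | zero => simp
  | succ n =>
    rw [Finset.Nat.sum_antidiagonal_succ]
    simp [← Nat.cast_smul_eq_nsmul ℂ]

/-- Conjugation multiplies `E ⊗ t^m` by `1 + zt`, so `G` has only two coefficients. -/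
theorem deltaPart_E (m : ℤ) (p : ℕ) (x : V) : σ.deltaPart (p + 1) (σ.op m E x) =
    σ.op m E (σ.deltaPart (p + 1) x) + σ.op (m + 1) E (σ.deltaPart p x) := by
  have := σ.deltaPart_mul (G := PowerSeries.mk fun n =>
    if n = 0 then σ.op m E else if n = 1 then σ.op (m + 1) E else 0) ?_ (p + 1)
  · rw [Finset.Nat.sum_antidiagonal_succ] at this
    simp only [PowerSeries.coeff_mk, if_true, Nat.succ_ne_zero, if_false] at this
    have h := LinearMap.congr_fun this x
    rw [Module.End.mul_apply] at h
    rw [h, LinearMap.add_apply, Module.End.mul_apply]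
    congr 1
    cases p with
    | zero => simp
    | succ p =>
      rw [Finset.Nat.sum_antidiagonal_succ]
      simp
  ext1 n
  rw [coeff_commutator]
  simp only [coeff_theta_deltaExp, PowerSeries.coeff_mk, coeff_theta (PowerSeries.mk _)]
  match n with
  | 0 => simp
  | 1 =>
    rw [Finset.Nat.sum_antidiagonal_succ]
    ext x
    have h1 : (((0 + 1 : ℕ) : ℤ) + m) = m + 1 := by push_cast; ring
    simp only [Finset.Nat.antidiagonal_zero, Finset.sum_singleton, if_true, LinearMap.sub_apply,
      Module.End.mul_apply, LinearMap.smul_apply, map_smul, coweight_E, h1,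
      if_neg (Nat.succ_ne_zero _), zero_mul, mul_zero, sub_zero, one_ne_zero, if_false,
      zero_add]
    norm_num
  | n + 2 =>
    rw [Finset.Nat.sum_antidiagonal_succ', Finset.Nat.sum_antidiagonal_succ', Finset.sum_eq_zero
      fun q _ => by
        rw [if_neg (Nat.succ_ne_zero (q.2 + 1)), if_neg (show q.2 + 1 + 1 ≠ 1 by omega), mul_zero,
          zero_mul, sub_zero]]
    ext x
    have h1 : (((n + 2 : ℕ) : ℤ) + m) = ((n + 1 : ℕ) : ℤ) + (m + 1) := by push_cast; ring
    simp only [if_true, if_neg (Nat.succ_ne_zero _), zero_add, LinearMap.add_apply,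
      LinearMap.sub_apply, Module.End.mul_apply, LinearMap.smul_apply, map_smul, coweight_E, h1,
      one_ne_zero, if_false, add_zero]
    rw [pow_succ (-1 : ℂ) (n + 1), if_neg (show n + 2 ≠ 1 by omega), LinearMap.zero_apply,
      smul_zero]
    module

theorem deltaPart_H (p : ℕ) (x : V) :
    σ.op 0 coweight (σ.deltaPart p x) = σ.deltaPart p (σ.op 0 coweight x) := by
  have := σ.deltaPart_mul (G := PowerSeries.C (σ.op 0 coweight)) ?_ p
  · rw [PowerSeries.coeff_zero_C] at this
    have h := LinearMap.congr_fun this x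
    rw [Module.End.mul_apply] at h
    rw [h]
    cases p with
    | zero => simp
    | succ p =>
      rw [Finset.Nat.sum_antidiagonal_succ]
      simp [PowerSeries.coeff_C]
  rw [theta_C]
  ext1 n
  rw [coeff_commutator, map_zero]
  refine Finset.sum_eq_zero fun q _ => ?_
  rw [coeff_theta_deltaExp, PowerSeries.coeff_C]
  split_ifs
  · simp
  · simp
  · refine sub_eq_zero.2 ?_
    rw [smul_mul_assoc, mul_smul_comm]
    congr 1
    exact LinearMap.ext fun x => (σ.coweight_coweight (Or.inr rfl) x).symm
  · simp

/-- The differential equation of the exponential writes each coefficient on `v` through positive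
modes of `coweight` applied to earlier coefficients. -/
theorem deltaPart_eq_zero {v : V} (h : ∀ m : ℤ, 0 < m → σ.op m coweight v = 0) (p : ℕ) :
    σ.deltaPart (p + 1) v = 0 := by
  induction p using Nat.strong_induction_on with
  | _ p ih =>
    have h1 := LinearMap.congr_fun (congrArg (PowerSeries.coeff (p + 1))
      (theta_expSeries σ.coeff_zero_deltaExp σ.commute_deltaExp)) v
    rw [coeff_theta, coeff_expSeries, PowerSeries.coeff_mul, LinearMap.smul_apply,
      LinearMap.sum_apply, Finset.sum_eq_zero] at h1
    · exact (smul_eq_zero.1 h1).resolve_left (Nat.cast_ne_zero.2 (Nat.succ_ne_zero p))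
    · intro q hq
      have hq' := mem_antidiagonal.1 hq
      rw [Module.End.mul_apply, coeff_expSeries, coeff_theta_deltaExp]
      split_ifs with h0
      · rfl
      · change (-(-1 : ℂ) ^ q.1) • σ.op q.1 coweight (σ.deltaPart q.2 v) = 0
        cases hq2 : q.2 with
        | zero => rw [deltaPart_zero, Module.End.one_apply, h _ (by omega), smul_zero]
        | succ j => rw [ih j (by omega), map_zero, smul_zero]

end delta

end AffRep

end AffineSl2

end

/-! ### Li's formula for the field map of the twisted representation. -/

noncomputable section

namespace AffineSl2

open Finset.HasAntidiagonal (antidiagonal mem_antidiagonal)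

theorem sum_range_antidiagonal {M : Type*} [AddCommMonoid M] {I J : ℕ} (g : ℕ → ℕ → M)
    (hI : ∀ i j, I ≤ i → g i j = 0) (hJ : ∀ i j, J ≤ j → g i j = 0) :
    ∑ s ∈ Finset.range (I + J), ∑ q ∈ antidiagonal s, g q.1 q.2 =
      ∑ j ∈ Finset.range J, ∑ i ∈ Finset.range I, g i j := by
  rw [Finset.sum_comm, ← Finset.sum_product (Finset.range I) (Finset.range J) fun q => g q.1 q.2, ← Finset.sum_fiberwise_of_maps_to
    (s := Finset.range I ×ˢ Finset.range J) (t := Finset.range (I + J)) (g := fun q => q.1 + q.2) fun q hq => by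
      simp only [Finset.mem_product, Finset.mem_range] at hq ⊢
      omega]
  refine Finset.sum_congr rfl fun s _ => (Finset.sum_subset (fun q hq => ?_) fun q hq hq' => ?_).symm
  · exact mem_antidiagonal.2 (Finset.mem_filter.1 hq).2
  · simp only [Finset.mem_filter, Finset.mem_product, Finset.mem_range, not_and] at hq'
    by_cases h1 : I ≤ q.1
    · exact hI _ _ h1
    · refine hJ _ _ (not_lt.1 fun h2 => hq' ⟨not_le.1 h1, h2⟩ (mem_antidiagonal.1 hq))

section shift

variable {W : Type*} [AddCommGroup W] [Module ℂ W]

/-- Multiplication of a field by `x^(-s)`. -/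
def shift (s : ℤ) : Fld W →ₗ[ℂ] Fld W where
  toFun f := ⟨fun n => f.1 (n + s), fun w => by
    obtain ⟨N, hN⟩ := f.2 w
    exact ⟨N - s, fun n hn => hN _ (by omega)⟩⟩
  map_add' _ _ := rfl
  map_smul' _ _ := rfl

@[simp] theorem shift_apply (s : ℤ) (f : Fld W) (n : ℤ) : (shift s f).1 n = f.1 (n + s) := rfl

theorem shift_zero (f : Fld W) : shift 0 f = f :=
  Fld.ext fun n w => by rw [shift_apply, add_zero]

theorem shift_shift (s t : ℤ) (f : Fld W) : shift s (shift t f) = shift (s + t) f :=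
  Fld.ext fun n w => by rw [shift_apply, shift_apply, shift_apply, add_assoc]

theorem bor_shift (l p s t : ℤ) (a f : Fld W) :
    bor l p (shift s a) (shift t f) = shift t (bor l (p + s) a f) := Fld.ext fun n w => by
  simp only [shift_apply, bor_apply, nop_apply, show ∀ i : ℕ, p + l - i + s = p + s + l - i by
    intro i; ring, show ∀ i : ℕ, n + i + t = n + t + i by intro i; ring,
    show ∀ i : ℕ, n + l - i + t = n + t + l - i by intro i; ring,
    show ∀ i : ℕ, p + i + s = p + s + i by intro i; ring]

/-- Multiplication by powers of `x` of the coefficients of a bracket. -/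
theorem HasComm.bor_eq_sum_shift {a f : Fld W} {J : ℕ}
    (h : HasComm a f J fun j => fprod j a f) (l p : ℤ) {K : ℕ} (hK : J ≤ l + K) :
    bor l p a f = ∑ i ∈ Finset.range K, ch p i • shift (p - i) (fprod (l + i) a f) :=
  Fld.ext fun n w => by
    rw [h.bor_eq l p n w K hK, Fld.sum_apply]
    refine Finset.sum_congr rfl fun i _ => ?_
    rw [Fld.smul_apply, shift_apply, show p + n - i = n + (p - i) by ring]

/-- The `n`-th mode, as an additive map. -/
def modeHom (n : ℤ) : Fld W →+ Module.End ℂ W where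
  toFun f := f.1 n
  map_zero' := rfl
  map_add' _ _ := rfl

end shift

namespace AffRep

section twistedField

variable {κ : ℂ} {V W : Type*} [AddCommGroup V] [Module ℂ V] [AddCommGroup W] [Module ℂ W]
  {σ : AffRep κ V} {v₀ : V} {ρ : AffRep κ W} {hρ : ρ.Restricted} {Y Y' : V →ₗ[ℂ] Fld W}

theorem cur_twist_E (hρ : ρ.Restricted) : cur hρ.twist E = shift 1 (cur hρ E) :=
  Fld.ext fun n w => ρ.twist_op_E n w

theorem cur_twist_F (hρ : ρ.Restricted) : cur hρ.twist F = shift (-1) (cur hρ F) :=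
  Fld.ext fun n w => ρ.twist_op_F n w

/-- Stated for all large `K` so that one `K` can serve finitely many vectors. -/
theorem IsStateField.eventually_bor_eq (hc : σ.cyc v₀ = ⊤) (h : IsStateField σ v₀ hρ Y) (a : sl2)
    (v : V) (l p : ℤ) : ∀ᶠ K : ℕ in Filter.atTop, bor l p (cur hρ a) (Y v) =
      ∑ i ∈ Finset.range K, ch p i • shift (p - i) (Y (σ.op (l + i) a v)) := by
  obtain ⟨J, hJ⟩ := loc_cur hρ (h.mem_vfld hc v) a
  filter_upwards [Filter.eventually_ge_atTop (J - l).toNat] with K hK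
  rw [hJ.bor_eq_sum_shift l p (K := K) (by omega)]
  exact Finset.sum_congr rfl fun i _ => by rw [h.map_op, fldRep_op]

theorem ch_neg_one (i : ℕ) : ch (-1) i = (-1) ^ i := by
  have h := neg_one_pow_mul_ch (-1) i
  rw [show (i : ℤ) - 1 - -1 = i by ring, ch_natCast, Nat.choose_self] at h
  rw [Nat.cast_one] at h
  have h2 : (-1 : ℂ) ^ i * (-1) ^ i = 1 := by rw [← mul_pow]; simp
  linear_combination (-1 : ℂ) ^ i * h - ch (-1) i * h2

variable (σ) in
/-- The field of `v` for `Y'` is `Y(Δ(x) v, x)`, for an eigenvector `v` of the coweight. -/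
def TwistedField (Y Y' : V →ₗ[ℂ] Fld W) (r : ℤ) (v : V) : Prop :=
  σ.op 0 coweight v = (r : ℂ) • v ∧ ∃ P : ℕ, (∀ p, P ≤ p → σ.deltaPart p v = 0) ∧
    Y' v = ∑ p ∈ Finset.range P, shift (r - p) (Y (σ.deltaPart p v))

theorem TwistedField.vac (h0 : ∀ (m : ℤ) (a : sl2), 0 ≤ m → σ.op m a v₀ = 0)
    (h : IsStateField σ v₀ hρ Y) (h' : IsStateField σ v₀ hρ.twist Y') :
    TwistedField σ Y Y' 0 v₀ := by
  refine ⟨by rw [h0 _ _ le_rfl, Int.cast_zero, zero_smul], 1, fun p hp => ?_, ?_⟩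
  · obtain ⟨p, rfl⟩ := Nat.exists_eq_add_of_le' hp
    exact σ.deltaPart_eq_zero (fun m hm => h0 m _ hm.le) p
  · rw [Finset.sum_range_one, deltaPart_zero, Module.End.one_apply, h.map_vac, h'.map_vac,
      Nat.cast_zero, sub_zero, shift_zero]

theorem TwistedField.E_neg_one (h : IsStateField σ v₀ hρ Y) (h' : IsStateField σ v₀ hρ.twist Y')
    {r : ℤ} {v : V} (hv : TwistedField σ Y Y' r v) :
    TwistedField σ Y Y' (r + 1) (σ.op (-1) E v) := by
  obtain ⟨hr, P, hP, hY⟩ := hv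
  refine ⟨?_, P + 1, fun p hp => ?_, ?_⟩
  · rw [coweight_E, hr, zero_add, map_smul, Int.cast_add, Int.cast_one, add_smul, one_smul]
  · obtain ⟨p, rfl⟩ := Nat.exists_eq_add_of_le' (Nat.le_trans (Nat.le_add_left 1 P) hp)
    rw [deltaPart_E, hP p (by omega), hP (p + 1) (by omega), map_zero, map_zero, add_zero]
  -- The twisted current is `x₁ E(x₁)`, and `x₁ = x₂ + (x₁ - x₂)` splits the product into two terms,
  -- which match the two terms of `deltaPart_E`.
  · have key (f : Fld W) (s : ℤ) : fprod (-1) (cur hρ.twist E) (shift s f) =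
        shift (s + 1) (fprod (-1) (cur hρ E) f) + shift s (fprod 0 (cur hρ E) f) := by
      rw [cur_twist_E hρ, bor_shift]
      refine Fld.ext fun n w => ?_
      have h1 := bor_succ (cur hρ E) f (-1) 0 (n + s) w
      rw [neg_add_cancel] at h1
      rw [Fld.add_apply, shift_apply, shift_apply, shift_apply, h1, ← add_assoc n s 1]
      exact (add_sub_cancel _ _).symm
    rw [h'.map_op, fldRep_op, hY, map_sum, Finset.sum_range_succ']
    simp only [key, Finset.sum_add_distrib, deltaPart_E, map_add, deltaPart_zero,
      Module.End.one_apply]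
    have e1 := Finset.sum_range_succ
      (fun p : ℕ => shift (r + 1 - p) (Y (σ.op (-1) E (σ.deltaPart p v)))) P
    rw [hP P le_rfl, map_zero, map_zero, map_zero, add_zero, Finset.sum_range_succ', deltaPart_zero,
      Module.End.one_apply] at e1
    rw [add_right_comm, e1]
    congr 1
    · exact Finset.sum_congr rfl fun p _ => by
        rw [h.map_op, fldRep_op, show r - (p : ℤ) + 1 = r + 1 - p by ring]
    · exact Finset.sum_congr rfl fun p _ => by
        rw [h.map_op, fldRep_op, neg_add_cancel, Nat.cast_add, Nat.cast_one,
          add_sub_add_right_eq_sub]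

/-- The twisted current is `x₁⁻¹ F(x₁)`, and `x₁⁻¹` expands as the geometric series of `(-1)^i (x₁ -
x₂)^i x₂^(-1-i)`. Its terms match the series of `deltaPart_F` after regrouping along diagonals. -/
theorem TwistedField.F_zero (hσ : σ.Restricted) (hc : σ.cyc v₀ = ⊤) (h : IsStateField σ v₀ hρ Y)
    (h' : IsStateField σ v₀ hρ.twist Y') {r : ℤ} {v : V} (hv : TwistedField σ Y Y' r v) :
    TwistedField σ Y Y' (r - 1) (σ.op 0 F v) := by
  obtain ⟨hr, P, hP, hY⟩ := hv
  have hK : ∀ᶠ K : ℕ in Filter.atTop, ∀ p ∈ Finset.range P,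
      (bor 0 (-1) (cur hρ F) (Y (σ.deltaPart p v)) = ∑ i ∈ Finset.range K,
        ch (-1) i • shift (-1 - i) (Y (σ.op (0 + i) F (σ.deltaPart p v)))) ∧
      ∀ i : ℕ, K ≤ i → σ.op (0 + i) F (σ.deltaPart p v) = 0 := by
    refine (Filter.eventually_all_finset _).2 fun p _ => (h.eventually_bor_eq hc F _ 0 (-1)).and ?_
    obtain ⟨N, hN⟩ := hσ F (σ.deltaPart p v)
    filter_upwards [Filter.eventually_ge_atTop N.toNat] with K hK i hi
    exact hN _ (by omega)
  obtain ⟨K, hK⟩ := hK.exists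
  have hI (i p : ℕ) (hi : K ≤ i) : σ.op (0 + i) F (σ.deltaPart p v) = 0 := by
    by_cases hp : p < P
    · exact (hK p (Finset.mem_range.2 hp)).2 i hi
    · rw [hP p (not_lt.1 hp), map_zero]
  refine ⟨?_, K + P, fun s hs => ?_, ?_⟩
  · rw [coweight_F, hr, zero_add, map_smul, Int.cast_sub, Int.cast_one, sub_smul, one_smul]
  · rw [deltaPart_F]
    refine Finset.sum_eq_zero fun q hq => ?_
    have := mem_antidiagonal.1 hq
    by_cases hq1 : K ≤ q.1
    · rw [hI _ _ hq1, smul_zero]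
    · rw [hP q.2 (by omega), map_zero, smul_zero]
  · rw [h'.map_op, fldRep_op, hY, map_sum]
    calc _ = ∑ p ∈ Finset.range P, ∑ i ∈ Finset.range K,
          (-1 : ℂ) ^ i • shift (r - 1 - (i + p : ℕ)) (Y (σ.op (0 + i) F (σ.deltaPart p v))) := by
          refine Finset.sum_congr rfl fun p hp => ?_
          rw [cur_twist_F hρ, bor_shift, zero_add, (hK p hp).1, map_sum]
          refine Finset.sum_congr rfl fun i _ => ?_
          rw [map_smul, shift_shift, ch_neg_one,
            show r - (p : ℤ) + (-1 - i) = r - 1 - (i + p : ℕ) by push_cast; ring]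
      _ = _ := by
          rw [← sum_range_antidiagonal (fun i p => (-1 : ℂ) ^ i •
            shift (r - 1 - (i + p : ℕ)) (Y (σ.op (0 + i) F (σ.deltaPart p v))))
            (fun i p hi => by rw [hI i p hi, map_zero, map_zero, smul_zero])
            (fun i p hp => by rw [hP p hp, map_zero, map_zero, map_zero, smul_zero])]
          refine Finset.sum_congr rfl fun s _ => ?_
          rw [deltaPart_F, map_sum, map_sum]
          refine Finset.sum_congr rfl fun q hq => ?_
          rw [mem_antidiagonal.1 hq, map_smul, map_smul]

theorem mem_span_twistedField {μ : ℂ} (hw : σ.HW μ v₀) (hc : σ.cyc v₀ = ⊤)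
    (h0 : ∀ (m : ℤ) (a : sl2), 0 ≤ m → σ.op m a v₀ = 0)
    (h : IsStateField σ v₀ hρ Y) (h' : IsStateField σ v₀ hρ.twist Y') (v : V) :
    v ∈ Submodule.span ℂ {v | ∃ r, TwistedField σ Y Y' r v} := by
  refine hw.mem_of_words hc (N := Submodule.span ℂ {v | ∃ r, TwistedField σ Y Y' r v})
    (Submodule.subset_span ⟨0, TwistedField.vac h0 h h'⟩) (fun x hx => ?_)
    (fun x hx => ?_) v
  · refine (Submodule.span_le (p := (Submodule.span ℂ _).comap (σ.op 0 F))).2 ?_ hx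
    rintro x ⟨r, hr⟩
    exact Submodule.subset_span ⟨_, hr.F_zero (hw.restricted hc) hc h h'⟩
  · refine (Submodule.span_le (p := (Submodule.span ℂ _).comap (σ.op (-1) E))).2 ?_ hx
    rintro x ⟨r, hr⟩
    exact Submodule.subset_span ⟨_, hr.E_neg_one h h'⟩

variable {τ : Affine →ₗ⁅ℂ⁆ Module.End ℂ V}

theorem deltaSeries_coweight (hτ : ∀ m a, τ (loop a m) = σ.op m a) :
    deltaSeries τ coweight = σ.deltaExp := by
  simp only [deltaSeries, deltaExp, hτ]

theorem deltaCoeff_eq (hτ : ∀ m a, τ (loop a m) = σ.op m a) (q : ℤ) (v : V) :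
    deltaCoeff τ coweight q v =
      ∑ᶠ p : ℕ, eigenComponent (σ.op 0 coweight) ((q + p : ℤ) : ℂ) (σ.deltaPart p v) := by
  rw [deltaCoeff, deltaSeries_coweight hτ, hτ]
  rfl

theorem eigenComponent_deltaPart {r : ℤ} {v : V} (hr : σ.op 0 coweight v = (r : ℂ) • v) (q : ℤ)
    (p : ℕ) : eigenComponent (σ.op 0 coweight) ((q + p : ℤ) : ℂ) (σ.deltaPart p v) =
      if r = q + p then σ.deltaPart p v else 0 := by
  rw [eigenComponent_of_mem _ _ r _ (by rw [deltaPart_H, hr, map_smul])]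
  simp only [Int.cast_inj]

theorem deltaCoeff_sub (hτ : ∀ m a, τ (loop a m) = σ.op m a) {r : ℤ} {v : V}
    (hr : σ.op 0 coweight v = (r : ℂ) • v) (p : ℕ) :
    deltaCoeff τ coweight (r - p) v = σ.deltaPart p v := by
  rw [deltaCoeff_eq hτ, finsum_eq_single _ p fun s hs => by
    rw [eigenComponent_deltaPart hr, if_neg (by omega)], eigenComponent_deltaPart hr,
    if_pos (by ring)]

theorem deltaCoeff_of_lt (hτ : ∀ m a, τ (loop a m) = σ.op m a) {r : ℤ} {v : V}
    (hr : σ.op 0 coweight v = (r : ℂ) • v) {q : ℤ} (hq : r < q) :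
    deltaCoeff τ coweight q v = 0 := by
  rw [deltaCoeff_eq hτ, finsum_eq_zero_of_forall_eq_zero fun p => ?_]
  rw [eigenComponent_deltaPart hr, if_neg (by omega)]

theorem deltaCoeff_add (hτ : ∀ m a, τ (loop a m) = σ.op m a) {u v : V}
    (hu : (Function.support fun p => σ.deltaPart p u).Finite)
    (hv : (Function.support fun p => σ.deltaPart p v).Finite) (q : ℤ) :
    deltaCoeff τ coweight q (u + v) = deltaCoeff τ coweight q u + deltaCoeff τ coweight q v := by
  rw [deltaCoeff_eq hτ, deltaCoeff_eq hτ, deltaCoeff_eq hτ, ← finsum_add_distrib]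
  · simp only [map_add]
  · exact hu.subset fun p hp h => hp (by dsimp only at h ⊢; rw [h, map_zero])
  · exact hv.subset fun p hp h => hp (by dsimp only at h ⊢; rw [h, map_zero])

theorem deltaCoeff_smul (hτ : ∀ m a, τ (loop a m) = σ.op m a) (c : ℂ) (v : V) (q : ℤ) :
    deltaCoeff τ coweight q (c • v) = c • deltaCoeff τ coweight q v := by
  rw [deltaCoeff_eq hτ, deltaCoeff_eq hτ, smul_finsum]
  simp only [map_smul]

theorem deltaCoeff_zero (hτ : ∀ m a, τ (loop a m) = σ.op m a) (q : ℤ) :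
    deltaCoeff τ coweight q (0 : V) = 0 := by
  simpa using deltaCoeff_smul hτ 0 (0 : V) q

/-- Li's formula for the twisted field map. -/
theorem IsStateField.twist_eq {μ : ℂ} (hw : σ.HW μ v₀) (hc : σ.cyc v₀ = ⊤)
    (h0 : ∀ (m : ℤ) (a : sl2), 0 ≤ m → σ.op m a v₀ = 0)
    (h : IsStateField σ v₀ hρ Y) (h' : IsStateField σ v₀ hρ.twist Y')
    (hτ : ∀ m a, τ (loop a m) = σ.op m a) (v : V) (m : ℤ) :
    (Y' v).1 m = ∑ᶠ q : ℤ, (Y (deltaCoeff τ coweight q v)).1 (m + q) := by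
  -- The two finiteness conditions are carried along because a `finsum` is additive only for finite
  -- supports.
  let N : Submodule ℂ V :=
    { carrier := {v | (Function.support fun p => σ.deltaPart p v).Finite ∧
        (Function.support fun q => deltaCoeff τ coweight q v).Finite ∧
        Y' v = ∑ᶠ q : ℤ, shift q (Y (deltaCoeff τ coweight q v))}
      zero_mem' := by
        simp [deltaCoeff_zero hτ]
      add_mem' := by
        rintro u v ⟨hu, hu', hu''⟩ ⟨hv, hv', hv''⟩
        refine ⟨(hu.union hv).subset ?_, (hu'.union hv').subset ?_, ?_⟩
        · simp only [map_add]
          exact Function.support_add _ _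
        · simp only [deltaCoeff_add hτ hu hv]
          exact Function.support_add _ _
        · simp only [deltaCoeff_add hτ hu hv, map_add]
          rw [hu'', hv'', finsum_add_distrib]
          · exact hu'.subset fun q hq h => hq (by dsimp only at h ⊢; rw [h, map_zero, map_zero])
          · exact hv'.subset fun q hq h => hq (by dsimp only at h ⊢; rw [h, map_zero, map_zero])
      smul_mem' := by
        rintro c v ⟨hv, hv', hv''⟩
        refine ⟨hv.subset ?_, hv'.subset ?_, ?_⟩
        · simp only [map_smul]
          exact Function.support_const_smul_subset c _
        · simp only [deltaCoeff_smul hτ]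
          exact Function.support_const_smul_subset c _
        · simp only [deltaCoeff_smul hτ, map_smul]
          rw [hv'', smul_finsum] }
  have hN : Submodule.span ℂ {v | ∃ r, TwistedField σ Y Y' r v} ≤ N := by
    refine Submodule.span_le.2 ?_
    rintro v ⟨r, hr, P, hP, hY⟩
    -- For a coweight eigenvector of eigenvalue `r`, the exponent `q = r - p` receives exactly the
    -- `p`-th part of the exponential, and only finitely many parts are nonzero.
    have hq (q : ℤ) (h : deltaCoeff τ coweight q v ≠ 0) :
        q ∈ (Finset.range P).image fun p : ℕ => r - p := by
      have h1 : q ≤ r := not_lt.1 fun h1 => h (deltaCoeff_of_lt hτ hr h1)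
      have h2 : q = r - (r - q).toNat := by omega
      refine Finset.mem_image.2 ⟨(r - q).toNat, Finset.mem_range.2 (not_le.1 fun h3 => h ?_), h2.symm⟩
      rw [h2, deltaCoeff_sub hτ hr, hP _ h3]
    refine ⟨(Finset.range P).finite_toSet.subset fun p hp => ?_,
      (Finset.finite_toSet _).subset hq, ?_⟩
    · exact Finset.mem_coe.2 (Finset.mem_range.2 (not_le.1 fun h => hp (hP p h)))
    · rw [finsum_eq_sum_of_support_subset _ fun q h => hq q fun h1 => h (by
        rw [h1, map_zero, map_zero]), Finset.sum_image fun p _ p' _ h => by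
        omega, hY]
      exact Finset.sum_congr rfl fun p _ => by rw [deltaCoeff_sub hτ hr]
  obtain ⟨-, hf, hY⟩ := hN (mem_span_twistedField hw hc h0 h h' v)
  change modeHom m (Y' v) = _
  rw [hY, AddMonoidHom.map_finsum]
  · rfl
  · exact hf.subset fun q hq h => hq (by dsimp only at h ⊢; rw [h, map_zero, map_zero])

end twistedField

end AffRep

open AffRep

theorem IsFieldMap.isTwist {k : ℕ} {W : Type*} [AddCommGroup W] [Module ℂ W]
    {ρ : AffRep (k : ℂ) W} {hρ : ρ.Restricted} {𝒱 : VertexAlgebra (L k 0)}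
    (h𝒱 : IsAffineVertexAlgebra k 𝒱) {M : VertexModule 𝒱 W}
    (hM : IsFieldMap hρ (ofVertexOperator ∘ₗ M.Y)) {Y : L k 0 →ₗ[ℂ] Fld W}
    (h : IsFieldMap hρ.twist Y) : IsTwist coweight M (IsFieldMap.vertexModule h𝒱 h) := by
  intro v m
  rw [IsFieldMap.vertexModule_mode]
  exact hM.twist_eq (lRep_hw_zero k) (lRep_cyc k 0) (op_hwVec_zero k) h
    (fun m a => (lRep_op k 0 m a).symm) v m

end AffineSl2

end

/-! ### Existence of the modules, and the twist of a given module structure. -/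

noncomputable section

namespace AffineSl2

open AffRep

section modules

variable {k n : ℕ} {𝒱 : VertexAlgebra (L k 0)}

theorem exists_isAffineVertexModule (h𝒱 : IsAffineVertexAlgebra k 𝒱) (hn : n ≤ k) :
    ∃ M : VertexModule 𝒱 (L k n), IsAffineVertexModule M := by
  obtain ⟨Y, hY⟩ := exists_isFieldMap (lRep_restricted k n) (lRep_hw k n) (lRep_cyc k n)
    (lRep_irr k n) hn
  refine ⟨IsFieldMap.vertexModule h𝒱 hY, fun a m => ?_⟩
  rw [IsFieldMap.vertexModule_mode, IsFieldMap.map_gen hY]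
  rfl

theorem IsAffineVertexModule.isFieldMap (h𝒱 : IsAffineVertexAlgebra k 𝒱)
    {M : VertexModule 𝒱 (L k n)} (hM : IsAffineVertexModule M) :
    IsFieldMap (lRep_restricted k n) (ofVertexOperator ∘ₗ M.Y) :=
  isFieldMap_of_module h𝒱 M.vac_mode M.jacobi hM

theorem isHighestWeightVector_twist (h𝒱 : IsAffineVertexAlgebra k 𝒱)
    {M : VertexModule 𝒱 (L k n)} (hM : IsAffineVertexModule M) {Y : L k 0 →ₗ[ℂ] Fld (L k n)}
    (hY : IsFieldMap (lRep_restricted k n).twist Y) {κ μ : ℂ} {v : L k n}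
    (hv : M.IsHighestWeightVector κ μ v) :
    (IsFieldMap.vertexModule h𝒱 hY).IsHighestWeightVector (k : ℂ) ((k : ℂ) - (n : ℂ))
      (((lRep k n).op 0 F ^ n) v) := by
  obtain ⟨hv0, hv⟩ := lRep_hw_of_isHighestWeightVector hM hv
  exact IsFieldMap.isHighestWeightVector h𝒱 hY
    (hv.twist (lRep_irr k n) (level_add_two_ne_zero k)) (hv.F_pow_ne_zero hv0)

/-- The twist of `L(k, n)` by the fundamental coweight is `L(k, k - n)`. -/
theorem exists_isTwist (h𝒱 : IsAffineVertexAlgebra k 𝒱) (hn : n ≤ k) {M : VertexModule 𝒱 (L k n)}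
    {M' : VertexModule 𝒱 (L k (k - n))} (hM : IsAffineVertexModule M)
    (hM' : IsAffineVertexModule M') : ∃ N : VertexModule 𝒱 (L k n), IsTwist coweight M N ∧
      N.Isomorphic M' ∧ ∀ (κ μ : ℂ) (v : L k n), M.IsHighestWeightVector κ μ v →
        N.IsHighestWeightVector (k : ℂ) ((k : ℂ) - (n : ℂ)) ((act (L k n) (loop F 0) ^ n) v) := by
  obtain ⟨Y, hY⟩ := exists_isFieldMap_twist hn
  obtain ⟨f, hf⟩ := exists_equiv_twist hn
  have h1 := IsFieldMap.isTwist h𝒱 (hM.isFieldMap h𝒱) hY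
  have h2 := IsFieldMap.isomorphic h𝒱 hY (hM'.isFieldMap h𝒱) f hf
  refine ⟨IsFieldMap.vertexModule h𝒱 hY, h1, h2, fun κ μ v hv => ?_⟩
  rw [← lRep_op]
  exact isHighestWeightVector_twist h𝒱 hM hY hv

end modules

end AffineSl2

end


theorem theorem3p1 (k : ℕ) (hk : 0 < k) :
    (∃ 𝒱 : AffineSl2.VertexAlgebra (AffineSl2.L k 0), AffineSl2.IsAffineVertexAlgebra k 𝒱) ∧
    ∀ 𝒱 : AffineSl2.VertexAlgebra (AffineSl2.L k 0), AffineSl2.IsAffineVertexAlgebra k 𝒱 →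
      (∀ n : ℕ, n ≤ k → ∃ M : AffineSl2.VertexModule 𝒱 (AffineSl2.L k n),
        AffineSl2.IsAffineVertexModule M) ∧
      ∀ n : ℕ, n ≤ k →
        ∀ (M : AffineSl2.VertexModule 𝒱 (AffineSl2.L k n))
          (M' : AffineSl2.VertexModule 𝒱 (AffineSl2.L k (k - n))),
          AffineSl2.IsAffineVertexModule M → AffineSl2.IsAffineVertexModule M' →
          ∃ N : AffineSl2.VertexModule 𝒱 (AffineSl2.L k n),
            AffineSl2.IsTwist AffineSl2.coweight M N ∧
            N.Isomorphic M' ∧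
            ∀ (κ μ : ℂ) (v : AffineSl2.L k n), M.IsHighestWeightVector κ μ v →
              N.IsHighestWeightVector (k : ℂ) ((k : ℂ) - (n : ℂ))
                ((AffineSl2.act (AffineSl2.L k n) (AffineSl2.loop AffineSl2.F 0) ^ n) v) := by
  refine ⟨?_, fun 𝒱 h𝒱 => ⟨fun n hn => AffineSl2.exists_isAffineVertexModule h𝒱 hn,
    fun n hn M M' hM hM' => AffineSl2.exists_isTwist h𝒱 hn hM hM'⟩⟩
  obtain ⟨Y, hY⟩ := AffineSl2.exists_fieldMap_L k
  exact ⟨_, AffineSl2.IsFieldMap.isAffineVertexAlgebra hY⟩
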